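/- **Model.** For each $n$ let $X_t=f_t+\varepsilon_t$, $1\le t\le n$, with $f_t=f_0+\sum_{j=1}^{q_n}d_j\,\mathbb I\{t\ge k_j+1\}$, where $0=k_0<k_1<\dots<k_{q_n}<k_{q_n+1}=n$ and $d_j\neq 0$; $q_n\ge 0$, $f_0$, $k_j$, $d_j$ may depend on $n$. Put $\delta_j=\min(k_j-k_{j-1},k_{j+1}-k_j)$ and $D_n=\min_{1\le j\le q_n}d_j^2\delta_j$ ($D_n=\infty$ if $q_n=0$). Assume $\max_j|d_j|=O(1)$ and $\min_j\delta_j\to\infty$. **Errors.** $(\varepsilon_t)_{t\ge1}$ is ergodic, $E\varepsilon_t=0$ and $0<c\le\mathrm{Var}(\varepsilon_t)\le C<\infty$. (Ergodic means here: for all $m$ and every continuous $g:\mathbb R^m\to\mathbb R$ of at most quadratic growth, $\frac1n\sum_{t=1}^n\{g(\varepsilon_t,\dots,\varepsilon_{t+m-1})-E g(\varepsilon_t,\dots,\varepsilon_{t+m-1})\}\to0$ in probability; for strictly stationary sequences this is ordinary ergodicity.) There are sequences $\omega_n,\omega_n^{(1)},\omega_n^{(2)}$ with $\sqrt{\log n}=O(\omega_n)$,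 $P(\mathcal M_n^{(11)})\to1$, and $P(\mathcal M_n^{(12)}\cap\mathcal M_n^{(13)})\to1$ for all sequences $1\le a_n,b_n\le D_n$, where - $\mathcal M_n^{(11)}$: $(e-s)^{-1/2}\big|\sum_{t=s+1}^e\varepsilon_t\big|\le\omega_n$ for all $0\le s<e\le n$; - $\mathcal M_n^{(12)}$: for all $1\le j\le q_n$ one has $\frac{\sqrt{d_j^{-2}a_n}}{\ell}\big|\sum_{t=k_j-\ell+1}^{k_j}\varepsilon_t\big|\le\omega_n^{(1)}$ for $d_j^{-2}a_n\le\ell\le k_j-k_{j-1}$ and $\frac{\sqrt{d_j^{-2}a_n}}{\ell}\big|\sum_{t=k_j+1}^{k_j+\ell}\varepsilon_t\big|\le\omega_n^{(1)}$ for $d_j^{-2}a_n\le\ell\le k_{j+1}-k_j$; - $\mathcal M_n^{(13)}$: for all $1\le j\le q_n$ and $1\le\ell\le d_j^{-2}b_n$, $\big|\sum_{t=k_j-\ell+1}^{k_j}\varepsilon_t\big|\le\omega_n^{(2)}\sqrt{d_j^{-2}b_n}$ and $\big|\sum_{t=k_j+1}^{k_j+\ell}\varepsilon_t\big|\le\omega_n^{(2)}\sqrt{d_j^{-2}b_n}$.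 **Jump size and penalty.** $\omega_n^2/D_n\to0$; $\xi_n>0$, $\xi_n/D_n\to0$ and $\omega_n^2/\xi_n\to0$. **Candidates.** $\mathcal K_n\subset\{1,\dots,n-1\}$ is a (random) set of $Q_n$ candidates with $n^{-1}\omega_n^2Q_n\to0$ in probability, and $P(\mathcal M_n^{(2)})\to1$ for $\mathcal M_n^{(2)}=\{\max_j\min_{c\in\mathcal K_n}d_j^2|c-k_j|\le\rho_n\}$, where $\max(\omega_n^{(1)},\omega_n^{(2)})^2=O(\rho_n)$ and $\rho_n=O(\omega_n^2)$. Each $c\in\mathcal K_n$ has a detection interval $(c-G_L(c),c+G_R(c)]$ with integers $G_L(c),G_R(c)\ge0$. **Detection intervals.** Let $\nu_n\to\infty$ slowly, i.e. $\rho_n\nu_n/\xi_n\to0$ and (automatic if $\rho_n$ is bounded away from $0$) $\rho_n\nu_n\ge1$ for large $n$. There is $\kappa_n\to0$ such that, with probability tending to one, for each $j$ there is $c\in\mathcal K_n$ with $d_j^2|c-k_j|\le\rho_n\nu_n$ and $\xi_n\le\kappa_n\,d_j^2\min\{G_L(c),G_R(c)\}$. **Algorithm.** For $\mathcal A\subset\{1,\dots,n-1\}$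 let $\mathrm{RSS}(\mathcal A)$ be the residual sum of squares of $X_1,\dots,X_n$ about the segment means of the segmentation with break points $\mathcal A$. LocAlg, with any sorting function $h$, starts with accepted set $\widehat{\mathcal K}=\emptyset$ and active set $\mathcal C=\mathcal K_n$ and repeats the following until $\mathcal C=\emptyset$. 1. Choose $c_\circ\in\mathcal C$ maximising $h$ over $\mathcal C$ (ties broken arbitrarily). 2. Let $c_L$ be the largest $c<c_\circ$ which is in $\widehat{\mathcal K}\cup\{0\}$ or is in $\mathcal C$ with $c_\circ-c\ge G_R(c)+G_L(c_\circ)$; let $c_R$ be the smallest $c>c_\circ$ which is in $\widehat{\mathcal K}\cup\{n\}$ or is in $\mathcal C$ with $c-c_\circ\ge G_R(c_\circ)+G_L(c)$. Put $\mathcal D=\mathcal C\cap(c_L,c_R)$. 3. (PrunAlg) For $\mathcal A\subset\mathcal D$ let $\mathrm{SC}(\mathcal A)=\frac n2\log\frac{\mathrm{RSS}(\mathcal A\cup\widehat{\mathcal K}\cup(\mathcal C\setminus\mathcal D))}{n}+(|\mathcal A|+|\widehat{\mathcal K}|+|\mathcal C\setminus\mathcal D|)\xi_n$. Let $\mathcal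 F$ be the family of $\mathcal A\subset\mathcal D$ such that $\mathrm{SC}(\mathcal B)\le\mathrm{SC}(\mathcal B\cup\{c\})$ whenever $\mathcal A\subset\mathcal B\subset\mathcal D$ and $c\in\mathcal D\setminus\mathcal B$, and $m^*=\min_{\mathcal A\in\mathcal F}|\mathcal A|$. Let $\widehat{\mathcal A}$ minimise $\mathrm{SC}$ over all sets obtained from some $\mathcal A'\in\mathcal F$ with $m^*\le|\mathcal A'|\le m^*+2$ by deleting none, one or both of its smallest and largest elements; among minimisers take one of minimal cardinality (remaining ties broken arbitrarily). 4. Let $\mathcal R$ consist of $c_\circ$ and, if $\widehat{\mathcal A}\ne\emptyset$, of $\mathcal D\cap[\min\widehat{\mathcal A},\max\widehat{\mathcal A}]$, of $\mathcal D\cap(c_L,\min\widehat{\mathcal A})$ if $c_L\in\widehat{\mathcal K}\cup\{0\}$, and of $\mathcal D\cap(\max\widehat{\mathcal A},c_R)$ if $c_R\in\widehat{\mathcal K}\cup\{n\}$. Replace $\widehat{\mathcal K}$ by $\widehat{\mathcal K}\cup\widehat{\mathcal A}$ and $\mathcal C$ by $\mathcal C\setminus\mathcal R$. The output is the final $\widehat{\mathcal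 K}=\{\hat k_1<\dots<\hat k_{\hat q_n}\}$. **Theorem.** Under these assumptions, let $K>1$ and let $\nu_n'$ be any sequence with $\nu_n'\ge K\nu_n$ for large $n$. Then, with $\mathcal M_n=\mathcal M_n^{(11)}\cap\mathcal M_n^{(12)}\cap\mathcal M_n^{(13)}\cap\mathcal M_n^{(2)}$ (for any admissible $a_n,b_n$), $$P\Big\{\hat q_n=q_n;\ \max_{1\le j\le q_n}d_j^2\,\big|\hat k_j\,\mathbb I\{j\le\hat q_n\}-k_j\big|\le\rho_n\nu_n'\Big\}\ \ge\ P(\mathcal M_n)+o(1)\ \to\ 1,$$ where the event on the left is understood to hold for every sorting function $h$ fixed in advance (possibly depending on the data) and simultaneously for all ways of breaking ties, and to include that the algorithm has an output. -/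

import Mathlib

open MeasureTheory ProbabilityTheory Filter Topology Asymptotics
open scoped ENNReal

namespace LocPrune

noncomputable section

/-! ### Probability conventions -/

/-- The events `E n` hold with probability tending to one. Formulated through (outer) measures of
the complements, so that nothing has to be measurable; for measurable events it is the same as
`μ (E n) → 1`. -/
def WithProbTendingToOne {Ω : Type*} [MeasurableSpace Ω] (μ : Measure Ω)
    (E : ℕ → Set Ω) : Prop :=
  Tendsto (fun n => μ (E n)ᶜ) atTop (𝓝 0)

/-- Ergodicity of a (possibly non-stationary) square-integrable sequence `ε 1, ε 2, …`: time
averages agree asymptotically with ensemble averages, for every continuous observable of at most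
quadratic growth that depends on finitely many consecutive variables. A strictly stationary
sequence with finite variance has this property if and only if it is ergodic in the usual sense
(shift-invariant events have probability zero or one). -/
def IsErgodicSequence {Ω : Type*} [MeasurableSpace Ω] (μ : Measure Ω) (ε : ℕ → Ω → ℝ) : Prop :=
  ∀ (m : ℕ) (g : (Fin m → ℝ) → ℝ), Continuous g →
    (∃ B : ℝ, ∀ x, |g x| ≤ B * (1 + ∑ i, x i ^ 2)) →
    TendstoInMeasure μ
      (fun (n : ℕ) ω => (∑ t ∈ Finset.Icc 1 n,
        (g (fun i => ε (t + i) ω) - ∫ ω', g (fun i => ε (t + i) ω') ∂μ)) / (n : ℝ))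
      atTop (fun _ => 0)

/-! ### The change point model -/

/-- The deterministic part of the model for one sample size: the number `q` of change points, the
change points `cp 1 < ⋯ < cp q` (with `cp 0 = 0` and `cp (q + 1) = n`), the jumps
`d 1, …, d q` and the initial level `f₀`. Other values of `cp` and `d` are irrelevant. -/
structure MeanModel where
  q : ℕ
  cp : ℕ → ℕ
  d : ℕ → ℝ
  f₀ : ℝ

namespace MeanModel

/-- `S` describes a piecewise constant mean on `{1, …, n}`. -/
def IsValid (S : MeanModel) (n : ℕ) : Prop :=
  S.cp 0 = 0 ∧ S.cp (S.q + 1) = n ∧ (∀ j ≤ S.q, S.cp j < S.cp (j + 1)) ∧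
    ∀ j ∈ Finset.Icc 1 S.q, S.d j ≠ 0

/-- The mean `f_t = f₀ + ∑_j d_j 1{t ≥ k_j + 1}`. -/
def mean (S : MeanModel) (t : ℕ) : ℝ :=
  S.f₀ + ∑ j ∈ Finset.Icc 1 S.q, if S.cp j + 1 ≤ t then S.d j else 0

/-- `δ_j = min (k_j - k_{j-1}) (k_{j+1} - k_j)`, for `1 ≤ j ≤ q`. -/
def delta (S : MeanModel) (j : ℕ) : ℕ :=
  min (S.cp j - S.cp (j - 1)) (S.cp (j + 1) - S.cp j)

/-- `D = min_{1 ≤ j ≤ q} d_j² δ_j`, equal to `∞` if there is no change point. -/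
def D (S : MeanModel) : ℝ≥0∞ :=
  ⨅ j ∈ Finset.Icc 1 S.q, ENNReal.ofReal (S.d j ^ 2 * S.delta j)

/-- The observation `X_t = f_t + ε_t`. -/
def obs {Ω : Type*} (S : MeanModel) (ε : ℕ → Ω → ℝ) (ω : Ω) (t : ℕ) : ℝ :=
  S.mean t + ε t ω

end MeanModel

/-! ### The localised pruning algorithm -/

/-- Sample mean of `x_{s+1}, …, x_e`. -/
def segMean (x : ℕ → ℝ) (s e : ℕ) : ℝ :=
  (∑ t ∈ Finset.Ioc s e, x t) / ((e : ℝ) - s)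

/-- The smallest element of `A ∪ {n}` that is larger than `s` (used for `s < n`). -/
def nextPoint (n : ℕ) (A : Finset ℕ) (s : ℕ) : ℕ :=
  sInf {u : ℕ | (u ∈ A ∨ u = n) ∧ s < u}

/-- Residual sum of squares of `x_1, …, x_n` for the segmentation given by `A ⊆ {1, …, n - 1}`: the
segments are `(s, nextPoint s]` with `s ∈ A ∪ {0}`. -/
def RSS (n : ℕ) (x : ℕ → ℝ) (A : Finset ℕ) : ℝ :=
  ∑ s ∈ insert 0 A, ∑ t ∈ Finset.Ioc s (nextPoint n A s),
    (x t - segMean x s (nextPoint n A s)) ^ 2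

/-- The Schwarz criterion `SC(A | C, Khat, c_L, c_R)` of a set `A ⊆ D` of local candidates, where
`D` is the set of active candidates in `(c_L, c_R)`, `C` is the set of all active candidates and
`Khat` is the set of accepted candidates. -/
def SC (n : ℕ) (x : ℕ → ℝ) (ξ : ℝ) (D C Khat : Finset ℕ) (A : Finset ℕ) : ℝ :=
  (n : ℝ) / 2 * Real.log (RSS n x (A ∪ Khat ∪ (C \ D)) / n) +
    ((A.card : ℝ) + Khat.card + (C \ D).card) * ξ

/-- Criterion (C1), for a criterion `sc` on the subsets of `D`: adding further candidates to `A`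
increases `sc` monotonically. -/
def MonotoneAbove (D : Finset ℕ) (sc : Finset ℕ → ℝ) (A : Finset ℕ) : Prop :=
  A ⊆ D ∧ ∀ B, A ⊆ B → B ⊆ D → ∀ c ∈ D \ B, sc B ≤ sc (insert c B)

/-- `A ⊂_R A'`: the set `A` arises from `A'` by removing none, one or both of the smallest and the
largest element of `A'`. -/
def InnerSubset (A A' : Finset ℕ) : Prop :=
  A ⊆ A' ∧ ∀ c ∈ A', (∃ a ∈ A', a < c) → (∃ b ∈ A', c < b) → c ∈ A

/-- `m*`, the smallest cardinality of a set that fulfils (C1). -/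
def minCard (D : Finset ℕ) (sc : Finset ℕ → ℝ) : ℕ :=
  sInf {m : ℕ | ∃ A, MonotoneAbove D sc A ∧ A.card = m}

/-- The search family of criterion (C2). -/
def SearchFamily (D : Finset ℕ) (sc : Finset ℕ → ℝ) (A : Finset ℕ) : Prop :=
  ∃ A', MonotoneAbove D sc A' ∧ minCard D sc ≤ A'.card ∧ A'.card ≤ minCard D sc + 2 ∧
    InnerSubset A A'

/-- `Ahat` is a possible output of the inner algorithm: it minimises `sc` over the search family
and, among the minimisers, has minimal cardinality (remaining ties are broken arbitrarily). -/
def IsPrunAlgOutput (D : Finset ℕ) (sc : Finset ℕ → ℝ) (Ahat : Finset ℕ) : Prop :=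
  SearchFamily D sc Ahat ∧ (∀ A, SearchFamily D sc A → sc Ahat ≤ sc A) ∧
    ∀ A, SearchFamily D sc A → sc A = sc Ahat → Ahat.card ≤ A.card

/-- `c` may serve as left end point of the local environment of `c₀`: it is accepted, or zero, or an
active candidate whose detection interval `(c - gL c, c + gR c]` lies to the left of that
of `c₀`. -/
def LeftBoundary (gL gR : ℕ → ℕ) (C Khat : Finset ℕ) (c₀ c : ℕ) : Prop :=
  c < c₀ ∧ (c ∈ Khat ∨ c = 0 ∨ (c ∈ C ∧ c + gR c + gL c₀ ≤ c₀))

/-- The mirror image of `LeftBoundary`. -/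
def RightBoundary (n : ℕ) (gL gR : ℕ → ℕ) (C Khat : Finset ℕ) (c₀ c : ℕ) : Prop :=
  c₀ < c ∧ (c ∈ Khat ∨ c = n ∨ (c ∈ C ∧ c₀ + gR c₀ + gL c ≤ c))

open Classical in
/-- The set of candidates for which a decision is reached in one iteration: `c₀` itself, the
candidates of `D` between two elements of `Ahat` (or in `Ahat`), those of `D` to the left of all
elements of a non-empty `Ahat` if the left end point is accepted or zero, and likewise on the
right. -/
def decided (n : ℕ) (Khat D Ahat : Finset ℕ) (c₀ cL cR : ℕ) : Finset ℕ :=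
  insert c₀ (D.filter fun c =>
    ((∃ a ∈ Ahat, a ≤ c) ∧ ∃ b ∈ Ahat, c ≤ b) ∨
    ((cL ∈ Khat ∨ cL = 0) ∧ Ahat.Nonempty ∧ ∀ a ∈ Ahat, c < a) ∨
    ((cR ∈ Khat ∨ cR = n) ∧ Ahat.Nonempty ∧ ∀ a ∈ Ahat, a < c))

/-- One iteration of the outer algorithm. A state is a pair (accepted candidates, active
candidates); the iteration picks any active candidate `c₀` that maximises `h` (so that every
tie-breaking rule is covered). -/
def LocAlgStep (n : ℕ) (x : ℕ → ℝ) (ξ : ℝ) (gL gR : ℕ → ℕ) (h : ℕ → ℝ)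
    (σ τ : Finset ℕ × Finset ℕ) : Prop :=
  ∃ c₀ ∈ σ.2, (∀ c ∈ σ.2, h c ≤ h c₀) ∧
  ∃ cL cR : ℕ, IsGreatest {c | LeftBoundary gL gR σ.2 σ.1 c₀ c} cL ∧
    IsLeast {c | RightBoundary n gL gR σ.2 σ.1 c₀ c} cR ∧
  ∃ D : Finset ℕ, D = σ.2.filter (fun c => cL < c ∧ c < cR) ∧
  ∃ Ahat : Finset ℕ, IsPrunAlgOutput D (SC n x ξ D σ.2 σ.1) Ahat ∧
    τ.1 = σ.1 ∪ Ahat ∧ τ.2 = σ.2 \ decided n σ.1 D Ahat c₀ cL cR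

/-- `Khat` is a possible final output of the outer algorithm started with the candidate set `C`:
iterations lead from (nothing accepted, all of `C` active) to (`Khat` accepted, nothing active). -/
def IsLocAlgOutput (n : ℕ) (x : ℕ → ℝ) (ξ : ℝ) (gL gR : ℕ → ℕ) (h : ℕ → ℝ)
    (C Khat : Finset ℕ) : Prop :=
  Relation.ReflTransGen (LocAlgStep n x ξ gL gR h) (∅, C) (Khat, ∅)

/-- The `j`-th smallest element of `K` (`j ≥ 1`), and `0` if `j` exceeds the cardinality. -/
def nthEstimator (K : Finset ℕ) (j : ℕ) : ℕ :=
  K.sort.getD (j - 1) 0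

/-! ### The events -/

variable {Ω : Type*}

/-- The event `M^(11)`. -/
def event11 (ε : ℕ → Ω → ℝ) (w : ℝ) (n : ℕ) : Set Ω :=
  {ω | ∀ s e : ℕ, s < e → e ≤ n →
    1 / √((e : ℝ) - s) * |∑ t ∈ Finset.Ioc s e, ε t ω| ≤ w}

/-- The event `M^(12)` with parameter `a`. -/
def event12 (ε : ℕ → Ω → ℝ) (S : MeanModel) (w₁ a : ℝ) : Set Ω :=
  {ω | ∀ j ∈ Finset.Icc 1 S.q, ∀ l : ℕ, a / S.d j ^ 2 ≤ l →
    (l ≤ S.cp j - S.cp (j - 1) →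
      √(a / S.d j ^ 2) / l * |∑ t ∈ Finset.Ioc (S.cp j - l) (S.cp j), ε t ω| ≤ w₁) ∧
    (l ≤ S.cp (j + 1) - S.cp j →
      √(a / S.d j ^ 2) / l * |∑ t ∈ Finset.Ioc (S.cp j) (S.cp j + l), ε t ω| ≤ w₁)}

/-- The event `M^(13)` with parameter `b`. -/
def event13 (ε : ℕ → Ω → ℝ) (S : MeanModel) (w₂ b : ℝ) : Set Ω :=
  {ω | ∀ j ∈ Finset.Icc 1 S.q, ∀ l : ℕ, 1 ≤ l → (l : ℝ) ≤ b / S.d j ^ 2 →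
    1 / √(b / S.d j ^ 2) * |∑ t ∈ Finset.Ioc (S.cp j - l) (S.cp j), ε t ω| ≤ w₂ ∧
    1 / √(b / S.d j ^ 2) * |∑ t ∈ Finset.Ioc (S.cp j) (S.cp j + l), ε t ω| ≤ w₂}

/-- `d_j² |c - k_j|`. -/
def scaledError (S : MeanModel) (c j : ℕ) : ℝ :=
  S.d j ^ 2 * |(c : ℝ) - S.cp j|

/-- The event `M^(2)`: every change point has a candidate within scaled distance `r`. -/
def event2 (S : MeanModel) (r : ℝ) (C : Ω → Finset ℕ) : Set Ω :=
  {ω | ∀ j ∈ Finset.Icc 1 S.q, ∃ c ∈ C ω, scaledError S c j ≤ r}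

/-- The event that the outer algorithm has an output, and that every possible output consists of
exactly `q` estimators, the `j`-th of which has scaled distance at most `r` from the `j`-th change
point for every `j`. -/
def consistencyEvent (n : ℕ) (ε : ℕ → Ω → ℝ) (S : MeanModel) (ξ : ℝ) (C : Ω → Finset ℕ)
    (gL gR : Ω → ℕ → ℕ) (h : Ω → ℕ → ℝ) (r : ℝ) : Set Ω :=
  {ω | (∃ Khat, IsLocAlgOutput n (S.obs ε ω) ξ (gL ω) (gR ω) (h ω) (C ω) Khat) ∧
    ∀ Khat, IsLocAlgOutput n (S.obs ε ω) ξ (gL ω) (gR ω) (h ω) (C ω) Khat →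
      Khat.card = S.q ∧ ∀ j ∈ Finset.Icc 1 S.q, scaledError S (nthEstimator Khat j) j ≤ r}

/-! ### The assumptions -/

/-- Standing assumptions on the signals: bounded jumps and minimal spacing tending to infinity. -/
structure SignalAssumption (S : ℕ → MeanModel) : Prop where
  valid : ∀ n, 1 ≤ n → (S n).IsValid n
  jumps_bounded : ∃ B : ℝ, ∀ᶠ n in atTop, ∀ j ∈ Finset.Icc 1 (S n).q, |(S n).d j| ≤ B
  spacing : ∀ M : ℕ, ∀ᶠ n in atTop, ∀ j ∈ Finset.Icc 1 (S n).q, M ≤ (S n).delta j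

/-- A sequence with `1 ≤ a_n ≤ D_n` (for all large `n`). -/
def AdmissibleScale (S : ℕ → MeanModel) (a : ℕ → ℝ) : Prop :=
  ∀ᶠ n in atTop, 1 ≤ a n ∧ ENNReal.ofReal (a n) ≤ (S n).D

/-- The assumption on the errors. -/
structure ErrorAssumption [MeasurableSpace Ω] (μ : Measure Ω) (ε : ℕ → Ω → ℝ)
    (S : ℕ → MeanModel) (w w₁ w₂ : ℕ → ℝ) : Prop where
  square_integrable : ∀ t, 1 ≤ t → MemLp (ε t) 2 μ
  ergodic : IsErgodicSequence μ ε
  centred : ∀ t, 1 ≤ t → ∫ ω, ε t ω ∂μ = 0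
  variance_bounds : ∃ c₁ c₂ : ℝ, 0 < c₁ ∧ ∀ t, 1 ≤ t →
    c₁ ≤ variance (ε t) μ ∧ variance (ε t) μ ≤ c₂
  log_le : (fun n : ℕ => √(Real.log n)) =O[atTop] w
  prob11 : WithProbTendingToOne μ fun n => event11 ε (w n) n
  prob1213 : ∀ a b : ℕ → ℝ, AdmissibleScale S a → AdmissibleScale S b →
    WithProbTendingToOne μ fun n =>
      event12 ε (S n) (w₁ n) (a n) ∩ event13 ε (S n) (w₂ n) (b n)

/-- The assumption on the size of the changes: `ω_n² / D_n → 0`. -/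
def SizeAssumption (S : ℕ → MeanModel) (w : ℕ → ℝ) : Prop :=
  Tendsto (fun n => ENNReal.ofReal (w n ^ 2) / (S n).D) atTop (𝓝 0)

/-- The assumption on the penalty: `ξ_n / D_n → 0` and `ω_n² / ξ_n → 0`. -/
structure PenaltyAssumption (S : ℕ → MeanModel) (w ξ : ℕ → ℝ) : Prop where
  pos : ∀ᶠ n in atTop, 0 < ξ n
  penalty_small : Tendsto (fun n => ENNReal.ofReal (ξ n) / (S n).D) atTop (𝓝 0)
  penalty_large : Tendsto (fun n => w n ^ 2 / ξ n) atTop (𝓝 0)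

/-- The assumption on the (random) candidate sets and their precision `ρ`. -/
structure CandidateAssumption [MeasurableSpace Ω] (μ : Measure Ω) (S : ℕ → MeanModel)
    (w w₁ w₂ ρ : ℕ → ℝ) (C : ℕ → Ω → Finset ℕ) : Prop where
  subset : ∀ n ω, C n ω ⊆ Finset.Ioo 0 n
  precision_ge : (fun n => max (w₁ n) (w₂ n) ^ 2) =O[atTop] ρ
  precision_le : ρ =O[atTop] fun n => w n ^ 2
  prob2 : WithProbTendingToOne μ fun n => event2 (S n) (ρ n) (C n)
  number : TendstoInMeasure μ (fun (n : ℕ) ω => w n ^ 2 * ((C n ω).card : ℝ) / n) atTop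
    (fun _ => 0)

/-- `ν_n → ∞` slowly: `ρ_n ν_n` is negligible compared with the penalty. Moreover `ρ_n ν_n ≥ 1` for
large `n`, which is automatic if `ρ_n` is bounded away from zero. -/
structure SlowRate (ρ ξ ν : ℕ → ℝ) : Prop where
  tendsto : Tendsto ν atTop atTop
  negligible : Tendsto (fun n => ρ n * ν n / ξ n) atTop (𝓝 0)
  one_le : ∀ᶠ n in atTop, 1 ≤ ρ n * ν n

/-- The assumption on the detection intervals `(c - gL c, c + gR c]`: uniformly in `j`, with
probability tending to one, there is a candidate `c` with `d_j² |c - k_j| ≤ ρ_n ν_n` and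
`ξ_n / (d_j² min (gL c) (gR c)) ≤ κ_n → 0`. -/
def DetectionIntervalAssumption [MeasurableSpace Ω] (μ : Measure Ω) (S : ℕ → MeanModel)
    (ξ ρ ν : ℕ → ℝ) (C : ℕ → Ω → Finset ℕ) (gL gR : ℕ → Ω → ℕ → ℕ) : Prop :=
  ∃ κ : ℕ → ℝ, Tendsto κ atTop (𝓝 0) ∧ WithProbTendingToOne μ fun n =>
    {ω | ∀ j ∈ Finset.Icc 1 (S n).q, ∃ c ∈ C n ω, scaledError (S n) c j ≤ ρ n * ν n ∧
      ξ n ≤ κ n * ((S n).d j ^ 2 * (min (gL n ω c) (gR n ω c) : ℕ))}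

/-- The event `M_n`, the intersection of `M^(11)`, `M^(12)`, `M^(13)` and `M^(2)`. -/
def eventM (n : ℕ) (ε : ℕ → Ω → ℝ) (S : MeanModel) (w w₁ w₂ ρ a b : ℝ)
    (C : Ω → Finset ℕ) : Set Ω :=
  event11 ε w n ∩ event12 ε S w₁ a ∩ event13 ε S w₂ b ∩ event2 S ρ C

end

end LocPrune

open LocPrune

/-!
On an event of probability tending to one, the theorem is a deterministic statement about one
sample. Put `α = ρ ν`, the acceptance radius. The noise `w²` and the radius `α` are small compared
with the penalty `ξ`, and `ξ` is small compared with all `d_j² δ_j`; all these ratios are bounded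
by a constant `η` that may be chosen as small as desired (`RegularSample`, `GoodSample`,
`Tuning`). The events `M^(12)` and `M^(13)`, taken with `a = b = α`, bound the noise sums starting
at the change point `j` by a small multiple of `|d_j|` times the length down to the scale `α /
d_j²` (`LocalNoise`). By ergodicity the energy of the noise is of exact order `n`. Hence the
residual sums of squares are bounded below by a multiple of `n` throughout, and above by one as
soon as at most one change point is missed; so in the criterion a decrease of the residual sum of
squares competes with a constant multiple of `ξ` per break point.

Four comparisons of residual sums of squares carry the argument. A break point near an undetected
change point gains many penalties (`RegularSample.le_RSS_sub_RSS_insert`). A superfluous break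
point gains less than one (`RegularSample.RSS_sub_RSS_insert_le`). Moving the representative of a
change point to a distinguished candidate within `α` of it is an improvement if the representative
was at scaled distance of the order of the penalty (`RegularSample.RSS_swap_lt_coarse`), and even
if it was only at distance more than `K α` (`RegularSample.RSS_swap_lt_fine`); the factor `K > 1`
enters here, because the interval between the two positions then belongs predominantly to one side
of the change point.

These comparisons determine the output of the inner algorithm. A set with the monotonicity
property must cover all change points up to a moderate distance, and a set with one good
representative for every change point that is not represented from outside the local environment
belongs to the search family. Starting from the output, one can move its elements to better
positions and delete the others, strictly decreasing the criterion each time; so nothing can have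
been moved or deleted, and the output consists of exactly one element within `K α` for certain
change points, while the remaining change points lie near a break point outside the environment
(`PruneEnv.isPrunAlgOutput_spec`).

The outer algorithm maintains the invariant that accepted candidates represent distinct change
points within `K α`, and that every undetected change point still has its distinguished candidate
among the active ones (`LocInvariant.step`). The latter is due to the detection intervals, which
are long compared with `ξ / d_j²`: a change point that is missed by the inner algorithm is close
to an end point of the local environment, which forces that end point to be an active candidate
away from the central one, and the update rule leaves the distinguished candidate alone. Every
iteration removes an active candidate, so the algorithm terminates, and then the accepted
candidates correspond to the change points one to one (`LocInvariant.card_eq_and_nthEstimator`).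
-/

namespace LocPrune

/-! ### Residual sums of squares and insertion of a break point -/

/-- `(a, b)` is a gap of the segmentation of `(0, n]` with break points `A`: both ends belong to
`A ∪ {0, n}` and no break point lies strictly between them. -/
def IsGap (n : ℕ) (A : Finset ℕ) (a b : ℕ) : Prop :=
  (a = 0 ∨ a ∈ A) ∧ (b = n ∨ b ∈ A) ∧ a < b ∧ ∀ e ∈ A, e ≤ a ∨ b ≤ e

/-- The sum of a function `Φ` of segments `(s, e]` over the segmentation with break points `A`. -/
noncomputable def segSum (n : ℕ) (A : Finset ℕ) (Φ : ℕ → ℕ → ℝ) : ℝ :=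
  ∑ s ∈ insert 0 A, Φ s (nextPoint n A s)

/-- The residual sum of squares of one segment `(s, e]`. -/
noncomputable def segRSS (x : ℕ → ℝ) (s e : ℕ) : ℝ :=
  ∑ t ∈ Finset.Ioc s e, (x t - segMean x s e) ^ 2

/-- The decrease of the residual sum of squares when a segment is split into two pieces of lengths
`p`, `q` over which the data sum up to `P`, `Q`. -/
noncomputable def splitGain (p P q Q : ℝ) : ℝ :=
  P ^ 2 / p + Q ^ 2 / q - (P + Q) ^ 2 / (p + q)

lemma RSS_eq_segSum (n : ℕ) (x : ℕ → ℝ) (A : Finset ℕ) :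
    RSS n x A = segSum n A (segRSS x) := rfl

lemma exists_isGap {n : ℕ} {A : Finset ℕ} {c : ℕ} (hc : c ∈ Finset.Ioo 0 n) (hcA : c ∉ A) :
    ∃ a b, IsGap n A a b ∧ a < c ∧ c < b := by
  classical
  rw [Finset.mem_Ioo] at hc
  have h1 : ((insert 0 A).filter (· < c)).Nonempty := ⟨0, by simp [hc.1]⟩
  have h2 : ((insert n A).filter (c < ·)).Nonempty := ⟨n, by simp [hc.2]⟩
  have ha := Finset.max'_mem _ h1
  have hb := Finset.min'_mem _ h2
  set a := Finset.max' _ h1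
  set b := Finset.min' _ h2
  simp only [Finset.mem_filter, Finset.mem_insert] at ha hb
  refine ⟨a, b, ⟨ha.1, hb.1, by omega, fun e he => ?_⟩, ha.2, hb.2⟩
  rcases lt_trichotomy e c with h | h | h
  · exact Or.inl (Finset.le_max' _ _ (by simp [he, h]))
  · exact absurd (h ▸ he) hcA
  · exact Or.inr (Finset.min'_le _ _ (by simp [he, h]))

lemma nextPoint_eq_of_isLeast {n : ℕ} {A : Finset ℕ} {s u : ℕ}
    (h : IsLeast {u : ℕ | (u ∈ A ∨ u = n) ∧ s < u} u) : nextPoint n A s = u := h.csInf_eq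

lemma isLeast_nextPoint {n : ℕ} {A : Finset ℕ} {s : ℕ} (hs : s < n) :
    IsLeast {u : ℕ | (u ∈ A ∨ u = n) ∧ s < u} (nextPoint n A s) :=
  ⟨Nat.sInf_mem ⟨n, Or.inr rfl, hs⟩, fun _ hv => Nat.sInf_le hv⟩

lemma IsGap.le {n : ℕ} {A : Finset ℕ} (hA : A ⊆ Finset.Ioo 0 n) {a b : ℕ} (h : IsGap n A a b) :
    b ≤ n := by
  rcases h.2.1 with h | h
  · exact h.le
  · exact (Finset.mem_Ioo.1 (hA h)).2.le

lemma IsGap.nextPoint_eq {n : ℕ} {A : Finset ℕ} (hA : A ⊆ Finset.Ioo 0 n) {a b : ℕ}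
    (h : IsGap n A a b) : nextPoint n A a = b := by
  apply nextPoint_eq_of_isLeast
  refine ⟨⟨h.2.1.symm, h.2.2.1⟩, ?_⟩
  rintro v ⟨hv | rfl, hav⟩
  · rcases h.2.2.2 v hv with h' | h'
    · omega
    · exact h'
  · exact h.le hA

lemma IsGap.insert_left {n : ℕ} {A : Finset ℕ} {a b c : ℕ} (h : IsGap n A a b) (hac : a < c)
    (hcb : c < b) : IsGap n (insert c A) a c := by
  refine ⟨?_, Or.inr (Finset.mem_insert_self _ _), hac, fun e he => ?_⟩
  · exact h.1.imp_right (Finset.mem_insert_of_mem)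
  · rcases Finset.mem_insert.1 he with rfl | he
    · exact Or.inr le_rfl
    · rcases h.2.2.2 e he with h' | h' <;> omega

lemma IsGap.insert_right {n : ℕ} {A : Finset ℕ} {a b c : ℕ} (h : IsGap n A a b) (hac : a < c)
    (hcb : c < b) : IsGap n (insert c A) c b := by
  refine ⟨Or.inr (Finset.mem_insert_self _ _), ?_, hcb, fun e he => ?_⟩
  · exact h.2.1.imp_right (Finset.mem_insert_of_mem)
  · rcases Finset.mem_insert.1 he with rfl | he
    · exact Or.inl le_rfl
    · rcases h.2.2.2 e he with h' | h' <;> omega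

lemma segSum_insert {n : ℕ} {A : Finset ℕ} (hA : A ⊆ Finset.Ioo 0 n) {a b c : ℕ}
    (h : IsGap n A a b) (hac : a < c) (hcb : c < b) (Φ : ℕ → ℕ → ℝ) :
    segSum n (insert c A) Φ = segSum n A Φ - Φ a b + Φ a c + Φ c b := by
  have hbn := h.le hA
  have hA' : insert c A ⊆ Finset.Ioo 0 n := by
    intro e he
    rcases Finset.mem_insert.1 he with rfl | he
    · exact Finset.mem_Ioo.2 ⟨by omega, by omega⟩
    · exact hA he
  have hcA : c ∉ insert 0 A := by
    intro hc
    rcases Finset.mem_insert.1 hc with rfl | hc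
    · omega
    · rcases h.2.2.2 c hc with h' | h' <;> omega
  have ha : a ∈ insert 0 A := by
    rcases h.1 with h | h <;> simp [h]
  unfold segSum
  rw [Finset.insert_comm, Finset.sum_insert hcA, ← Finset.add_sum_erase _ _ ha,
    ← Finset.add_sum_erase _ (fun s => Φ s (nextPoint n A s)) ha,
    (h.insert_right hac hcb).nextPoint_eq hA', (h.insert_left hac hcb).nextPoint_eq hA',
    h.nextPoint_eq hA]
  have : ∑ s ∈ (insert 0 A).erase a, Φ s (nextPoint n (insert c A) s) =
      ∑ s ∈ (insert 0 A).erase a, Φ s (nextPoint n A s) := by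
    refine Finset.sum_congr rfl fun s hs => ?_
    congr 1
    rw [Finset.mem_erase, Finset.mem_insert] at hs
    have hsn : s < n := by
      rcases hs.2 with rfl | hs
      · omega
      · exact (Finset.mem_Ioo.1 (hA hs)).2
    have hsab : s ≤ a ∨ b ≤ s := by
      rcases hs.2 with rfl | hs
      · exact Or.inl (Nat.zero_le _)
      · exact h.2.2.2 s hs
    have hL := isLeast_nextPoint (A := A) hsn
    apply nextPoint_eq_of_isLeast
    refine ⟨⟨hL.1.1.imp_left Finset.mem_insert_of_mem, hL.1.2⟩, ?_⟩
    rintro v ⟨hv | rfl, hsv⟩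
    · rcases Finset.mem_insert.1 hv with rfl | hv
      · have hsa : s < a := by have := hs.1; omega
        have haA : a ∈ A := h.1.resolve_left (by omega)
        exact (hL.2 ⟨Or.inl haA, hsa⟩).trans hac.le
      · exact hL.2 ⟨Or.inl hv, hsv⟩
    · exact hL.2 ⟨Or.inr rfl, hsv⟩
  rw [this]
  ring

lemma segSum_empty {n : ℕ} (hn : 0 < n) (Φ : ℕ → ℕ → ℝ) : segSum n ∅ Φ = Φ 0 n := by
  have : IsGap n ∅ 0 n := ⟨Or.inl rfl, Or.inl rfl, hn, by simp⟩
  simp [segSum, this.nextPoint_eq (by simp)]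

/-- The segments form a partition of `(0, n]`. -/
lemma segSum_sum {n : ℕ} (hn : 0 < n) (F : ℕ → ℝ) {A : Finset ℕ} (hA : A ⊆ Finset.Ioo 0 n) :
    segSum n A (fun s e => ∑ t ∈ Finset.Ioc s e, F t) = ∑ t ∈ Finset.Ioc 0 n, F t := by
  induction A using Finset.induction_on with
  | empty => exact segSum_empty hn _
  | insert c A hc ih =>
    have hA' := (Finset.subset_insert c A).trans hA
    obtain ⟨a, b, h, hac, hcb⟩ := exists_isGap (hA (Finset.mem_insert_self c A)) hc
    rw [segSum_insert hA' h hac hcb, ih hA',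
      ← Finset.sum_Ioc_consecutive F hac.le hcb.le]
    ring

lemma isGap_nextPoint {n : ℕ} (hn : 0 < n) {A : Finset ℕ} (hA : A ⊆ Finset.Ioo 0 n) {s : ℕ}
    (hs : s ∈ insert 0 A) : IsGap n A s (nextPoint n A s) := by
  rw [Finset.mem_insert] at hs
  have hsn : s < n := by
    rcases hs with rfl | hs
    · exact hn
    · exact (Finset.mem_Ioo.1 (hA hs)).2
  have hL := isLeast_nextPoint (A := A) hsn
  refine ⟨hs, hL.1.1.symm, hL.1.2, fun e he => ?_⟩
  by_contra! hcon
  exact absurd (hL.2 ⟨Or.inl he, hcon.1⟩) (by omega)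

lemma segSum_mono {n : ℕ} (hn : 0 < n) {A : Finset ℕ} (hA : A ⊆ Finset.Ioo 0 n)
    {Φ Ψ : ℕ → ℕ → ℝ} (h : ∀ a b, IsGap n A a b → Φ a b ≤ Ψ a b) : segSum n A Φ ≤ segSum n A Ψ :=
  Finset.sum_le_sum fun _ hs => h _ _ (isGap_nextPoint hn hA hs)

lemma sum_Ioc_const (s e : ℕ) (h : s ≤ e) (c : ℝ) :
    ∑ _t ∈ Finset.Ioc s e, c = ((e : ℝ) - s) * c := by
  rw [Finset.sum_const, Nat.card_Ioc, nsmul_eq_mul, Nat.cast_sub h]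

/-- Decomposition of the sum of squares about an arbitrary constant `μ`. -/
lemma segRSS_eq (x : ℕ → ℝ) {s e : ℕ} (h : s < e) (μ : ℝ) :
    segRSS x s e = ∑ t ∈ Finset.Ioc s e, (x t - μ) ^ 2 -
      (∑ t ∈ Finset.Ioc s e, (x t - μ)) ^ 2 / ((e : ℝ) - s) := by
  have hpos : (0 : ℝ) < (e : ℝ) - s := by
    rw [sub_pos]
    exact_mod_cast h
  set m := segMean x s e with hm
  have hsum : ∑ t ∈ Finset.Ioc s e, (x t - μ) = ((e : ℝ) - s) * (m - μ) := by
    rw [Finset.sum_sub_distrib, sum_Ioc_const s e h.le, hm, segMean]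
    field_simp
  have : ∀ t, (x t - m) ^ 2 = (x t - μ) ^ 2 + (-2 * (m - μ)) * (x t - μ) + (m - μ) ^ 2 :=
    fun t => by ring
  unfold segRSS
  rw [← hm]
  simp_rw [this]
  rw [Finset.sum_add_distrib, Finset.sum_add_distrib, ← Finset.mul_sum, hsum,
    sum_Ioc_const s e h.le]
  field_simp
  ring

lemma segRSS_le (x : ℕ → ℝ) {s e : ℕ} (h : s < e) (μ : ℝ) :
    segRSS x s e ≤ ∑ t ∈ Finset.Ioc s e, (x t - μ) ^ 2 := by
  have hpos : (0 : ℝ) < (e : ℝ) - s := by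
    rw [sub_pos]
    exact_mod_cast h
  rw [segRSS_eq x h μ]
  have : 0 ≤ (∑ t ∈ Finset.Ioc s e, (x t - μ)) ^ 2 / ((e : ℝ) - s) := by positivity
  linarith

lemma splitGain_eq {p q : ℝ} (hp : 0 < p) (hq : 0 < q) (P Q : ℝ) :
    splitGain p P q Q = p * q / (p + q) * (P / p - Q / q) ^ 2 := by
  unfold splitGain
  field_simp
  ring

lemma splitGain_nonneg {p q : ℝ} (hp : 0 < p) (hq : 0 < q) (P Q : ℝ) : 0 ≤ splitGain p P q Q := by
  rw [splitGain_eq hp hq]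
  positivity

lemma splitGain_comm (p q P Q : ℝ) : splitGain p P q Q = splitGain q Q p P := by
  unfold splitGain
  rw [add_comm q p, add_comm Q P]
  ring

lemma segRSS_split (x : ℕ → ℝ) {s m e : ℕ} (hsm : s < m) (hme : m < e) (μ : ℝ) :
    segRSS x s e - segRSS x s m - segRSS x m e =
      splitGain ((m : ℝ) - s) (∑ t ∈ Finset.Ioc s m, (x t - μ)) ((e : ℝ) - m)
        (∑ t ∈ Finset.Ioc m e, (x t - μ)) := by
  rw [segRSS_eq x (hsm.trans hme) μ, segRSS_eq x hsm μ, segRSS_eq x hme μ,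
    ← Finset.sum_Ioc_consecutive _ hsm.le hme.le, ← Finset.sum_Ioc_consecutive _ hsm.le hme.le]
  unfold splitGain
  rw [show (m : ℝ) - s + (e - m) = e - s by ring]
  ring

lemma RSS_insert {n : ℕ} (x : ℕ → ℝ) {A : Finset ℕ} (hA : A ⊆ Finset.Ioo 0 n) {a b c : ℕ}
    (h : IsGap n A a b) (hac : a < c) (hcb : c < b) (μ : ℝ) :
    RSS n x A - RSS n x (insert c A) =
      splitGain ((c : ℝ) - a) (∑ t ∈ Finset.Ioc a c, (x t - μ)) ((b : ℝ) - c)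
        (∑ t ∈ Finset.Ioc c b, (x t - μ)) := by
  rw [← segRSS_split x hac hcb μ, RSS_eq_segSum, RSS_eq_segSum, segSum_insert hA h hac hcb]
  ring

lemma RSS_insert_le {n : ℕ} (x : ℕ → ℝ) {A : Finset ℕ} {c : ℕ}
    (hA : insert c A ⊆ Finset.Ioo 0 n) : RSS n x (insert c A) ≤ RSS n x A := by
  by_cases hc : c ∈ A
  · rw [Finset.insert_eq_of_mem hc]
  obtain ⟨a, b, h, hac, hcb⟩ := exists_isGap (hA (Finset.mem_insert_self c A)) hc
  have h1 := RSS_insert x ((Finset.subset_insert c A).trans hA) h hac hcb 0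
  have h2 := splitGain_nonneg (p := (c : ℝ) - a) (q := (b : ℝ) - c)
    (by rw [sub_pos]; exact_mod_cast hac) (by rw [sub_pos]; exact_mod_cast hcb)
    (∑ t ∈ Finset.Ioc a c, (x t - 0)) (∑ t ∈ Finset.Ioc c b, (x t - 0))
  linarith

lemma RSS_anti {n : ℕ} (x : ℕ → ℝ) {A B : Finset ℕ} (hAB : A ⊆ B) (hB : B ⊆ Finset.Ioo 0 n) :
    RSS n x B ≤ RSS n x A := by
  obtain ⟨C, rfl⟩ : ∃ C, B = A ∪ C := ⟨B, (Finset.union_eq_right.2 hAB).symm⟩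
  clear hAB
  induction C using Finset.induction_on with
  | empty => simp
  | insert c C _ ih =>
    rw [Finset.union_insert] at hB ⊢
    exact (RSS_insert_le x hB).trans (ih ((Finset.subset_insert _ _).trans hB))

/-- Moving a break point within a gap `(a, b)` from `c` to a later position `g`. -/
lemma RSS_swap {n : ℕ} (x : ℕ → ℝ) {A : Finset ℕ} (hA : A ⊆ Finset.Ioo 0 n) {a b c g : ℕ}
    (h : IsGap n A a b) (hac : a < c) (hcg : c < g) (hgb : g < b) (μ : ℝ) :
    RSS n x (insert c A) - RSS n x (insert g A) =
      splitGain ((g : ℝ) - c) (∑ t ∈ Finset.Ioc c g, (x t - μ)) ((b : ℝ) - g)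
        (∑ t ∈ Finset.Ioc g b, (x t - μ)) -
      splitGain ((c : ℝ) - a) (∑ t ∈ Finset.Ioc a c, (x t - μ)) ((g : ℝ) - c)
        (∑ t ∈ Finset.Ioc c g, (x t - μ)) := by
  rw [← segRSS_split x hcg hgb μ, ← segRSS_split x hac hcg μ, RSS_eq_segSum, RSS_eq_segSum,
    segSum_insert hA h hac (hcg.trans hgb), segSum_insert hA h (hac.trans hcg) hgb]
  ring

/-! ### Geometry of the change points -/

/-- `S.level p` is the mean between the change points `cp p` and `cp (p + 1)`. -/
noncomputable def MeanModel.level (S : MeanModel) (p : ℕ) : ℝ :=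
  S.f₀ + ∑ i ∈ Finset.Icc 1 p, S.d i

/-- The set `A` contains a point within scaled distance `θ` of the change point `i`. -/
def Covers (S : MeanModel) (A : Finset ℕ) (θ : ℝ) (i : ℕ) : Prop :=
  ∃ e ∈ A, scaledError S e i ≤ θ

/-- A sample of size `n` whose noise `e` is controlled uniformly over all intervals at the scale of
the penalty `ξ`. The acceptance radius `α` is small compared with `ξ`, which in turn is small
compared with all scaled distances between change points; both ratios are at most `η`. -/
structure RegularSample (n : ℕ) (S : MeanModel) (e : ℕ → ℝ) (ξ α η : ℝ) : Prop where
  valid : S.IsValid n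
  ξ_pos : 0 < ξ
  α_pos : 0 < α
  η_pos : 0 < η
  noise : ∀ s t, s < t → t ≤ n → (∑ i ∈ Finset.Ioc s t, e i) ^ 2 ≤ η * ξ * ((t : ℝ) - s)
  α_le : α ≤ η * ξ
  ξ_le : ∀ j ∈ Finset.Icc 1 S.q, ξ ≤ η * (S.d j ^ 2 * S.delta j)

lemma Covers.mono {S : MeanModel} {A B : Finset ℕ} {θ θ' : ℝ} {i : ℕ} (h : Covers S A θ i)
    (hAB : A ⊆ B) (hθ : θ ≤ θ') : Covers S B θ' i :=
  let ⟨e, he, h'⟩ := h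
  ⟨e, hAB he, h'.trans hθ⟩

namespace MeanModel.IsValid

variable {S : MeanModel} {n : ℕ}

lemma cp_lt (h : S.IsValid n) {i j : ℕ} (hij : i < j) (hj : j ≤ S.q + 1) : S.cp i < S.cp j := by
  induction j, hij using Nat.le_induction with
  | base => exact h.2.2.1 i (by omega)
  | succ j hij ih => exact (ih (by omega)).trans (h.2.2.1 j (by omega))

lemma cp_le (h : S.IsValid n) {i j : ℕ} (hij : i ≤ j) (hj : j ≤ S.q + 1) : S.cp i ≤ S.cp j := by
  rcases hij.eq_or_lt with rfl | hij
  · exact le_rfl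
  · exact (h.cp_lt hij hj).le

lemma d_ne_zero (h : S.IsValid n) {j : ℕ} (hj : j ∈ Finset.Icc 1 S.q) : S.d j ≠ 0 := h.2.2.2 j hj

lemma mean_eq (h : S.IsValid n) {p t : ℕ} (hp : p ≤ S.q) (h1 : S.cp p < t)
    (h2 : t ≤ S.cp (p + 1)) : S.mean t = S.level p := by
  unfold MeanModel.mean MeanModel.level
  congr 1
  rw [← Finset.sum_filter]
  congr 1
  ext i
  simp only [Finset.mem_filter, Finset.mem_Icc]
  constructor
  · rintro ⟨⟨hi1, hi2⟩, hi3⟩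
    refine ⟨hi1, ?_⟩
    by_contra! hcon
    have := h.cp_le (i := p + 1) (j := i) hcon (by omega)
    omega
  · rintro ⟨hi1, hi2⟩
    have := h.cp_le hi2 (by omega)
    exact ⟨⟨hi1, by omega⟩, by omega⟩

lemma exists_index (h : S.IsValid n) {s : ℕ} (hs : s < n) :
    ∃ p ≤ S.q, S.cp p ≤ s ∧ s < S.cp (p + 1) := by
  classical
  have hex : ∃ p, s < S.cp (p + 1) := ⟨S.q, by rw [h.2.1]; exact hs⟩
  refine ⟨Nat.find hex, ?_, ?_, Nat.find_spec hex⟩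
  · exact Nat.find_min' hex (by rw [h.2.1]; exact hs)
  · rcases Nat.eq_zero_or_pos (Nat.find hex) with h0 | h0
    · rw [h0, h.1]
      exact Nat.zero_le _
    · have := Nat.find_min hex (m := Nat.find hex - 1) (by omega)
      rw [Nat.sub_add_cancel h0] at this
      omega

end MeanModel.IsValid

lemma MeanModel.level_succ (S : MeanModel) (p : ℕ) :
    S.level (p + 1) = S.level p + S.d (p + 1) := by
  unfold MeanModel.level
  rw [Finset.sum_Icc_succ_top (by omega)]
  ring

namespace RegularSample

variable {n : ℕ} {S : MeanModel} {e : ℕ → ℝ} {ξ α η T : ℝ}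

lemma d_sq_pos (H : RegularSample n S e ξ α η) {j : ℕ} (hj : j ∈ Finset.Icc 1 S.q) :
    0 < S.d j ^ 2 := by
  have := H.valid.d_ne_zero hj
  positivity

lemma ξ_le_gap_left (H : RegularSample n S e ξ α η) {i j : ℕ} (hj : j ∈ Finset.Icc 1 S.q)
    (hij : i < j) : ξ ≤ η * (S.d j ^ 2 * ((S.cp j : ℝ) - S.cp i)) := by
  rw [Finset.mem_Icc] at hj
  refine (H.ξ_le j (Finset.mem_Icc.2 hj)).trans ?_
  have h1 := H.valid.cp_le (i := i) (j := j - 1) (by omega) (by omega)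
  have h2 := H.valid.cp_lt (i := j - 1) (j := j) (by omega) (by omega)
  have h3 : S.delta j ≤ S.cp j - S.cp i := (min_le_left _ _).trans (by omega)
  have h4 : (S.delta j : ℝ) ≤ (S.cp j : ℝ) - S.cp i := by
    rw [← Nat.cast_sub (by omega)]
    exact_mod_cast h3
  have := H.η_pos
  gcongr

lemma ξ_le_gap_right (H : RegularSample n S e ξ α η) {i j : ℕ} (hj : j ∈ Finset.Icc 1 S.q)
    (hij : j < i) (hi : i ≤ S.q + 1) : ξ ≤ η * (S.d j ^ 2 * ((S.cp i : ℝ) - S.cp j)) := by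
  rw [Finset.mem_Icc] at hj
  refine (H.ξ_le j (Finset.mem_Icc.2 hj)).trans ?_
  have h1 := H.valid.cp_le (i := j + 1) (j := i) (by omega) (by omega)
  have h2 := H.valid.cp_lt (i := j) (j := j + 1) (by omega) (by omega)
  have h3 : S.delta j ≤ S.cp i - S.cp j := (min_le_right _ _).trans (by omega)
  have h4 : (S.delta j : ℝ) ≤ (S.cp i : ℝ) - S.cp j := by
    rw [← Nat.cast_sub (by omega)]
    exact_mod_cast h3
  have := H.η_pos
  gcongr

/-- A point within scaled distance `T ξ` of a change point is, by comparison, far from all others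
and from `0` and `n`. -/
lemma abs_le_left (H : RegularSample n S e ξ α η) (hT : T * η ≤ 1 / 16) {i j c : ℕ}
    (hj : j ∈ Finset.Icc 1 S.q) (hij : i < j) (hc : scaledError S c j ≤ T * ξ) :
    |(c : ℝ) - S.cp j| ≤ ((S.cp j : ℝ) - S.cp i) / 16 := by
  have h1 := H.ξ_le_gap_left hj hij
  have hd := H.d_sq_pos hj
  have hlt : (S.cp i : ℝ) < S.cp j := by
    exact_mod_cast H.valid.cp_lt hij (by rw [Finset.mem_Icc] at hj; omega)
  unfold scaledError at hc
  have h0 : 0 ≤ T * ξ := le_trans (by positivity) hc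
  have hT0 : 0 ≤ T := nonneg_of_mul_nonneg_left h0 H.ξ_pos
  have h2 : T * ξ ≤ T * (η * (S.d j ^ 2 * ((S.cp j : ℝ) - S.cp i))) := by gcongr
  have h3 : T * η * (S.d j ^ 2 * ((S.cp j : ℝ) - S.cp i)) ≤
      1 / 16 * (S.d j ^ 2 * ((S.cp j : ℝ) - S.cp i)) := by
    apply mul_le_mul_of_nonneg_right hT
    apply mul_nonneg hd.le
    linarith
  exact le_of_mul_le_mul_left (by linarith) hd

lemma abs_le_right (H : RegularSample n S e ξ α η) (hT : T * η ≤ 1 / 16) {i j c : ℕ}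
    (hj : j ∈ Finset.Icc 1 S.q) (hij : j < i) (hi : i ≤ S.q + 1)
    (hc : scaledError S c j ≤ T * ξ) :
    |(c : ℝ) - S.cp j| ≤ ((S.cp i : ℝ) - S.cp j) / 16 := by
  have h1 := H.ξ_le_gap_right hj hij hi
  have hd := H.d_sq_pos hj
  have hlt : (S.cp j : ℝ) < S.cp i := by
    exact_mod_cast H.valid.cp_lt hij hi
  unfold scaledError at hc
  have h0 : 0 ≤ T * ξ := le_trans (by positivity) hc
  have hT0 : 0 ≤ T := nonneg_of_mul_nonneg_left h0 H.ξ_pos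
  have h2 : T * ξ ≤ T * (η * (S.d j ^ 2 * ((S.cp i : ℝ) - S.cp j))) := by gcongr
  have h3 : T * η * (S.d j ^ 2 * ((S.cp i : ℝ) - S.cp j)) ≤
      1 / 16 * (S.d j ^ 2 * ((S.cp i : ℝ) - S.cp j)) := by
    apply mul_le_mul_of_nonneg_right hT
    apply mul_nonneg hd.le
    linarith
  exact le_of_mul_le_mul_left (by linarith) hd

/-- Points close to different change points have the same order as the change points. -/
lemma lt_of_close (H : RegularSample n S e ξ α η) (hT : T * η ≤ 1 / 16) {i j c c' : ℕ}
    (hi : i ∈ Finset.Icc 1 S.q) (hj : j ∈ Finset.Icc 1 S.q) (hij : i < j)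
    (hc : scaledError S c i ≤ T * ξ) (hc' : scaledError S c' j ≤ T * ξ) : c < c' := by
  have h1 := abs_le.1 (H.abs_le_right hT hi hij (by rw [Finset.mem_Icc] at hj; omega) hc)
  have h2 := abs_le.1 (H.abs_le_left hT hj hij hc')
  have hlt : (S.cp i : ℝ) < S.cp j := by
    exact_mod_cast H.valid.cp_lt hij (by rw [Finset.mem_Icc] at hj; omega)
  have : (c : ℝ) < c' := by linarith
  exact_mod_cast this

lemma eq_of_close (H : RegularSample n S e ξ α η) (hT : T * η ≤ 1 / 16) {i j c : ℕ}
    (hi : i ∈ Finset.Icc 1 S.q) (hj : j ∈ Finset.Icc 1 S.q)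
    (hc : scaledError S c i ≤ T * ξ) (hc' : scaledError S c j ≤ T * ξ) : i = j := by
  rcases lt_trichotomy i j with h | h | h
  · exact absurd (H.lt_of_close hT hi hj h hc hc') (lt_irrefl _)
  · exact h
  · exact absurd (H.lt_of_close hT hj hi h hc' hc) (lt_irrefl _)

lemma pos_of_close (H : RegularSample n S e ξ α η) (hT : T * η ≤ 1 / 16) {j c : ℕ}
    (hj : j ∈ Finset.Icc 1 S.q) (hc : scaledError S c j ≤ T * ξ) : 0 < c := by
  have hj' := Finset.mem_Icc.1 hj
  have h1 := abs_le.1 (H.abs_le_left hT hj (i := 0) (by omega) hc)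
  have hlt : (S.cp 0 : ℝ) < S.cp j := by
    exact_mod_cast H.valid.cp_lt (i := 0) (by omega) (by omega)
  rw [H.valid.1] at h1 hlt
  push_cast at h1 hlt
  have : (0 : ℝ) < c := by linarith
  exact_mod_cast this

lemma lt_n_of_close (H : RegularSample n S e ξ α η) (hT : T * η ≤ 1 / 16) {j c : ℕ}
    (hj : j ∈ Finset.Icc 1 S.q) (hc : scaledError S c j ≤ T * ξ) : c < n := by
  have hj' := Finset.mem_Icc.1 hj
  have h1 := abs_le.1 (H.abs_le_right hT hj (i := S.q + 1) (by omega) le_rfl hc)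
  have hlt : (S.cp j : ℝ) < S.cp (S.q + 1) := by
    exact_mod_cast H.valid.cp_lt (by omega) le_rfl
  rw [H.valid.2.1] at h1 hlt
  have : (c : ℝ) < n := by linarith
  exact_mod_cast this

end RegularSample

lemma scaledError_between {S : MeanModel} {x y z j : ℕ} {θ : ℝ} (hxy : x ≤ y) (hyz : y ≤ z)
    (hx : scaledError S x j ≤ θ) (hz : scaledError S z j ≤ θ) : scaledError S y j ≤ θ := by
  unfold scaledError at *
  have h1 : (x : ℝ) ≤ y := by exact_mod_cast hxy
  have h2 : (y : ℝ) ≤ z := by exact_mod_cast hyz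
  have : |(y : ℝ) - S.cp j| ≤ max |(x : ℝ) - S.cp j| |(z : ℝ) - S.cp j| := by
    rcases le_total (y : ℝ) (S.cp j) with h | h
    · refine le_max_of_le_left ?_
      rw [abs_of_nonpos (by linarith), abs_of_nonpos (by linarith)]
      linarith
    · refine le_max_of_le_right ?_
      rw [abs_of_nonneg (by linarith), abs_of_nonneg (by linarith)]
      linarith
  rcases le_max_iff.1 this with h | h
  · exact (mul_le_mul_of_nonneg_left h (sq_nonneg _)).trans hx
  · exact (mul_le_mul_of_nonneg_left h (sq_nonneg _)).trans hz

/-! ### Sums of the mean over intervals around a change point -/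

lemma sum_Ioc_ite_le (a u k : ℕ) (c : ℝ) :
    ∑ t ∈ Finset.Ioc a u, (if t ≤ k then c else 0) = c * ((min u k - a : ℕ) : ℝ) := by
  rw [← Finset.sum_filter, Finset.sum_const, nsmul_eq_mul, mul_comm]
  congr 2
  rw [← Nat.card_Ioc]
  congr 1
  ext t
  simp only [Finset.mem_filter, Finset.mem_Ioc]
  omega

lemma sum_Ioc_ite_lt (a u k : ℕ) (c : ℝ) :
    ∑ t ∈ Finset.Ioc a u, (if k < t then c else 0) = c * ((u - max a k : ℕ) : ℝ) := by
  rw [← Finset.sum_filter, Finset.sum_const, nsmul_eq_mul, mul_comm]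
  congr 2
  rw [← Nat.card_Ioc]
  congr 1
  ext t
  simp only [Finset.mem_filter, Finset.mem_Ioc]
  omega

namespace MeanModel.IsValid

variable {S : MeanModel} {n : ℕ}

/-- Two consecutive change points `p`, `p + 1`, seen from the level between them. The side
conditions allow for `p = 0` and `p = q`, where one of the two is an end point of `(0, n]`. -/
lemma mean_sub_level (h : S.IsValid n) {p t : ℕ} (hp : p ≤ S.q) (h1 : S.cp (p - 1) < t)
    (h2 : t ≤ S.cp (p + 1) ∨ p + 1 ≤ S.q ∧ t ≤ S.cp (p + 2)) :
    S.mean t - S.level p =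
      (if t ≤ S.cp p then -S.d p else 0) + (if S.cp (p + 1) < t then S.d (p + 1) else 0) := by
  have hlt := h.cp_lt (i := p) (j := p + 1) (by omega) (by omega)
  by_cases ha : t ≤ S.cp p
  · rcases Nat.eq_zero_or_pos p with rfl | hp0
    · simp at h1
      omega
    · obtain ⟨r, rfl⟩ : ∃ r, p = r + 1 := ⟨p - 1, by omega⟩
      rw [h.mean_eq (p := r) (by omega) h1 ha, S.level_succ, if_pos ha, if_neg (by omega)]
      ring
  · by_cases hb : t ≤ S.cp (p + 1)
    · rw [h.mean_eq hp (by omega) hb, if_neg ha, if_neg (by omega)]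
      ring
    · rcases h2 with h2 | h2
      · omega
      · rw [h.mean_eq (p := p + 1) h2.1 (by omega) h2.2, S.level_succ, if_neg ha, if_pos (by omega)]
        ring

lemma sum_mean_sub_level (h : S.IsValid n) {p a u : ℕ} (hp : p ≤ S.q) (h1 : S.cp (p - 1) ≤ a)
    (h2 : u ≤ S.cp (p + 1) ∨ p + 1 ≤ S.q ∧ u ≤ S.cp (p + 2)) :
    ∑ t ∈ Finset.Ioc a u, (S.mean t - S.level p) =
      -S.d p * ((min u (S.cp p) - a : ℕ) : ℝ) +
        S.d (p + 1) * ((u - max a (S.cp (p + 1)) : ℕ) : ℝ) := by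
  rw [← sum_Ioc_ite_le, ← sum_Ioc_ite_lt, ← Finset.sum_add_distrib]
  refine Finset.sum_congr rfl fun t ht => ?_
  rw [Finset.mem_Ioc] at ht
  exact h.mean_sub_level hp (by omega) (h2.imp (ht.2.trans) (fun h => ⟨h.1, ht.2.trans h.2⟩))

end MeanModel.IsValid

/-! ### Bounds on the observations over intervals ending in a gap -/

/-- `D₁ * x` is the contribution of a piece of length `x` beyond the neighbouring change point,
whose jump has size `D₁`; `G` is the distance of that change point from the one of jump size `D₂`. -/
lemma fringe_bound {D₁ D₂ x T ξ η G l : ℝ} (hD₁ : 0 < D₁) (hD₂ : 0 ≤ D₂) (hT : 0 ≤ T) (hξ : 0 < ξ)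
    (hη : 0 < η) (hG : 0 ≤ G) (hx : 0 ≤ x) (h1 : D₁ ^ 2 * x ≤ T * ξ) (h2 : ξ ≤ η * (D₁ ^ 2 * G))
    (h3 : ξ ≤ η * (D₂ ^ 2 * G)) (hl : G ≤ 2 * l) :
    D₁ * x ≤ 2 * T * η * D₂ * l ∧ (D₁ * x) ^ 2 ≤ 2 * T ^ 2 * η * ξ * l := by
  have hge : ξ ≤ η * (D₁ * D₂ * G) := by
    have : ξ ^ 2 ≤ (η * (D₁ * D₂ * G)) ^ 2 := by
      calc ξ ^ 2 = ξ * ξ := sq ξ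
        _ ≤ (η * (D₁ ^ 2 * G)) * (η * (D₂ ^ 2 * G)) := by gcongr
        _ = _ := by ring
    exact (pow_le_pow_iff_left₀ hξ.le (by positivity) two_ne_zero).1 this
  constructor
  · have : D₁ * (D₁ * x) ≤ D₁ * (T * η * D₂ * G) := by
      calc D₁ * (D₁ * x) = D₁ ^ 2 * x := by ring
        _ ≤ T * ξ := h1
        _ ≤ T * (η * (D₁ * D₂ * G)) := by gcongr
        _ = _ := by ring
    have h4 := le_of_mul_le_mul_left this hD₁
    have : T * η * D₂ * G ≤ T * η * D₂ * (2 * l) := by gcongr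
    linarith
  · have : D₁ ^ 2 * (D₁ * x) ^ 2 ≤ D₁ ^ 2 * (T ^ 2 * η * ξ * G) := by
      calc D₁ ^ 2 * (D₁ * x) ^ 2 = (D₁ ^ 2 * x) ^ 2 := by ring
        _ ≤ (T * ξ) ^ 2 := by gcongr
        _ = T ^ 2 * ξ * ξ := by ring
        _ ≤ T ^ 2 * ξ * (η * (D₁ ^ 2 * G)) := by gcongr
        _ = _ := by ring
    have h4 := le_of_mul_le_mul_left this (by positivity)
    have : T ^ 2 * η * ξ * G ≤ T ^ 2 * η * ξ * (2 * l) := by gcongr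
    linarith

/-- From a bound on the signal part `M` and a bound on the noise part `N` of a sum over an interval
of length `l` to a bound on the mean. -/
lemma mean_bound {M N φ D x T ξ η l ℓ m : ℝ} (hD : 0 < D) (hξ : 0 < ξ)
    (hη : 0 < η) (hl : 0 < l) (hℓ : 0 < ℓ) (hm : 0 ≤ m) (hM : |M| ≤ φ + D * x)
    (hφ : φ ≤ 2 * T * η * D * l) (hN : N ^ 2 ≤ η * ξ * l) (hlen : ℓ * ξ ≤ D ^ 2 * l)
    (hx : D ^ 2 * x ≤ m * ξ) :
    |M + N| ≤ (2 * T * η + m / ℓ + √(η / ℓ)) * D * l := by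
  have h1 : |N| ≤ √(η / ℓ) * D * l := by
    apply abs_le_of_sq_le_sq _ (by positivity)
    rw [mul_pow, mul_pow, Real.sq_sqrt (by positivity)]
    refine hN.trans ?_
    have : η * ξ * l = η / ℓ * (ℓ * ξ) * l := by field_simp
    rw [this]
    calc η / ℓ * (ℓ * ξ) * l ≤ η / ℓ * (D ^ 2 * l) * l := by gcongr
      _ = _ := by ring
  have h2 : D * x ≤ m / ℓ * D * l := by
    have : D * (D * x) ≤ D * (m / ℓ * D * l) := by
      calc D * (D * x) = D ^ 2 * x := by ring
        _ ≤ m * ξ := hx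
        _ = m / ℓ * (ℓ * ξ) := by field_simp
        _ ≤ m / ℓ * (D ^ 2 * l) := by gcongr
        _ = _ := by ring
    exact le_of_mul_le_mul_left this hD
  calc |M + N| ≤ |M| + |N| := abs_add_le _ _
    _ ≤ 2 * T * η * D * l + m / ℓ * D * l + √(η / ℓ) * D * l := by linarith
    _ = _ := by ring

lemma sum_obs (S : MeanModel) (e : ℕ → ℝ) (a u : ℕ) (μ : ℝ) :
    ∑ t ∈ Finset.Ioc a u, (S.mean t + e t - μ) =
      ∑ t ∈ Finset.Ioc a u, (S.mean t - μ) + ∑ t ∈ Finset.Ioc a u, e t := by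
  rw [← Finset.sum_add_distrib]
  exact Finset.sum_congr rfl fun t _ => by ring

lemma sum_sub_level_shift (x : ℕ → ℝ) {a u : ℕ} (h : a ≤ u) (μ c : ℝ) :
    ∑ t ∈ Finset.Ioc a u, (x t - μ) = ∑ t ∈ Finset.Ioc a u, (x t - (μ + c)) +
      ((u : ℝ) - a) * c := by
  rw [← sum_Ioc_const a u h, ← Finset.sum_add_distrib]
  exact Finset.sum_congr rfl fun t _ => by ring

namespace RegularSample

variable {n : ℕ} {S : MeanModel} {e : ℕ → ℝ} {ξ α η T : ℝ}

/-- Between the left end `a` of a gap and a point `u` near the change point `j`, the mean differs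
from the level left of `j` only by a negligible contribution `φ` of the change point `j - 1` and by
the part of the interval that lies beyond the change point `j`. -/
lemma left_fringe (H : RegularSample n S e ξ α η) (hT0 : 0 ≤ T) (hT : T * η ≤ 1 / 16) {j : ℕ}
    (hj : j ∈ Finset.Icc 1 S.q) {A : Finset ℕ} {a b u : ℕ} (hgap : IsGap n A a b)
    (hcov : ∀ i ∈ Finset.Icc 1 S.q, i ≠ j → Covers S A (T * ξ) i) (hau : a < u) (hub : u < b)
    (hu : (S.cp j : ℝ) - u ≤ ((S.cp j : ℝ) - S.cp (j - 1)) / 4) (hu' : u ≤ S.cp (j + 1))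
    (haj : a ≤ S.cp j) :
    ∃ φ : ℝ, 0 ≤ φ ∧ φ ≤ 2 * T * η * |S.d j| * ((u : ℝ) - a) ∧
      φ ^ 2 ≤ 2 * T ^ 2 * η * ξ * ((u : ℝ) - a) ∧
      |∑ t ∈ Finset.Ioc a u, (S.mean t - S.level (j - 1))| ≤
        φ + |S.d j| * ((u - S.cp j : ℕ) : ℝ) := by
  have hv := H.valid
  have hj' := Finset.mem_Icc.1 hj
  obtain ⟨r, rfl⟩ : ∃ r, j = r + 1 := ⟨j - 1, by omega⟩
  simp only [Nat.add_sub_cancel] at hu ⊢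
  have hlt := hv.cp_lt (i := r) (j := r + 1) (by omega) (by omega)
  have hltR : (S.cp r : ℝ) < S.cp (r + 1) := by exact_mod_cast hlt
  have hauR : (a : ℝ) < u := by exact_mod_cast hau
  rcases le_or_gt (S.cp r) a with hra | hra
  · have h1 : S.cp (r - 1) ≤ a := (hv.cp_le (by omega) (by omega)).trans hra
    have hmul : 0 ≤ (u : ℝ) - a := by linarith
    have := H.η_pos
    have := H.ξ_pos
    refine ⟨0, le_rfl, by positivity, by rw [zero_pow two_ne_zero]; positivity, ?_⟩
    rw [hv.sum_mean_sub_level (by omega) h1 (Or.inr ⟨hj'.2, hu'⟩), max_eq_right haj,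
      show min u (S.cp r) - a = 0 by omega]
    simp [abs_mul]
  · have hr : 1 ≤ r := by
      by_contra! hcon
      obtain rfl : r = 0 := by omega
      rw [hv.1] at hra
      omega
    have hr' : r ∈ Finset.Icc 1 S.q := Finset.mem_Icc.2 ⟨hr, by omega⟩
    obtain ⟨c, hcA, hc⟩ := hcov r hr' (by omega)
    have hc1 := abs_le.1 (H.abs_le_right hT hr' (i := r + 1) (by omega) (by omega) hc)
    have hc2 := abs_le.1 (H.abs_le_left hT hr' (i := r - 1) (by omega) hc)
    have hlt' : (S.cp (r - 1) : ℝ) < S.cp r := by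
      exact_mod_cast hv.cp_lt (i := r - 1) (by omega) (by omega)
    have hcu : c < u := by
      have : (c : ℝ) < u := by linarith
      exact_mod_cast this
    have hca : c ≤ a := (hgap.2.2.2 c hcA).resolve_right (by omega)
    have hcaR : (c : ℝ) ≤ a := by exact_mod_cast hca
    have hraR : (a : ℝ) < S.cp r := by exact_mod_cast hra
    have h1 : S.cp (r - 1) ≤ a := by
      have : (S.cp (r - 1) : ℝ) ≤ a := by linarith
      exact_mod_cast this
    have hcu' : S.cp r ≤ u := by
      have : (S.cp r : ℝ) ≤ u := by linarith
      exact_mod_cast this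
    have hcast : ((S.cp r - a : ℕ) : ℝ) = (S.cp r : ℝ) - a := Nat.cast_sub hra.le
    have hfr := fringe_bound (D₁ := |S.d r|) (D₂ := |S.d (r + 1)|) (x := (S.cp r : ℝ) - a)
      (T := T) (ξ := ξ) (η := η) (G := (S.cp (r + 1) : ℝ) - S.cp r) (l := (u : ℝ) - a)
      (abs_pos.2 (hv.d_ne_zero hr')) (abs_nonneg _) hT0 H.ξ_pos H.η_pos (by linarith) (by linarith)
      (by
        rw [sq_abs]
        refine le_trans ?_ hc
        unfold scaledError
        apply mul_le_mul_of_nonneg_left _ (sq_nonneg _)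
        rw [abs_of_nonpos (by linarith)]
        linarith)
      (by rw [sq_abs]; exact H.ξ_le_gap_right hr' (by omega) (by omega))
      (by rw [sq_abs]; exact H.ξ_le_gap_left hj (by omega)) (by linarith)
    refine ⟨|S.d r| * ((S.cp r : ℝ) - a), mul_nonneg (abs_nonneg _) (by linarith), hfr.1,
      hfr.2, ?_⟩
    rw [hv.sum_mean_sub_level (by omega) h1 (Or.inr ⟨hj'.2, hu'⟩), max_eq_right haj,
      min_eq_right hcu', hcast]
    refine (abs_add_le _ _).trans ?_
    rw [abs_mul, abs_mul, abs_neg, abs_of_nonneg (show (0 : ℝ) ≤ S.cp r - a by linarith),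
      Nat.abs_cast]

/-- The mirror image of `left_fringe`. -/
lemma right_fringe (H : RegularSample n S e ξ α η) (hT0 : 0 ≤ T) (hT : T * η ≤ 1 / 16) {j : ℕ}
    (hj : j ∈ Finset.Icc 1 S.q) {A : Finset ℕ} {a b u : ℕ} (hgap : IsGap n A a b)
    (hcov : ∀ i ∈ Finset.Icc 1 S.q, i ≠ j → Covers S A (T * ξ) i) (hau : a < u) (hub : u < b)
    (hbn : b ≤ n)
    (hu : (u : ℝ) - S.cp j ≤ ((S.cp (j + 1) : ℝ) - S.cp j) / 4) (hu' : S.cp (j - 1) ≤ u)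
    (hjb : S.cp j ≤ b) :
    ∃ φ : ℝ, 0 ≤ φ ∧ φ ≤ 2 * T * η * |S.d j| * ((b : ℝ) - u) ∧
      φ ^ 2 ≤ 2 * T ^ 2 * η * ξ * ((b : ℝ) - u) ∧
      |∑ t ∈ Finset.Ioc u b, (S.mean t - S.level j)| ≤
        φ + |S.d j| * ((S.cp j - u : ℕ) : ℝ) := by
  have hv := H.valid
  have hj' := Finset.mem_Icc.1 hj
  have hlt := hv.cp_lt (i := j) (j := j + 1) (by omega) (by omega)
  have hltR : (S.cp j : ℝ) < S.cp (j + 1) := by exact_mod_cast hlt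
  have hubR : (u : ℝ) < b := by exact_mod_cast hub
  rcases le_or_gt b (S.cp (j + 1)) with hrb | hrb
  · have hmul : 0 ≤ (b : ℝ) - u := by linarith
    have := H.η_pos
    have := H.ξ_pos
    refine ⟨0, le_rfl, by positivity, by rw [zero_pow two_ne_zero]; positivity, ?_⟩
    rw [hv.sum_mean_sub_level (by omega) hu' (Or.inl hrb), min_eq_right hjb,
      show b - max u (S.cp (j + 1)) = 0 by omega]
    simp [abs_mul]
  · have hr : j + 1 ≤ S.q := by
      by_contra! hcon
      obtain rfl : j = S.q := by omega
      rw [hv.2.1] at hrb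
      omega
    have hr' : j + 1 ∈ Finset.Icc 1 S.q := Finset.mem_Icc.2 ⟨by omega, hr⟩
    obtain ⟨c, hcA, hc⟩ := hcov (j + 1) hr' (by omega)
    have hc1 := abs_le.1 (H.abs_le_right hT hr' (i := j + 2) (by omega) (by omega) hc)
    have hc2 := abs_le.1 (H.abs_le_left hT hr' (i := j) (by omega) hc)
    have hlt' : (S.cp (j + 1) : ℝ) < S.cp (j + 2) := by
      exact_mod_cast hv.cp_lt (i := j + 1) (by omega) (by omega)
    have hcu : u < c := by
      have : (u : ℝ) < c := by linarith
      exact_mod_cast this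
    have hca : b ≤ c := (hgap.2.2.2 c hcA).resolve_left (by omega)
    have hcaR : (b : ℝ) ≤ c := by exact_mod_cast hca
    have hraR : (S.cp (j + 1) : ℝ) < b := by exact_mod_cast hrb
    have h1 : b ≤ S.cp (j + 2) := by
      have : (b : ℝ) ≤ S.cp (j + 2) := by linarith
      exact_mod_cast this
    have hcu' : u ≤ S.cp (j + 1) := by
      have : (u : ℝ) ≤ S.cp (j + 1) := by linarith
      exact_mod_cast this
    have hcast : ((b - S.cp (j + 1) : ℕ) : ℝ) = (b : ℝ) - S.cp (j + 1) := Nat.cast_sub hrb.le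
    have hfr := fringe_bound (D₁ := |S.d (j + 1)|) (D₂ := |S.d j|)
      (x := (b : ℝ) - S.cp (j + 1))
      (T := T) (ξ := ξ) (η := η) (G := (S.cp (j + 1) : ℝ) - S.cp j) (l := (b : ℝ) - u)
      (abs_pos.2 (hv.d_ne_zero hr')) (abs_nonneg _) hT0 H.ξ_pos H.η_pos (by linarith) (by linarith)
      (by
        rw [sq_abs]
        refine le_trans ?_ hc
        unfold scaledError
        apply mul_le_mul_of_nonneg_left _ (sq_nonneg _)
        rw [abs_of_nonneg (by linarith)]
        linarith)
      (by rw [sq_abs]; exact H.ξ_le_gap_left hr' (by omega))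
      (by rw [sq_abs]; exact H.ξ_le_gap_right hj (by omega) (by omega)) (by linarith)
    refine ⟨|S.d (j + 1)| * ((b : ℝ) - S.cp (j + 1)), mul_nonneg (abs_nonneg _) (by linarith),
      hfr.1, hfr.2, ?_⟩
    rw [hv.sum_mean_sub_level (by omega) hu' (Or.inr ⟨hr, h1⟩), min_eq_right hjb,
      max_eq_right hcu', hcast]
    refine (abs_add_le _ _).trans ?_
    rw [abs_mul, abs_mul, abs_neg, abs_of_nonneg (show (0 : ℝ) ≤ b - S.cp (j + 1) by linarith),
      Nat.abs_cast, add_comm]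

lemma left_mean (H : RegularSample n S e ξ α η) (hT0 : 0 ≤ T) (hT : T * η ≤ 1 / 16) {j : ℕ}
    (hj : j ∈ Finset.Icc 1 S.q) {A : Finset ℕ} {a b u : ℕ} (hgap : IsGap n A a b)
    (hcov : ∀ i ∈ Finset.Icc 1 S.q, i ≠ j → Covers S A (T * ξ) i) (hau : a < u) (hub : u < b)
    (hbn : b ≤ n)
    (hu : (S.cp j : ℝ) - u ≤ ((S.cp j : ℝ) - S.cp (j - 1)) / 4) (hu' : u ≤ S.cp (j + 1))
    (haj : a ≤ S.cp j) {ℓ m : ℝ} (hℓ : 0 < ℓ) (hm : 0 ≤ m)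
    (hlen : ℓ * ξ ≤ S.d j ^ 2 * ((u : ℝ) - a))
    (hx : S.d j ^ 2 * ((u - S.cp j : ℕ) : ℝ) ≤ m * ξ) :
    |∑ t ∈ Finset.Ioc a u, (S.mean t + e t - S.level (j - 1))| ≤
      (2 * T * η + m / ℓ + √(η / ℓ)) * |S.d j| * ((u : ℝ) - a) := by
  obtain ⟨φ, -, hφ, -, hM⟩ := H.left_fringe hT0 hT hj hgap hcov hau hub hu hu' haj
  rw [sum_obs]
  exact mean_bound (abs_pos.2 (H.valid.d_ne_zero hj)) H.ξ_pos H.η_pos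
    (by rw [sub_pos]; exact_mod_cast hau) hℓ hm hM hφ (H.noise a u hau (by omega))
    (by rwa [sq_abs]) (by rwa [sq_abs])

lemma right_mean (H : RegularSample n S e ξ α η) (hT0 : 0 ≤ T) (hT : T * η ≤ 1 / 16) {j : ℕ}
    (hj : j ∈ Finset.Icc 1 S.q) {A : Finset ℕ} {a b u : ℕ} (hgap : IsGap n A a b)
    (hcov : ∀ i ∈ Finset.Icc 1 S.q, i ≠ j → Covers S A (T * ξ) i) (hau : a < u) (hub : u < b)
    (hbn : b ≤ n)
    (hu : (u : ℝ) - S.cp j ≤ ((S.cp (j + 1) : ℝ) - S.cp j) / 4) (hu' : S.cp (j - 1) ≤ u)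
    (hjb : S.cp j ≤ b) {ℓ m : ℝ} (hℓ : 0 < ℓ) (hm : 0 ≤ m)
    (hlen : ℓ * ξ ≤ S.d j ^ 2 * ((b : ℝ) - u))
    (hx : S.d j ^ 2 * ((S.cp j - u : ℕ) : ℝ) ≤ m * ξ) :
    |∑ t ∈ Finset.Ioc u b, (S.mean t + e t - S.level j)| ≤
      (2 * T * η + m / ℓ + √(η / ℓ)) * |S.d j| * ((b : ℝ) - u) := by
  obtain ⟨φ, -, hφ, -, hM⟩ := H.right_fringe hT0 hT hj hgap hcov hau hub hbn hu hu' hjb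
  rw [sum_obs]
  exact mean_bound (abs_pos.2 (H.valid.d_ne_zero hj)) H.ξ_pos H.η_pos
    (by rw [sub_pos]; exact_mod_cast hub) hℓ hm hM hφ (H.noise u b hub hbn)
    (by rwa [sq_abs]) (by rwa [sq_abs])

lemma left_sq (H : RegularSample n S e ξ α η) (hT0 : 0 ≤ T) (hT : T * η ≤ 1 / 16) {j : ℕ}
    (hj : j ∈ Finset.Icc 1 S.q) {A : Finset ℕ} {a b u : ℕ} (hgap : IsGap n A a b)
    (hcov : ∀ i ∈ Finset.Icc 1 S.q, i ≠ j → Covers S A (T * ξ) i) (hau : a < u) (hub : u < b)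
    (hbn : b ≤ n)
    (hu : (S.cp j : ℝ) - u ≤ ((S.cp j : ℝ) - S.cp (j - 1)) / 4) (huj : u ≤ S.cp j) :
    (∑ t ∈ Finset.Ioc a u, (S.mean t + e t - S.level (j - 1))) ^ 2 ≤
      (4 * T ^ 2 + 4) * η * ξ * ((u : ℝ) - a) := by
  have hj' := Finset.mem_Icc.1 hj
  obtain ⟨φ, h0, -, hφ, hM⟩ := H.left_fringe hT0 hT hj hgap hcov hau hub hu
    (huj.trans (H.valid.cp_le (by omega) (by omega))) (by omega)
  have hN := H.noise a u hau (by omega)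
  rw [sum_obs]
  rw [show u - S.cp j = 0 by omega] at hM
  simp only [Nat.cast_zero, mul_zero, add_zero] at hM
  have hM2 := (sq_le_sq' (neg_le_of_abs_le hM) (le_of_abs_le hM)).trans hφ
  have := add_sq_le (a := ∑ t ∈ Finset.Ioc a u, (S.mean t - S.level (j - 1)))
    (b := ∑ t ∈ Finset.Ioc a u, e t)
  have hN0 := (sq_nonneg _).trans hN
  linarith

lemma right_sq (H : RegularSample n S e ξ α η) (hT0 : 0 ≤ T) (hT : T * η ≤ 1 / 16) {j : ℕ}
    (hj : j ∈ Finset.Icc 1 S.q) {A : Finset ℕ} {a b u : ℕ} (hgap : IsGap n A a b)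
    (hcov : ∀ i ∈ Finset.Icc 1 S.q, i ≠ j → Covers S A (T * ξ) i) (hau : a < u) (hub : u < b)
    (hbn : b ≤ n)
    (hu : (u : ℝ) - S.cp j ≤ ((S.cp (j + 1) : ℝ) - S.cp j) / 4) (huj : S.cp j ≤ u) :
    (∑ t ∈ Finset.Ioc u b, (S.mean t + e t - S.level j)) ^ 2 ≤
      (4 * T ^ 2 + 4) * η * ξ * ((b : ℝ) - u) := by
  have hj' := Finset.mem_Icc.1 hj
  obtain ⟨φ, h0, -, hφ, hM⟩ := H.right_fringe hT0 hT hj hgap hcov hau hub hbn hu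
    ((H.valid.cp_le (by omega) (by omega)).trans huj) (by omega)
  have hN := H.noise u b hub hbn
  rw [sum_obs]
  rw [show S.cp j - u = 0 by omega] at hM
  simp only [Nat.cast_zero, mul_zero, add_zero] at hM
  have hM2 := (sq_le_sq' (neg_le_of_abs_le hM) (le_of_abs_le hM)).trans hφ
  have := add_sq_le (a := ∑ t ∈ Finset.Ioc u b, (S.mean t - S.level j))
    (b := ∑ t ∈ Finset.Ioc u b, e t)
  have hN0 := (sq_nonneg _).trans hN
  linarith

end RegularSample

/-! ### Elementary comparisons of gains -/

/-- Two pieces whose means are close to levels that differ by `d`. -/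
lemma le_splitGain {p q P Q d w : ℝ} (hp : 0 < p) (hq : 0 < q) (hP : |P| ≤ |d| * p / 4)
    (hQ : |Q| ≤ |d| * q / 4) (hwp : w ≤ d ^ 2 * p) (hwq : w ≤ d ^ 2 * q) :
    w / 8 ≤ splitGain p P q (Q + q * d) := by
  rw [splitGain_eq hp hq]
  have h1 : |P / p| ≤ |d| / 4 := by
    rw [abs_div, abs_of_pos hp, div_le_iff₀ hp]
    linarith
  have h2 : |Q / q| ≤ |d| / 4 := by
    rw [abs_div, abs_of_pos hq, div_le_iff₀ hq]
    linarith
  have h3 : P / p - (Q + q * d) / q = P / p - Q / q - d := by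
    field_simp
    ring
  rw [h3]
  have h4 : |d| / 2 ≤ |P / p - Q / q - d| := by
    have := abs_sub_abs_le_abs_sub d (P / p - Q / q)
    have h5 := abs_sub (P / p) (Q / q)
    rw [abs_sub_comm]
    linarith
  have h5 : d ^ 2 / 4 ≤ (P / p - Q / q - d) ^ 2 := by
    rw [← sq_abs (P / p - Q / q - d), ← sq_abs d]
    have := pow_le_pow_left₀ (by positivity) h4 2
    linarith
  have h6 : w / 2 ≤ p * q / (p + q) * d ^ 2 := by
    rw [div_mul_eq_mul_div, le_div_iff₀ (by positivity)]
    have e1 : w * q ≤ d ^ 2 * p * q := by gcongr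
    have e2 : w * p ≤ d ^ 2 * q * p := by gcongr
    linarith
  have h7 : 0 ≤ p * q / (p + q) := by positivity
  have := mul_le_mul_of_nonneg_left h5 h7
  linarith

/-- Comparison of the gains of two split points, the piece `(p, P)` being the interval between
them: coarse version, at the scale of the penalty. -/
lemma splitGain_lt_coarse {l₁ P₁ p P l₂ P₂ d ζ w : ℝ} (hl₁ : 0 < l₁) (hp : 0 < p) (hl₂ : 0 < l₂)
    (h₁ : P₁ ^ 2 ≤ ζ * l₁) (h : P ^ 2 ≤ ζ * p) (h₂ : |P₂| ≤ |d| * l₂ / 4) (hw : 0 < w)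
    (hwp : w ≤ d ^ 2 * p) (hwl : w ≤ d ^ 2 * l₂) (hζ : 17 * ζ ≤ w) :
    splitGain l₁ P₁ p P < splitGain p P l₂ (P₂ + l₂ * d) := by
  have hle : splitGain l₁ P₁ p P ≤ 2 * ζ := by
    unfold splitGain
    have e1 : P₁ ^ 2 / l₁ ≤ ζ := by rwa [div_le_iff₀ hl₁]
    have e2 : P ^ 2 / p ≤ ζ := by rwa [div_le_iff₀ hp]
    have e3 : 0 ≤ (P₁ + P) ^ 2 / (l₁ + p) := by positivity
    linarith
  have hζ0 : 0 ≤ ζ := nonneg_of_mul_nonneg_left ((sq_nonneg _).trans h) hp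
  have hP : |P| ≤ |d| * p / 4 := by
    apply abs_le_of_sq_le_sq _ (by positivity)
    rw [div_pow, mul_pow, sq_abs]
    have e1 : 17 * ζ * p ≤ d ^ 2 * p * p := mul_le_mul_of_nonneg_right (by linarith) hp.le
    have : 0 ≤ ζ * p := (sq_nonneg _).trans h
    linarith
  have := le_splitGain hp hl₂ hP h₂ hwp hwl
  have : 2 * ζ < w / 8 := by linarith
  linarith

/-- Fine version of `splitGain_lt_coarse`: the interval between the split points belongs to the
level of the first piece except for a fraction of at most `1 / (1 + K)`, `K > 1`. -/
lemma splitGain_lt_fine {l₁ P₁ p P l₂ P₂ d K lam : ℝ} (hl₁ : 0 < l₁) (hp : 0 < p) (hl₂ : 0 < l₂)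
    (hd : d ≠ 0) (hK : 1 < K) (hlam : 0 < lam) (hlamK : 5 * lam < (K - 1) / (K + 1))
    (h₁ : |P₁| ≤ lam * |d| * l₁) (h : |P| ≤ (1 / (1 + K) + lam) * |d| * p)
    (h₂ : |P₂| ≤ lam * |d| * l₂) (hpl : p ≤ lam * l₂) :
    splitGain l₁ P₁ p P < splitGain p P l₂ (P₂ + l₂ * d) := by
  have hd' : 0 < |d| := abs_pos.2 hd
  set s := 1 / (1 + K) with hs
  have hs0 : 0 < s := by positivity
  have hs1 : (K - 1) / (K + 1) = 1 - 2 * s := by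
    rw [hs]
    field_simp
    ring
  rw [hs1] at hlamK
  rw [splitGain_eq hl₁ hp, splitGain_eq hp hl₂]
  have e1 : |P₁ / l₁| ≤ lam * |d| := by rwa [abs_div, abs_of_pos hl₁, div_le_iff₀ hl₁]
  have e2 : |P / p| ≤ (s + lam) * |d| := by rwa [abs_div, abs_of_pos hp, div_le_iff₀ hp]
  have e3 : |P₂ / l₂| ≤ lam * |d| := by rwa [abs_div, abs_of_pos hl₂, div_le_iff₀ hl₂]
  have h3 : P / p - (P₂ + l₂ * d) / l₂ = P / p - P₂ / l₂ - d := by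
    field_simp
    ring
  rw [h3]
  have f1 : (P₁ / l₁ - P / p) ^ 2 ≤ ((s + 2 * lam) * |d|) ^ 2 := by
    rw [← sq_abs]
    have := abs_sub (P₁ / l₁) (P / p)
    exact pow_le_pow_left₀ (abs_nonneg _) (by linarith) 2
  have f2 : ((1 - s - 2 * lam) * |d|) ^ 2 ≤ (P / p - P₂ / l₂ - d) ^ 2 := by
    rw [← sq_abs (P / p - P₂ / l₂ - d)]
    have e5 := abs_sub_abs_le_abs_sub d (P / p - P₂ / l₂)
    have e6 := abs_sub (P / p) (P₂ / l₂)
    rw [abs_sub_comm d] at e5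
    refine pow_le_pow_left₀ (mul_nonneg (by linarith) hd'.le) (by linarith) 2
  have g1 : l₁ * p / (l₁ + p) ≤ p := by
    rw [div_le_iff₀ (by positivity)]
    nlinarith [mul_pos hp hp]
  have g2 : p / (1 + lam) ≤ p * l₂ / (p + l₂) := by
    rw [div_le_div_iff₀ (by positivity) (by positivity)]
    have := mul_le_mul_of_nonneg_left hpl hp.le
    linarith
  calc l₁ * p / (l₁ + p) * (P₁ / l₁ - P / p) ^ 2
      ≤ p * ((s + 2 * lam) * |d|) ^ 2 := by gcongr
    _ < p / (1 + lam) * ((1 - s - 2 * lam) * |d|) ^ 2 := by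
        rw [div_mul_eq_mul_div, lt_div_iff₀ (by positivity), mul_pow, mul_pow]
        have : (s + 2 * lam) ^ 2 * (1 + lam) < (1 - s - 2 * lam) ^ 2 := by
          have k1 : (s + 2 * lam) ^ 2 ≤ 1 := by
            apply pow_le_one₀ (by positivity)
            linarith
          have k2 : (1 - s - 2 * lam) ^ 2 - (s + 2 * lam) ^ 2 = 1 - 2 * s - 4 * lam := by ring
          nlinarith
        have hpos : 0 < p * |d| ^ 2 := by positivity
        have := mul_lt_mul_of_pos_left this hpos
        linarith
    _ ≤ p * l₂ / (p + l₂) * (P / p - P₂ / l₂ - d) ^ 2 := by gcongr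

/-! ### Gains from adding or moving a break point near a change point -/

/-- Partial sums of the noise that start at a change point are small compared with the jump, down to
the scale of the acceptance radius `α`. -/
def LocalNoise (S : MeanModel) (e : ℕ → ℝ) (α η : ℝ) : Prop :=
  ∀ j ∈ Finset.Icc 1 S.q, ∀ c, S.cp (j - 1) ≤ c → c ≤ S.cp (j + 1) →
    |S.d j| * |∑ t ∈ Finset.Ioc c (S.cp j), e t| ≤ η * max (scaledError S c j) α ∧
    |S.d j| * |∑ t ∈ Finset.Ioc (S.cp j) c, e t| ≤ η * max (scaledError S c j) α

lemma left_far {X c a k r R : ℝ} (hX : 0 < X) (hc : X * |c - k| ≤ r) (ha : R < X * |a - k|)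
    (hrR : r ≤ R) (hac : a < c) : a < k ∧ R - r ≤ X * (c - a) := by
  have h1 : |c - k| < |a - k| := lt_of_mul_lt_mul_left (by linarith) hX.le
  have h2 : a < k := by
    by_contra! hcon
    rw [abs_of_nonneg (by linarith), abs_of_nonneg (by linarith)] at h1
    linarith
  rw [abs_of_neg (by linarith)] at ha
  have h3 := mul_le_mul_of_nonneg_left (neg_abs_le (c - k)) hX.le
  exact ⟨h2, by linarith⟩

lemma right_far {X c b k r R : ℝ} (hX : 0 < X) (hc : X * |c - k| ≤ r) (hb : R < X * |b - k|)
    (hrR : r ≤ R) (hcb : c < b) : k < b ∧ R - r ≤ X * (b - c) := by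
  have h1 : |c - k| < |b - k| := lt_of_mul_lt_mul_left (by linarith) hX.le
  have h2 : k < b := by
    by_contra! hcon
    rw [abs_of_nonpos (by linarith), abs_of_nonpos (by linarith)] at h1
    linarith
  rw [abs_of_pos (by linarith)] at hb
  have h3 := mul_le_mul_of_nonneg_left (le_abs_self (c - k)) hX.le
  exact ⟨h2, by linarith⟩

lemma cast_sub_le_abs (u k : ℕ) : ((u - k : ℕ) : ℝ) ≤ |(u : ℝ) - k| := by
  rcases le_total k u with h | h
  · rw [Nat.cast_sub h]
    exact le_abs_self _
  · rw [Nat.sub_eq_zero_of_le h]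
    simp

namespace RegularSample

variable {n : ℕ} {S : MeanModel} {e : ℕ → ℝ} {ξ α η T : ℝ}

lemma far_left_of_not_covers (H : RegularSample n S e ξ α η) {θ : ℝ} (hθ : θ * η ≤ 1 / 16)
    {A : Finset ℕ} {a b j : ℕ} (hj : j ∈ Finset.Icc 1 S.q) (hgap : IsGap n A a b)
    (h : ¬ Covers S A (θ * ξ) j) : θ * ξ < scaledError S a j := by
  by_contra! hcon
  rcases hgap.1 with rfl | ha
  · exact absurd (H.pos_of_close hθ hj hcon) (lt_irrefl _)
  · exact h ⟨a, ha, hcon⟩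

lemma far_right_of_not_covers (H : RegularSample n S e ξ α η) {θ : ℝ} (hθ : θ * η ≤ 1 / 16)
    {A : Finset ℕ} {a b j : ℕ} (hj : j ∈ Finset.Icc 1 S.q) (hgap : IsGap n A a b)
    (h : ¬ Covers S A (θ * ξ) j) : θ * ξ < scaledError S b j := by
  by_contra! hcon
  rcases hgap.2.1 with rfl | hb
  · exact absurd (H.lt_n_of_close hθ hj hcon) (lt_irrefl _)
  · exact h ⟨b, hb, hcon⟩

lemma mem_Ioo_of_close (H : RegularSample n S e ξ α η) (hT : T * η ≤ 1 / 16) {j c : ℕ}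
    (hj : j ∈ Finset.Icc 1 S.q) (hc : scaledError S c j ≤ T * ξ) : c ∈ Finset.Ioo 0 n :=
  Finset.mem_Ioo.2 ⟨H.pos_of_close hT hj hc, H.lt_n_of_close hT hj hc⟩

/-- A point close to the change point `j` lies in the central part of the interval formed by the two
neighbouring change points. -/
lemma position_of_close (H : RegularSample n S e ξ α η) (hT : T * η ≤ 1 / 16) {j c : ℕ}
    (hj : j ∈ Finset.Icc 1 S.q) (hc : scaledError S c j ≤ T * ξ) :
    (S.cp j : ℝ) - c ≤ ((S.cp j : ℝ) - S.cp (j - 1)) / 4 ∧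
      (c : ℝ) - S.cp j ≤ ((S.cp (j + 1) : ℝ) - S.cp j) / 4 ∧
      S.cp (j - 1) ≤ c ∧ c ≤ S.cp (j + 1) := by
  have hj' := Finset.mem_Icc.1 hj
  have h1 := abs_le.1 (H.abs_le_left hT hj (i := j - 1) (by omega) hc)
  have h2 := abs_le.1 (H.abs_le_right hT hj (i := j + 1) (by omega) (by omega) hc)
  have h3 : (S.cp (j - 1) : ℝ) < S.cp j := by
    exact_mod_cast H.valid.cp_lt (by omega) (by omega)
  have h4 : (S.cp j : ℝ) < S.cp (j + 1) := by
    exact_mod_cast H.valid.cp_lt (by omega) (by omega)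
  refine ⟨by linarith, by linarith, ?_, ?_⟩
  · have : (S.cp (j - 1) : ℝ) ≤ c := by linarith
    exact_mod_cast this
  · have : (c : ℝ) ≤ S.cp (j + 1) := by linarith
    exact_mod_cast this

lemma level_eq (S : MeanModel) {j : ℕ} (hj : j ∈ Finset.Icc 1 S.q) :
    S.level j = S.level (j - 1) + S.d j := by
  rw [Finset.mem_Icc] at hj
  obtain ⟨r, rfl⟩ : ∃ r, j = r + 1 := ⟨j - 1, by omega⟩
  exact S.level_succ r

/-- A candidate near an uncovered change point reduces the residual sum of squares considerably. -/
lemma le_RSS_sub_RSS_insert (H : RegularSample n S e ξ α η) (hT0 : 0 ≤ T) (hT : T * η ≤ 1 / 16)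
    {θ : ℝ} (hθ0 : 0 < θ) (hθT : θ ≤ T) (hs : 2 * T * η + √(η / (θ / 2)) ≤ 1 / 8)
    {j : ℕ} (hj : j ∈ Finset.Icc 1 S.q) {A : Finset ℕ} (hA : A ⊆ Finset.Ioo 0 n)
    (hcov : ∀ i ∈ Finset.Icc 1 S.q, i ≠ j → Covers S A (T * ξ) i)
    (hncov : ¬ Covers S A (θ * ξ) j) {g : ℕ} (hg : scaledError S g j ≤ θ / 16 * ξ) :
    θ * ξ / 16 ≤ RSS n (fun t => S.mean t + e t) A -
      RSS n (fun t => S.mean t + e t) (insert g A) := by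
  have hξ := H.ξ_pos
  have hη := H.η_pos
  have hX := H.d_sq_pos hj
  have hgT : scaledError S g j ≤ T * ξ := hg.trans (by gcongr; linarith)
  have hgA : g ∉ A := fun h => hncov ⟨g, h, hg.trans (by gcongr; linarith)⟩
  obtain ⟨a, b, hgap, hag, hgb⟩ := exists_isGap (H.mem_Ioo_of_close hT hj hgT) hgA
  have hagR : (a : ℝ) < g := by exact_mod_cast hag
  have hgbR : (g : ℝ) < b := by exact_mod_cast hgb
  have hbn := hgap.le hA
  have hθη : θ * η ≤ 1 / 16 := (mul_le_mul_of_nonneg_right hθT hη.le).trans hT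
  obtain ⟨ha1, ha2⟩ := left_far hX hg (H.far_left_of_not_covers hθη hj hgap hncov)
    (by gcongr; linarith) hagR
  obtain ⟨hb1, hb2⟩ := right_far hX hg (H.far_right_of_not_covers hθη hj hgap hncov)
    (by gcongr; linarith) hgbR
  have haj : a < S.cp j := by exact_mod_cast ha1
  have hjb : S.cp j < b := by exact_mod_cast hb1
  obtain ⟨p1, p2, p3, p4⟩ := H.position_of_close hT hj hgT
  have hθξ : 0 < θ * ξ := by positivity
  have hL := H.left_mean hT0 hT hj hgap hcov hag hgb hbn p1 p4 haj.le (ℓ := θ / 2)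
    (m := θ / 16) (by positivity) (by positivity) (by linarith)
    ((mul_le_mul_of_nonneg_left (cast_sub_le_abs _ _) hX.le).trans hg)
  have hR := H.right_mean hT0 hT hj hgap hcov hag hgb hbn p2 p3 hjb.le (ℓ := θ / 2)
    (m := θ / 16) (by positivity) (by positivity) (by linarith)
    ((mul_le_mul_of_nonneg_left (cast_sub_le_abs _ _) hX.le).trans
      (by rw [abs_sub_comm]; exact hg))
  have hsum : 2 * T * η + θ / 16 / (θ / 2) + √(η / (θ / 2)) ≤ 1 / 4 := by
    have : θ / 16 / (θ / 2) = 1 / 8 := by field_simp; norm_num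
    rw [this]
    linarith
  have hlev := level_eq S hj
  rw [RSS_insert _ hA hgap hag hgb (S.level (j - 1)),
    sum_sub_level_shift (a := g) (u := b) _ hgb.le (S.level (j - 1)) (S.d j), ← hlev]
  have := le_splitGain (p := (g : ℝ) - a) (q := (b : ℝ) - g)
    (P := ∑ t ∈ Finset.Ioc a g, (S.mean t + e t - S.level (j - 1)))
    (Q := ∑ t ∈ Finset.Ioc g b, (S.mean t + e t - S.level j)) (d := S.d j) (w := θ * ξ / 2)
    (by linarith) (by linarith)
    (hL.trans (by
      have := mul_le_mul_of_nonneg_right hsum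
        (mul_nonneg (abs_nonneg (S.d j)) (sub_nonneg.2 hagR.le))
      linarith))
    (hR.trans (by
      have := mul_le_mul_of_nonneg_right hsum
        (mul_nonneg (abs_nonneg (S.d j)) (sub_nonneg.2 hgbR.le))
      linarith)) (by linarith) (by linarith)
  linarith

lemma mid_left_sum (H : RegularSample n S e ξ α η) {j : ℕ} (hj : j ∈ Finset.Icc 1 S.q) {c g : ℕ}
    (hc : S.cp (j - 1) ≤ c) (hcj : c ≤ S.cp j) (hg : g ≤ S.cp (j + 1)) :
    ∑ t ∈ Finset.Ioc c g, (S.mean t - S.level (j - 1)) = S.d j * ((g - S.cp j : ℕ) : ℝ) := by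
  have hj' := Finset.mem_Icc.1 hj
  have hle := H.valid.cp_le (i := j - 1 - 1) (j := j - 1) (by omega) (by omega)
  rw [H.valid.sum_mean_sub_level (p := j - 1) (by omega) (hle.trans hc)
    (Or.inr ⟨by omega, by rwa [show j - 1 + 2 = j + 1 by omega]⟩),
    show j - 1 + 1 = j by omega, max_eq_right hcj, show min g (S.cp (j - 1)) - c = 0 by omega]
  simp

lemma mid_right_sum (H : RegularSample n S e ξ α η) {j : ℕ} (hj : j ∈ Finset.Icc 1 S.q) {c g : ℕ}
    (hc : c ≤ S.cp (j + 1)) (hcj : S.cp j ≤ c) (hg : S.cp (j - 1) ≤ g) :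
    ∑ t ∈ Finset.Ioc g c, (S.mean t - S.level j) = -S.d j * ((S.cp j - g : ℕ) : ℝ) := by
  have hj' := Finset.mem_Icc.1 hj
  rw [H.valid.sum_mean_sub_level (p := j) (by omega) hg (Or.inl hc),
    min_eq_right hcj, show c - max g (S.cp (j + 1)) = 0 by omega]
  simp

/-- If the end points of an interval lie on different sides of a change point, or one of them is
nearer to it than `α`, the signal contributes little to the normalised sum. -/
lemma mid_sq {p x d N ξ η : ℝ} (hx : 0 ≤ x) (hxp : x ≤ p)
    (hd : d ^ 2 * x ≤ η * ξ) (hN : N ^ 2 ≤ η * ξ * p) :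
    (d * x + N) ^ 2 ≤ 4 * η * ξ * p := by
  have h1 := add_sq_le (a := d * x) (b := N)
  have h2 : (d * x) ^ 2 ≤ η * ξ * p := by
    calc (d * x) ^ 2 = d ^ 2 * x * x := by ring
      _ ≤ η * ξ * p := by
        apply mul_le_mul hd hxp hx
        exact le_trans (by positivity) hd
  linarith

/-- Both positions, close to the same change point and not separated by a break point, lie in the
same gap. -/
lemma exists_common_gap (H : RegularSample n S e ξ α η) (hT : T * η ≤ 1 / 16) {j c g : ℕ}
    (hj : j ∈ Finset.Icc 1 S.q) {A : Finset ℕ}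
    (hc : scaledError S c j ≤ T * ξ) (hg : scaledError S g j ≤ T * ξ)
    (hsep : ∀ x ∈ A, (x < c ∧ x < g) ∨ (c < x ∧ g < x)) :
    ∃ a b, IsGap n A a b ∧ a < c ∧ c < b ∧ a < g ∧ g < b := by
  have hgA : g ∉ A := fun h => by have := hsep g h; omega
  have hc' := Finset.mem_Ioo.1 (H.mem_Ioo_of_close hT hj hc)
  obtain ⟨a, b, hgap, hag, hgb⟩ := exists_isGap (H.mem_Ioo_of_close hT hj hg) hgA
  refine ⟨a, b, hgap, ?_, ?_, hag, hgb⟩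
  · rcases hgap.1 with rfl | ha
    · exact hc'.1
    · have := hsep a ha
      omega
  · rcases hgap.2.1 with rfl | hb
    · exact hc'.2
    · have := hsep b hb
      omega

/-- Moving a break point at scaled distance more than `σ ξ` from a change point, which has no break
point within this distance, to a position within `α` reduces the residual sum of squares. -/
lemma RSS_swap_lt_coarse (H : RegularSample n S e ξ α η) (hT0 : 0 ≤ T) (hT : T * η ≤ 1 / 16)
    {σ : ℝ} (hσ0 : 0 < σ) (hσT : σ ≤ T) (hησ : 34 * (4 * T ^ 2 + 4) * η ≤ σ)
    (hs : 2 * T * η + η / (σ / 2) + √(η / (σ / 2)) ≤ 1 / 4)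
    {j : ℕ} (hj : j ∈ Finset.Icc 1 S.q) {A : Finset ℕ} (hA : A ⊆ Finset.Ioo 0 n)
    (hcov : ∀ i ∈ Finset.Icc 1 S.q, i ≠ j → Covers S A (T * ξ) i)
    (hncov : ¬ Covers S A (σ * ξ) j) {c g : ℕ} (hg : scaledError S g j ≤ α)
    (hc1 : σ * ξ < scaledError S c j) (hc2 : scaledError S c j ≤ T * ξ)
    (hsep : ∀ x ∈ A, (x < c ∧ x < g) ∨ (c < x ∧ g < x)) :
    RSS n (fun t => S.mean t + e t) (insert g A) <
      RSS n (fun t => S.mean t + e t) (insert c A) := by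
  have hξ := H.ξ_pos
  have hη := H.η_pos
  have hX := H.d_sq_pos hj
  have hg' : scaledError S g j ≤ η * ξ := hg.trans H.α_le
  have hησ' : 2 * η ≤ σ := by nlinarith [mul_nonneg (sq_nonneg T) hη.le]
  have hησξ : 2 * (η * ξ) ≤ σ * ξ := by nlinarith
  have hσξ : σ * ξ ≤ T * ξ := by gcongr
  have hηξ : 0 < η * ξ := by positivity
  have hgT : scaledError S g j ≤ T * ξ := by linarith
  have hση : σ * η ≤ 1 / 16 := (mul_le_mul_of_nonneg_right hσT hη.le).trans hT
  obtain ⟨a, b, hgap, hac, hcb, hag, hgb⟩ := H.exists_common_gap hT hj hc2 hgT hsep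
  have hagR : (a : ℝ) < g := by exact_mod_cast hag
  have hgbR : (g : ℝ) < b := by exact_mod_cast hgb
  have hacR : (a : ℝ) < c := by exact_mod_cast hac
  have hcbR : (c : ℝ) < b := by exact_mod_cast hcb
  have hbn := hgap.le hA
  obtain ⟨ha1, ha2⟩ := left_far hX hg' (H.far_left_of_not_covers hση hj hgap hncov)
    (by linarith) hagR
  obtain ⟨hb1, hb2⟩ := right_far hX hg' (H.far_right_of_not_covers hση hj hgap hncov)
    (by linarith) hgbR
  have haj : a < S.cp j := by exact_mod_cast ha1
  have hjb : S.cp j < b := by exact_mod_cast hb1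
  obtain ⟨p1, p2, p3, p4⟩ := H.position_of_close hT hj hgT
  obtain ⟨q1, q2, q3, q4⟩ := H.position_of_close hT hj hc2
  have hlev := level_eq S hj
  have hlev' : S.level (j - 1) = S.level j + -S.d j := by rw [hlev]; ring
  have hgL := (mul_le_mul_of_nonneg_left (cast_sub_le_abs g (S.cp j)) hX.le).trans hg'
  have hgR : S.d j ^ 2 * ((S.cp j - g : ℕ) : ℝ) ≤ η * ξ :=
    (mul_le_mul_of_nonneg_left (cast_sub_le_abs (S.cp j) g) hX.le).trans
      (by rw [abs_sub_comm]; exact hg')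
  have hwpos : 0 < σ * ξ / 2 := by positivity
  have hζ : 17 * ((4 * T ^ 2 + 4) * η * ξ) ≤ σ * ξ / 2 := by
    have := mul_le_mul_of_nonneg_right hησ hξ.le
    linarith
  rcases lt_trichotomy c g with hcg | rfl | hcg
  · have hcgR : (c : ℝ) < g := by exact_mod_cast hcg
    obtain ⟨hc3, hc4⟩ := left_far hX hg' hc1 (by linarith) hcgR
    have hcj : c < S.cp j := by exact_mod_cast hc3
    have hL := H.left_sq hT0 hT hj hgap hcov hac hcb hbn q1 hcj.le
    have hR := H.right_mean hT0 hT hj hgap hcov hag hgb hbn p2 p3 hjb.le (ℓ := σ / 2)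
      (m := η) (by positivity) hη.le (by linarith) hgR
    have hI : (∑ t ∈ Finset.Ioc c g, (S.mean t + e t - S.level (j - 1))) ^ 2 ≤
        (4 * T ^ 2 + 4) * η * ξ * ((g : ℝ) - c) := by
      rw [sum_obs, H.mid_left_sum hj q3 hcj.le p4]
      refine (mid_sq (Nat.cast_nonneg _) ?_ hgL (H.noise c g hcg (by omega))).trans ?_
      · rw [← Nat.cast_sub hcg.le]
        exact_mod_cast (by omega : g - S.cp j ≤ g - c)
      · have : 0 ≤ T ^ 2 * η * ξ * ((g : ℝ) - c) :=
          mul_nonneg (by positivity) (by linarith)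
        linarith
    have := splitGain_lt_coarse (l₁ := (c : ℝ) - a) (p := (g : ℝ) - c) (l₂ := (b : ℝ) - g)
      (d := S.d j) (w := σ * ξ / 2) (by linarith) (by linarith) (by linarith) hL hI
      (hR.trans (by
        have := mul_le_mul_of_nonneg_right hs
          (mul_nonneg (abs_nonneg (S.d j)) (sub_nonneg.2 hgbR.le))
        linarith)) hwpos (by linarith) (by linarith) hζ
    rw [← sub_pos, RSS_swap _ hA hgap hac hcg hgb (S.level (j - 1)),
      sum_sub_level_shift (a := g) (u := b) _ hgb.le (S.level (j - 1)) (S.d j), ← hlev]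
    linarith
  · linarith
  · have hcgR : (g : ℝ) < c := by exact_mod_cast hcg
    obtain ⟨hc3, hc4⟩ := right_far hX hg' hc1 (by linarith) hcgR
    have hcj : S.cp j < c := by exact_mod_cast hc3
    have hR := H.right_sq hT0 hT hj hgap hcov hac hcb hbn q2 hcj.le
    have hL := H.left_mean hT0 hT hj hgap hcov hag hgb hbn p1 p4 haj.le (ℓ := σ / 2)
      (m := η) (by positivity) hη.le (by linarith) hgL
    have hI : (∑ t ∈ Finset.Ioc g c, (S.mean t + e t - S.level j)) ^ 2 ≤
        (4 * T ^ 2 + 4) * η * ξ * ((c : ℝ) - g) := by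
      rw [sum_obs, H.mid_right_sum hj q4 hcj.le p3]
      refine (mid_sq (Nat.cast_nonneg _) ?_ (by rwa [neg_sq])
        (H.noise g c hcg (by omega))).trans ?_
      · rw [← Nat.cast_sub hcg.le]
        exact_mod_cast (by omega : S.cp j - g ≤ c - g)
      · have : 0 ≤ T ^ 2 * η * ξ * ((c : ℝ) - g) :=
          mul_nonneg (by positivity) (by linarith)
        linarith
    have := splitGain_lt_coarse (l₁ := (b : ℝ) - c) (p := (c : ℝ) - g) (l₂ := (g : ℝ) - a)
      (d := -S.d j) (w := σ * ξ / 2) (by linarith) (by linarith) (by linarith) hR hI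
      (hL.trans (by
        rw [abs_neg]
        have := mul_le_mul_of_nonneg_right hs
          (mul_nonneg (abs_nonneg (S.d j)) (sub_nonneg.2 hagR.le))
        linarith)) hwpos (by rw [neg_sq]; linarith) (by rw [neg_sq]; linarith) hζ
    rw [splitGain_comm ((b : ℝ) - c), splitGain_comm ((c : ℝ) - g) ((g : ℝ) - a)] at this
    rw [← sub_neg, RSS_swap _ hA hgap hag hcg hcb (S.level j),
      sum_sub_level_shift (a := a) (u := g) _ hag.le (S.level j) (-S.d j), ← hlev']
    linarith

/-- The bounds on the interval between the two split points that `splitGain_lt_fine` needs, where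
`x` is the length of its part beyond the change point, `N` its noise sum, and `y` and at most `α`
are the scaled errors of its end points. -/
lemma mid_abs {p x d N α η K lam y : ℝ} (hd : d ≠ 0) (hx : 0 ≤ x) (hK : 1 < K)
    (hη : 0 < η) (hα : 0 < α) (hlam : 2 * η ≤ lam * (1 - 1 / K)) (hy : K * α < y)
    (hp : y - α ≤ d ^ 2 * p)
    (hxp : (1 + K) * x ≤ p) (hN : |d| * |N| ≤ η * (y + α)) :
    |d * x + N| ≤ (1 / (1 + K) + lam) * |d| * p := by
  have hd' : 0 < |d| := abs_pos.2 hd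
  have h1 : |d * x| ≤ 1 / (1 + K) * |d| * p := by
    rw [abs_mul, abs_of_nonneg hx]
    have : x ≤ 1 / (1 + K) * p := by
      rw [div_mul_eq_mul_div, one_mul, le_div_iff₀ (by linarith)]
      linarith
    calc |d| * x ≤ |d| * (1 / (1 + K) * p) := by gcongr
      _ = _ := by ring
  have hαy : α < y / K := by
    rw [lt_div_iff₀ (by linarith)]
    linarith
  have hK1 : 1 / K < 1 := by
    rw [div_lt_one (by linarith)]
    exact hK
  have hlam0 : 0 < lam := by
    by_contra! hcon
    nlinarith
  have h2 : |N| ≤ lam * |d| * p := by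
    have : |d| * |N| ≤ |d| * (lam * |d| * p) := by
      have e1 : y + α ≤ 2 * y := by nlinarith
      have e2 : y * (1 - 1 / K) ≤ d ^ 2 * p := by
        have : y * (1 - 1 / K) = y - y / K := by ring
        linarith
      calc |d| * |N| ≤ η * (y + α) := hN
        _ ≤ η * (2 * y) := by gcongr
        _ = 2 * η * y := by ring
        _ ≤ lam * (1 - 1 / K) * y := by
          apply mul_le_mul_of_nonneg_right hlam
          nlinarith
        _ = lam * (y * (1 - 1 / K)) := by ring
        _ ≤ lam * (d ^ 2 * p) := by gcongr
        _ = |d| * (lam * |d| * p) := by rw [← sq_abs d]; ring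
    exact le_of_mul_le_mul_left this hd'
  calc |d * x + N| ≤ |d * x| + |N| := abs_add_le _ _
    _ ≤ _ := by linarith

set_option maxHeartbeats 400000 in
/-- Moving a break point of scaled error between `K α` and `σ ξ` to a position with scaled error at
most `α` reduces the residual sum of squares, provided that no other break point lies within
`τ ξ`, where `τ` is large compared with `σ`. -/
lemma RSS_swap_lt_fine (H : RegularSample n S e ξ α η) (hloc : LocalNoise S e α η)
    (hT0 : 0 ≤ T) (hT : T * η ≤ 1 / 16)
    {σ τ K lam : ℝ} (hK : 1 < K) (hlam0 : 0 < lam) (hlamK : 5 * lam < (K - 1) / (K + 1))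
    (hτT : τ ≤ T) (hητ : 2 * η ≤ τ) (hστ : 2 * σ ≤ τ) (hστ' : 4 * σ ≤ lam * τ)
    (hηK : 2 * η ≤ lam * (1 - 1 / K))
    (hs : 2 * T * η + η / (τ / 2) + √(η / (τ / 2)) ≤ lam)
    {j : ℕ} (hj : j ∈ Finset.Icc 1 S.q) {A : Finset ℕ} (hA : A ⊆ Finset.Ioo 0 n)
    (hcov : ∀ i ∈ Finset.Icc 1 S.q, i ≠ j → Covers S A (T * ξ) i)
    (hncov : ¬ Covers S A (τ * ξ) j) {c g : ℕ} (hg : scaledError S g j ≤ α)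
    (hc1 : K * α < scaledError S c j) (hc2 : scaledError S c j ≤ σ * ξ)
    (hsep : ∀ x ∈ A, (x < c ∧ x < g) ∨ (c < x ∧ g < x)) :
    RSS n (fun t => S.mean t + e t) (insert g A) <
      RSS n (fun t => S.mean t + e t) (insert c A) := by
  have hξ := H.ξ_pos
  have hη := H.η_pos
  have hα := H.α_pos
  have hX := H.d_sq_pos hj
  have hd := H.valid.d_ne_zero hj
  have hτ0 : 0 < τ := by linarith
  have hηξ : 0 < η * ξ := by positivity
  have hg' : scaledError S g j ≤ η * ξ := hg.trans H.α_le
  have hητξ : 2 * (η * ξ) ≤ τ * ξ := by nlinarith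
  have hστξ : 2 * (σ * ξ) ≤ τ * ξ := by nlinarith
  have hστξ' : 4 * (σ * ξ) ≤ lam * (τ * ξ) := by nlinarith
  have hτξ : τ * ξ ≤ T * ξ := by gcongr
  have hαK : α < K * α := by nlinarith
  have hgT : scaledError S g j ≤ T * ξ := by linarith
  have hcT : scaledError S c j ≤ T * ξ := by linarith
  have hτη : τ * η ≤ 1 / 16 := (mul_le_mul_of_nonneg_right hτT hη.le).trans hT
  obtain ⟨a, b, hgap, hac, hcb, hag, hgb⟩ := H.exists_common_gap hT hj hcT hgT hsep
  have hagR : (a : ℝ) < g := by exact_mod_cast hag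
  have hgbR : (g : ℝ) < b := by exact_mod_cast hgb
  have hacR : (a : ℝ) < c := by exact_mod_cast hac
  have hcbR : (c : ℝ) < b := by exact_mod_cast hcb
  have hbn := hgap.le hA
  have hfa := H.far_left_of_not_covers hτη hj hgap hncov
  have hfb := H.far_right_of_not_covers hτη hj hgap hncov
  obtain ⟨ha1, ha2⟩ := left_far hX hg' hfa (by linarith) hagR
  obtain ⟨hb1, hb2⟩ := right_far hX hg' hfb (by linarith) hgbR
  obtain ⟨-, ha3⟩ := left_far hX hc2 hfa (by linarith) hacR
  obtain ⟨-, hb3⟩ := right_far hX hc2 hfb (by linarith) hcbR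
  have haj : a < S.cp j := by exact_mod_cast ha1
  have hjb : S.cp j < b := by exact_mod_cast hb1
  obtain ⟨p1, p2, p3, p4⟩ := H.position_of_close hT hj hgT
  obtain ⟨q1, q2, q3, q4⟩ := H.position_of_close hT hj hcT
  have hlev := level_eq S hj
  have hlev' : S.level (j - 1) = S.level j + -S.d j := by rw [hlev]; ring
  have hgL := (mul_le_mul_of_nonneg_left (cast_sub_le_abs g (S.cp j)) hX.le).trans hg'
  have hgR : S.d j ^ 2 * ((S.cp j - g : ℕ) : ℝ) ≤ η * ξ :=
    (mul_le_mul_of_nonneg_left (cast_sub_le_abs (S.cp j) g) hX.le).trans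
      (by rw [abs_sub_comm]; exact hg')
  obtain ⟨nc1, nc2⟩ := hloc j hj c q3 q4
  obtain ⟨ng1, ng2⟩ := hloc j hj g p3 p4
  rw [max_eq_left (by linarith)] at nc1 nc2
  rw [max_eq_right hg] at ng1 ng2
  have hd0 := abs_nonneg (S.d j)
  have hmul : ∀ {l : ℝ}, 0 ≤ l →
      (2 * T * η + η / (τ / 2) + √(η / (τ / 2))) * |S.d j| * l ≤ lam * |S.d j| * l :=
    fun hl => by gcongr
  rcases lt_trichotomy c g with hcg | rfl | hcg
  · have hcgR : (c : ℝ) < g := by exact_mod_cast hcg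
    obtain ⟨hc3, hc4⟩ := left_far hX hg hc1 (by linarith) hcgR
    have hcj : c < S.cp j := by exact_mod_cast hc3
    have hy : scaledError S c j = S.d j ^ 2 * ((S.cp j : ℝ) - c) := by
      unfold scaledError
      rw [abs_of_neg (by linarith)]
      ring
    have hgk := mul_le_mul_of_nonneg_left (neg_abs_le ((g : ℝ) - S.cp j)) hX.le
    have hgk' := mul_le_mul_of_nonneg_left (le_abs_self ((g : ℝ) - S.cp j)) hX.le
    unfold scaledError at hg
    have hL := H.left_mean hT0 hT hj hgap hcov hac hcb hbn q1 q4 haj.le (ℓ := τ / 2)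
      (m := η) (by positivity) hη.le (by linarith)
      (by rw [show c - S.cp j = 0 by omega]; simpa using hηξ.le)
    have hR := H.right_mean hT0 hT hj hgap hcov hag hgb hbn p2 p3 hjb.le (ℓ := τ / 2)
      (m := η) (by positivity) hη.le (by linarith) hgR
    have hI : |∑ t ∈ Finset.Ioc c g, (S.mean t + e t - S.level (j - 1))| ≤
        (1 / (1 + K) + lam) * |S.d j| * ((g : ℝ) - c) := by
      rw [sum_obs, H.mid_left_sum hj q3 hcj.le p4]
      refine mid_abs (y := scaledError S c j) hd (Nat.cast_nonneg _) hK hη hα hηK hc1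
        (by rw [hy]; linarith) ?_ ?_
      · rcases le_total g (S.cp j) with h | h
        · rw [Nat.sub_eq_zero_of_le h]
          push_cast
          linarith
        · rw [Nat.cast_sub h]
          have h1 : S.d j ^ 2 * (K * ((g : ℝ) - S.cp j)) ≤ S.d j ^ 2 * ((S.cp j : ℝ) - c) := by
            have := mul_le_mul_of_nonneg_left (hgk'.trans hg) (by linarith : 0 ≤ K)
            linarith
          have := le_of_mul_le_mul_left h1 hX
          linarith
      · rcases le_total g (S.cp j) with h | h
        · have h1 := Finset.sum_Ioc_consecutive e hcg.le h
          have h2 : |∑ t ∈ Finset.Ioc c g, e t| ≤ |∑ t ∈ Finset.Ioc c (S.cp j), e t| +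
              |∑ t ∈ Finset.Ioc g (S.cp j), e t| := by
            rw [← h1]
            have := abs_sub (∑ t ∈ Finset.Ioc c g, e t + ∑ t ∈ Finset.Ioc g (S.cp j), e t)
              (∑ t ∈ Finset.Ioc g (S.cp j), e t)
            rwa [add_sub_cancel_right] at this
          have := mul_le_mul_of_nonneg_left h2 hd0
          linarith
        · rw [← Finset.sum_Ioc_consecutive e hcj.le h]
          have := mul_le_mul_of_nonneg_left (abs_add_le (∑ t ∈ Finset.Ioc c (S.cp j), e t)
            (∑ t ∈ Finset.Ioc (S.cp j) g, e t)) hd0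
          linarith
    have := splitGain_lt_fine (l₁ := (c : ℝ) - a) (p := (g : ℝ) - c) (l₂ := (b : ℝ) - g)
      (d := S.d j) (by linarith) (by linarith) (by linarith) hd hK hlam0 hlamK
      (hL.trans (hmul (by linarith))) hI (hR.trans (hmul (by linarith)))
      (by
        have h1 : S.d j ^ 2 * ((g : ℝ) - c) ≤ S.d j ^ 2 * (lam * ((b : ℝ) - g)) := by
          have h2 := mul_le_mul_of_nonneg_left hb2 hlam0.le
          have h3 := mul_le_mul_of_nonneg_left hητξ hlam0.le
          linarith
        exact le_of_mul_le_mul_left h1 hX)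
    rw [← sub_pos, RSS_swap _ hA hgap hac hcg hgb (S.level (j - 1)),
      sum_sub_level_shift (a := g) (u := b) _ hgb.le (S.level (j - 1)) (S.d j), ← hlev]
    linarith
  · linarith
  · have hcgR : (g : ℝ) < c := by exact_mod_cast hcg
    obtain ⟨hc3, hc4⟩ := right_far hX hg hc1 (by linarith) hcgR
    have hcj : S.cp j < c := by exact_mod_cast hc3
    have hy : scaledError S c j = S.d j ^ 2 * ((c : ℝ) - S.cp j) := by
      unfold scaledError
      rw [abs_of_pos (by linarith)]
    have hgk := mul_le_mul_of_nonneg_left (neg_abs_le ((g : ℝ) - S.cp j)) hX.le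
    have hgk' := mul_le_mul_of_nonneg_left (le_abs_self ((g : ℝ) - S.cp j)) hX.le
    unfold scaledError at hg
    have hR := H.right_mean hT0 hT hj hgap hcov hac hcb hbn q2 q3 hjb.le (ℓ := τ / 2)
      (m := η) (by positivity) hη.le (by linarith)
      (by rw [show S.cp j - c = 0 by omega]; simpa using hηξ.le)
    have hL := H.left_mean hT0 hT hj hgap hcov hag hgb hbn p1 p4 haj.le (ℓ := τ / 2)
      (m := η) (by positivity) hη.le (by linarith) hgL
    have hI : |∑ t ∈ Finset.Ioc g c, (S.mean t + e t - S.level j)| ≤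
        (1 / (1 + K) + lam) * |(-S.d j)| * ((c : ℝ) - g) := by
      rw [sum_obs, H.mid_right_sum hj q4 hcj.le p3]
      refine mid_abs (y := scaledError S c j) (neg_ne_zero.2 hd) (Nat.cast_nonneg _) hK hη hα
        hηK hc1 (by rw [hy, neg_sq]; linarith) ?_ ?_
      · rcases le_total (S.cp j) g with h | h
        · rw [Nat.sub_eq_zero_of_le h]
          push_cast
          linarith
        · rw [Nat.cast_sub h]
          have h1 : S.d j ^ 2 * (K * ((S.cp j : ℝ) - g)) ≤ S.d j ^ 2 * ((c : ℝ) - S.cp j) := by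
            have h2 : S.d j ^ 2 * ((S.cp j : ℝ) - g) ≤ α := by linarith
            have := mul_le_mul_of_nonneg_left h2 (by linarith : 0 ≤ K)
            linarith
          have := le_of_mul_le_mul_left h1 hX
          linarith
      · rw [abs_neg]
        rcases le_total (S.cp j) g with h | h
        · have h1 := Finset.sum_Ioc_consecutive e h hcg.le
          have h2 : |∑ t ∈ Finset.Ioc g c, e t| ≤ |∑ t ∈ Finset.Ioc (S.cp j) c, e t| +
              |∑ t ∈ Finset.Ioc (S.cp j) g, e t| := by
            rw [← h1]
            have := abs_sub (∑ t ∈ Finset.Ioc (S.cp j) g, e t + ∑ t ∈ Finset.Ioc g c, e t)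
              (∑ t ∈ Finset.Ioc (S.cp j) g, e t)
            rwa [add_sub_cancel_left] at this
          have := mul_le_mul_of_nonneg_left h2 hd0
          linarith
        · rw [← Finset.sum_Ioc_consecutive e h hcj.le]
          have := mul_le_mul_of_nonneg_left (abs_add_le (∑ t ∈ Finset.Ioc g (S.cp j), e t)
            (∑ t ∈ Finset.Ioc (S.cp j) c, e t)) hd0
          linarith
    have := splitGain_lt_fine (l₁ := (b : ℝ) - c) (p := (c : ℝ) - g) (l₂ := (g : ℝ) - a)
      (d := -S.d j) (by linarith) (by linarith) (by linarith) (neg_ne_zero.2 hd) hK hlam0 hlamK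
      (hR.trans (by rw [abs_neg]; exact hmul (by linarith))) hI
      (hL.trans (by rw [abs_neg]; exact hmul (by linarith)))
      (by
        have h1 : S.d j ^ 2 * ((c : ℝ) - g) ≤ S.d j ^ 2 * (lam * ((g : ℝ) - a)) := by
          have h2 := mul_le_mul_of_nonneg_left ha2 hlam0.le
          have h3 := mul_le_mul_of_nonneg_left hητξ hlam0.le
          linarith
        exact le_of_mul_le_mul_left h1 hX)
    rw [splitGain_comm ((b : ℝ) - c), splitGain_comm ((c : ℝ) - g) ((g : ℝ) - a)] at this
    rw [← sub_neg, RSS_swap _ hA hgap hag hcg hcb (S.level j),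
      sum_sub_level_shift (a := a) (u := g) _ hag.le (S.level j) (-S.d j), ← hlev']
    linarith

end RegularSample

/-! ### Gains from superfluous break points and bounds on the residual sum of squares -/

/-- The normalised sums of squares due to one change point near an end of a gap, which is split into
pieces of lengths `l₁` and `l₂`; the parts of these pieces beyond the change point have lengths
`x₁` and `x₂`. -/
lemma fringe_gain {d x₁ x₂ l₁ l₂ τ T₁ T M ξ : ℝ} (hl₁ : 0 < l₁) (hl₂ : 0 < l₂) (hx₁ : 0 ≤ x₁)
    (hx₂ : 0 ≤ x₂) (hxl₁ : x₁ ≤ l₁) (hxl₂ : x₂ ≤ l₂) (hξ : 0 < ξ) (hM : 0 ≤ M) (hτM : τ ≤ M)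
    (hT : 0 ≤ T) (hT₁ : T₁ ^ 2 ≤ M * T)
    (h : d ^ 2 * (x₁ + x₂) ≤ τ * ξ ∨ x₂ = 0 ∧ d ^ 2 * x₁ ≤ T₁ * ξ ∧ T * ξ < d ^ 2 * l₁) :
    (d * x₁) ^ 2 / l₁ + (d * x₂) ^ 2 / l₂ ≤ M * ξ := by
  rcases h with h | ⟨rfl, h1, h2⟩
  · have e1 : (d * x₁) ^ 2 / l₁ ≤ d ^ 2 * x₁ := by
      rw [div_le_iff₀ hl₁]
      calc (d * x₁) ^ 2 = d ^ 2 * x₁ * x₁ := by ring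
        _ ≤ d ^ 2 * x₁ * l₁ := by gcongr
    have e2 : (d * x₂) ^ 2 / l₂ ≤ d ^ 2 * x₂ := by
      rw [div_le_iff₀ hl₂]
      calc (d * x₂) ^ 2 = d ^ 2 * x₂ * x₂ := by ring
        _ ≤ d ^ 2 * x₂ * l₂ := by gcongr
    have : τ * ξ ≤ M * ξ := by gcongr
    linarith
  · have hd : 0 < d ^ 2 := by
      have : 0 ≤ T * ξ := by positivity
      exact pos_of_mul_pos_left (this.trans_lt h2) hl₁.le
    have e1 : (d * x₁) ^ 2 / l₁ ≤ M * ξ := by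
      rw [div_le_iff₀ hl₁]
      have : d ^ 2 * (d * x₁) ^ 2 ≤ d ^ 2 * (M * ξ * l₁) := by
        calc d ^ 2 * (d * x₁) ^ 2 = (d ^ 2 * x₁) ^ 2 := by ring
          _ ≤ (T₁ * ξ) ^ 2 := by gcongr
          _ = T₁ ^ 2 * ξ ^ 2 := by ring
          _ ≤ M * T * ξ ^ 2 := by gcongr
          _ = M * ξ * (T * ξ) := by ring
          _ ≤ M * ξ * (d ^ 2 * l₁) := by gcongr
          _ = _ := by ring
      exact le_of_mul_le_mul_left this hd
    simpa using e1

lemma splitGain_le_of_parts {p q P Q h₁ h₂ N h₁' h₂' N' M W : ℝ} (hp : 0 < p) (hq : 0 < q)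
    (hP : P = h₁ + h₂ + N) (hQ : Q = h₁' + h₂' + N') (e1 : h₁ ^ 2 / p + h₁' ^ 2 / q ≤ M)
    (e2 : h₂ ^ 2 / p + h₂' ^ 2 / q ≤ M) (hN : N ^ 2 ≤ W * p) (hN' : N' ^ 2 ≤ W * q) :
    splitGain p P q Q ≤ 6 * M + 6 * W := by
  have key : ∀ x y z : ℝ, (x + y + z) ^ 2 ≤ 3 * (x ^ 2 + y ^ 2 + z ^ 2) := fun x y z => by
    nlinarith [sq_nonneg (x - y), sq_nonneg (y - z), sq_nonneg (x - z)]
  have f1 : P ^ 2 / p ≤ 3 * (h₁ ^ 2 / p + h₂ ^ 2 / p + W) := by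
    rw [hP, div_le_iff₀ hp]
    refine (key _ _ _).trans ?_
    have : 3 * (h₁ ^ 2 / p + h₂ ^ 2 / p + W) * p = 3 * (h₁ ^ 2 + h₂ ^ 2 + W * p) := by
      field_simp
    rw [this]
    linarith
  have f2 : Q ^ 2 / q ≤ 3 * (h₁' ^ 2 / q + h₂' ^ 2 / q + W) := by
    rw [hQ, div_le_iff₀ hq]
    refine (key _ _ _).trans ?_
    have : 3 * (h₁' ^ 2 / q + h₂' ^ 2 / q + W) * q = 3 * (h₁' ^ 2 + h₂' ^ 2 + W * q) := by
      field_simp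
    rw [this]
    linarith
  have : 0 ≤ (P + Q) ^ 2 / (p + q) := by positivity
  unfold splitGain
  linarith

lemma MeanModel.IsValid.abs_level_sub_le {S : MeanModel} {B : ℝ}
    (hB : ∀ j ∈ Finset.Icc 1 S.q, |S.d j| ≤ B) (p m : ℕ) (hpm : p + m ≤ S.q) :
    |S.level (p + m) - S.level p| ≤ m * B := by
  induction m with
  | zero => simp
  | succ m ih =>
    have h1 := ih (by omega)
    have h2 := hB (p + m + 1) (Finset.mem_Icc.2 ⟨by omega, by omega⟩)
    rw [show p + (m + 1) = p + m + 1 by omega, S.level_succ,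
      show S.level (p + m) + S.d (p + m + 1) - S.level p =
        (S.level (p + m) - S.level p) + S.d (p + m + 1) by ring]
    refine (abs_add_le _ _).trans ?_
    push_cast
    linarith

namespace RegularSample

variable {n : ℕ} {S : MeanModel} {e : ℕ → ℝ} {ξ α η T : ℝ}

/-- Near the ends of a gap of a covering set there is at most one change point each, and there are
none in between. Here `p` is the index of the level that prevails in the gap `(a, b)`, and `x i` is
a point of the set near the change point `i`. -/
lemma exists_main_level (H : RegularSample n S e ξ α η) (hT : T * η ≤ 1 / 16)
    {A : Finset ℕ} (hA : A ⊆ Finset.Ioo 0 n) {a b : ℕ} (hgap : IsGap n A a b) {x : ℕ → ℕ}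
    (hx : ∀ i ∈ Finset.Icc 1 S.q, x i ∈ A ∧ scaledError S (x i) i ≤ T * ξ) :
    ∃ p ≤ S.q, S.cp (p - 1) ≤ a ∧
      (b ≤ S.cp (p + 1) ∨ p + 1 ≤ S.q ∧ b ≤ S.cp (p + 2)) ∧ S.cp p < b ∧ a < S.cp (p + 1) ∧
      (a < S.cp p → 1 ≤ p ∧ x p ≤ a) ∧ (S.cp (p + 1) < b → p + 1 ≤ S.q ∧ b ≤ x (p + 1)) := by
  have hv := H.valid
  have hbn := hgap.le hA
  have hab := hgap.2.2.1
  obtain ⟨p, hp, h1, h2⟩ := hv.exists_index (s := a) (by omega)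
  -- a change point inside the gap but not next to `a` is covered from the right
  have hlow : ∀ i, i ∈ Finset.Icc 1 S.q → a ≤ S.cp (i - 1) → b ≤ x i := by
    intro i hi hai
    have hi' := Finset.mem_Icc.1 hi
    refine (hgap.2.2.2 _ (hx i hi).1).resolve_left fun hxa => ?_
    have e1 := abs_le.1 (H.abs_le_left hT hi (i := i - 1) (by omega) (hx i hi).2)
    have e2 : (S.cp (i - 1) : ℝ) < S.cp i := by
      exact_mod_cast hv.cp_lt (by omega) (by omega)
    have e3 : (x i : ℝ) ≤ a := by exact_mod_cast hxa
    have e4 : (a : ℝ) ≤ S.cp (i - 1) := by exact_mod_cast hai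
    linarith
  have hble : ∀ i, i ∈ Finset.Icc 1 S.q → b ≤ x i → b ≤ S.cp (i + 1) := by
    intro i hi hbx
    have hi' := Finset.mem_Icc.1 hi
    have e1 := abs_le.1 (H.abs_le_right hT hi (i := i + 1) (by omega) (by omega) (hx i hi).2)
    have e2 : (S.cp i : ℝ) < S.cp (i + 1) := by
      exact_mod_cast hv.cp_lt (by omega) (by omega)
    have e3 : (b : ℝ) ≤ x i := by exact_mod_cast hbx
    have : (b : ℝ) ≤ S.cp (i + 1) := by linarith
    exact_mod_cast this
  have hlast : ∀ i, i ≤ S.q + 1 → S.cp i < b → i ≤ S.q := by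
    intro i hi hib
    by_contra! hcon
    obtain rfl : i = S.q + 1 := by omega
    rw [hv.2.1] at hib
    omega
  have hpp := hv.cp_le (i := p - 1) (j := p) (by omega) (by omega)
  rcases le_or_gt b (S.cp (p + 1)) with hb | hb
  · exact ⟨p, hp, by omega, Or.inl hb, by omega, h2, fun h => by omega, fun h => by omega⟩
  have hpq := hlast (p + 1) (by omega) hb
  have hp1 : p + 1 ∈ Finset.Icc 1 S.q := Finset.mem_Icc.2 ⟨by omega, hpq⟩
  have hlt2 := hv.cp_lt (i := p + 1) (j := p + 2) (by omega) (by omega)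
  rcases hgap.2.2.2 _ (hx _ hp1).1 with hside | hside
  · have hright : S.cp (p + 2) < b → p + 2 ≤ S.q ∧ b ≤ x (p + 2) := fun hb2 =>
      have hpq2 := hlast (p + 2) (by omega) hb2
      ⟨hpq2, hlow (p + 2) (Finset.mem_Icc.2 ⟨by omega, hpq2⟩) h2.le⟩
    refine ⟨p + 1, hpq, by simpa using h1, ?_, hb, by show a < S.cp (p + 2); omega,
      fun _ => ⟨by omega, hside⟩, hright⟩
    rcases le_or_gt b (S.cp (p + 2)) with hb2 | hb2
    · exact Or.inl hb2
    · obtain ⟨hpq2, hbx⟩ := hright hb2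
      exact Or.inr ⟨hpq2, hble (p + 2) (Finset.mem_Icc.2 ⟨by omega, hpq2⟩) hbx⟩
  · exact ⟨p, hp, by omega, Or.inr ⟨hpq, hble (p + 1) hp1 hside⟩, by omega, h2,
      fun h => by omega, fun _ => ⟨hpq, hside⟩⟩

/-- A superfluous break point `u` reduces the residual sum of squares only a little: every change
point either has another break point nearby, or it has one at moderate distance while `u` is far
away from it. -/
lemma RSS_sub_RSS_insert_le (H : RegularSample n S e ξ α η) {τ T₁ M : ℝ} (hτ0 : 0 ≤ τ)
    (hT₁ : T₁ * η ≤ 1 / 16) (hτT₁ : τ ≤ T₁) (hT₁T : T₁ ≤ T) (hτM : τ ≤ M)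
    (hTM : T₁ ^ 2 ≤ M * T) {A : Finset ℕ} {u : ℕ} (hA : insert u A ⊆ Finset.Ioo 0 n)
    (hcov : ∀ i ∈ Finset.Icc 1 S.q, Covers S A (τ * ξ) i ∨
      Covers S A (T₁ * ξ) i ∧ T * ξ < scaledError S u i) :
    RSS n (fun t => S.mean t + e t) A - RSS n (fun t => S.mean t + e t) (insert u A) ≤
      (6 * M + 6 * η) * ξ := by
  have hξ := H.ξ_pos
  have hη := H.η_pos
  have hv := H.valid
  have hM : 0 ≤ M := hτ0.trans hτM
  have hT₁0 : 0 ≤ T₁ := hτ0.trans hτT₁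
  have hT0 : 0 ≤ T := hT₁0.trans hT₁T
  by_cases huA : u ∈ A
  · rw [Finset.insert_eq_of_mem huA, sub_self]
    positivity
  have hA' := (Finset.subset_insert u A).trans hA
  obtain ⟨a, b, hgap, hau, hub⟩ := exists_isGap (hA (Finset.mem_insert_self u A)) huA
  have hauR : (a : ℝ) < u := by exact_mod_cast hau
  have hubR : (u : ℝ) < b := by exact_mod_cast hub
  have hbn := hgap.le hA'
  have hx : ∀ i, ∃ x, i ∈ Finset.Icc 1 S.q → x ∈ A ∧ scaledError S x i ≤ T₁ * ξ ∧
      (scaledError S x i ≤ τ * ξ ∨ T * ξ < scaledError S u i) := by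
    intro i
    by_cases hi : i ∈ Finset.Icc 1 S.q
    · rcases hcov i hi with ⟨x, hxA, hx⟩ | ⟨⟨x, hxA, hx⟩, hu⟩
      · exact ⟨x, fun _ => ⟨hxA, hx.trans (by gcongr), Or.inl hx⟩⟩
      · exact ⟨x, fun _ => ⟨hxA, hx, Or.inr hu⟩⟩
    · exact ⟨0, fun h => absurd h hi⟩
  choose x hx using hx
  obtain ⟨p, hp, hpa, hpb, hpb', hpa', hl, hr⟩ := H.exists_main_level hT₁ hA' hgap
    (x := x) (fun i hi => ⟨(hx i hi).1, (hx i hi).2.1⟩)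
  rw [RSS_insert _ hA' hgap hau hub (S.level p), add_mul, mul_assoc, mul_assoc 6]
  have hmin := Nat.cast_sub (R := ℝ) hau.le
  have hmin' := Nat.cast_sub (R := ℝ) hub.le
  refine splitGain_le_of_parts (h₁ := -S.d p * ((min u (S.cp p) - a : ℕ) : ℝ))
    (h₂ := S.d (p + 1) * ((u - max a (S.cp (p + 1)) : ℕ) : ℝ)) (N := ∑ t ∈ Finset.Ioc a u, e t)
    (h₁' := -S.d p * ((min b (S.cp p) - u : ℕ) : ℝ))
    (h₂' := S.d (p + 1) * ((b - max u (S.cp (p + 1)) : ℕ) : ℝ)) (N' := ∑ t ∈ Finset.Ioc u b, e t)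
    (by linarith) (by linarith) ?_ ?_ ?_ ?_ (H.noise a u hau (by omega)) (H.noise u b hub hbn)
  · rw [sum_obs, hv.sum_mean_sub_level hp hpa]
    exact hpb.imp (fun h => by omega) (fun h => ⟨h.1, by omega⟩)
  · rw [sum_obs, hv.sum_mean_sub_level hp (by omega) hpb]
  · refine fringe_gain (τ := τ) (T₁ := T₁) (T := T) (by linarith) (by linarith)
      (Nat.cast_nonneg _) (Nat.cast_nonneg _) ?_ ?_ hξ hM hτM hT0 hTM ?_
    · rw [← hmin]
      exact_mod_cast (by omega : min u (S.cp p) - a ≤ u - a)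
    · rw [← hmin']
      exact_mod_cast (by omega : min b (S.cp p) - u ≤ b - u)
    rcases le_or_gt (S.cp p) a with hpa2 | hpa2
    · left
      rw [show min u (S.cp p) - a = 0 by omega, show min b (S.cp p) - u = 0 by omega]
      simp only [Nat.cast_zero, add_zero, mul_zero]
      positivity
    obtain ⟨hp1, hxa⟩ := hl hpa2
    obtain ⟨hx1, hx2, hx3⟩ := hx p (Finset.mem_Icc.2 ⟨hp1, hp⟩)
    have hxaR : (x p : ℝ) ≤ a := by exact_mod_cast hxa
    have hpaR : (a : ℝ) < S.cp p := by exact_mod_cast hpa2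
    have hle : S.d p ^ 2 * ((S.cp p : ℝ) - a) ≤ scaledError S (x p) p := by
      unfold scaledError
      rw [abs_of_neg (by linarith)]
      exact mul_le_mul_of_nonneg_left (by linarith) (sq_nonneg _)
    have hsum : ((min u (S.cp p) - a : ℕ) : ℝ) + ((min b (S.cp p) - u : ℕ) : ℝ) =
        (S.cp p : ℝ) - a := by
      rw [← Nat.cast_sub hpa2.le]
      exact_mod_cast (by omega : min u (S.cp p) - a + (min b (S.cp p) - u) = S.cp p - a)
    rcases hx3 with hx3 | hx3
    · left
      rw [neg_sq, hsum]
      linarith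
    · right
      have hup : S.cp p < u := by
        by_contra! hcon
        have hconR : (u : ℝ) ≤ S.cp p := by exact_mod_cast hcon
        unfold scaledError at hx3
        rw [abs_of_nonpos (by linarith)] at hx3
        have := mul_le_mul_of_nonneg_left (show -((u : ℝ) - S.cp p) ≤ S.cp p - a by linarith)
          (sq_nonneg (S.d p))
        have : T₁ * ξ ≤ T * ξ := by gcongr
        linarith
      have hupR : (S.cp p : ℝ) < u := by exact_mod_cast hup
      have hz : min b (S.cp p) - u = 0 := by omega
      rw [hz, Nat.cast_zero, add_zero] at hsum
      refine ⟨by rw [hz, Nat.cast_zero], by rw [neg_sq, hsum]; linarith, ?_⟩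
      rw [neg_sq]
      unfold scaledError at hx3
      rw [abs_of_pos (by linarith)] at hx3
      exact hx3.trans_le (mul_le_mul_of_nonneg_left (by linarith) (sq_nonneg _))
  · rw [add_comm]
    refine fringe_gain (τ := τ) (T₁ := T₁) (T := T) (by linarith) (by linarith)
      (Nat.cast_nonneg _) (Nat.cast_nonneg _) ?_ ?_ hξ hM hτM hT0 hTM ?_
    · rw [← hmin']
      exact_mod_cast (by omega : b - max u (S.cp (p + 1)) ≤ b - u)
    · rw [← hmin]
      exact_mod_cast (by omega : u - max a (S.cp (p + 1)) ≤ u - a)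
    rcases le_or_gt b (S.cp (p + 1)) with hpa2 | hpa2
    · left
      rw [show b - max u (S.cp (p + 1)) = 0 by omega, show u - max a (S.cp (p + 1)) = 0 by omega]
      simp only [Nat.cast_zero, add_zero, mul_zero]
      positivity
    obtain ⟨hp1, hxa⟩ := hr hpa2
    obtain ⟨hx1, hx2, hx3⟩ := hx (p + 1) (Finset.mem_Icc.2 ⟨by omega, hp1⟩)
    have hxaR : (b : ℝ) ≤ x (p + 1) := by exact_mod_cast hxa
    have hpaR : (S.cp (p + 1) : ℝ) < b := by exact_mod_cast hpa2
    have hle : S.d (p + 1) ^ 2 * ((b : ℝ) - S.cp (p + 1)) ≤ scaledError S (x (p + 1)) (p + 1) := by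
      unfold scaledError
      rw [abs_of_pos (by linarith)]
      exact mul_le_mul_of_nonneg_left (by linarith) (sq_nonneg _)
    have hsum : ((b - max u (S.cp (p + 1)) : ℕ) : ℝ) + ((u - max a (S.cp (p + 1)) : ℕ) : ℝ) =
        (b : ℝ) - S.cp (p + 1) := by
      rw [← Nat.cast_sub hpa2.le]
      exact_mod_cast (by omega :
        b - max u (S.cp (p + 1)) + (u - max a (S.cp (p + 1))) = b - S.cp (p + 1))
    rcases hx3 with hx3 | hx3
    · left
      rw [hsum]
      linarith
    · right
      have hup : u < S.cp (p + 1) := by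
        by_contra! hcon
        have hconR : (S.cp (p + 1) : ℝ) ≤ u := by exact_mod_cast hcon
        unfold scaledError at hx3
        rw [abs_of_nonneg (by linarith)] at hx3
        have := mul_le_mul_of_nonneg_left (show (u : ℝ) - S.cp (p + 1) ≤ b - S.cp (p + 1) by
          linarith) (sq_nonneg (S.d (p + 1)))
        have : T₁ * ξ ≤ T * ξ := by gcongr
        linarith
      have hupR : (u : ℝ) < S.cp (p + 1) := by exact_mod_cast hup
      have hz : u - max a (S.cp (p + 1)) = 0 := by omega
      rw [hz, Nat.cast_zero, add_zero] at hsum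
      refine ⟨by rw [hz, Nat.cast_zero], by rw [hsum]; linarith, ?_⟩
      unfold scaledError at hx3
      rw [abs_of_neg (by linarith)] at hx3
      exact hx3.trans_le (mul_le_mul_of_nonneg_left (by linarith) (sq_nonneg _))

/-- Inside a gap of a set that covers all change points but one, the mean takes at most four
consecutive levels. -/
lemma abs_mean_sub_level_le (H : RegularSample n S e ξ α η) (hT : T * η ≤ 1 / 16) {B : ℝ}
    (hB : ∀ j ∈ Finset.Icc 1 S.q, |S.d j| ≤ B) (hB0 : 0 ≤ B) {j : ℕ}
    {A : Finset ℕ} (hA : A ⊆ Finset.Ioo 0 n)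
    (hcov : ∀ i ∈ Finset.Icc 1 S.q, i ≠ j → Covers S A (T * ξ) i) {a b : ℕ}
    (hgap : IsGap n A a b) :
    ∃ μ : ℝ, ∀ t ∈ Finset.Ioc a b, |S.mean t - μ| ≤ 3 * B := by
  have hv := H.valid
  have hbn := hgap.le hA
  have hab := hgap.2.2.1
  obtain ⟨p, hp, h1, h2⟩ := hv.exists_index (s := a) (by omega)
  refine ⟨S.level p, fun t ht => ?_⟩
  rw [Finset.mem_Ioc] at ht
  obtain ⟨r, hr, h3, h4⟩ := hv.exists_index (s := t - 1) (by omega)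
  rw [hv.mean_eq hr (by omega) (by omega)]
  have hpr : p ≤ r := by
    by_contra! hcon
    have := hv.cp_le (i := r + 1) (j := p) hcon (by omega)
    omega
  have hrp : r ≤ p + 3 := by
    by_contra! hcon
    have hlt := hv.cp_le (i := p + 4) (j := r) hcon (by omega)
    -- one of the two middle change points is covered, from inside the gap
    obtain ⟨i, hi1, hi2, hij⟩ : ∃ i, p + 2 ≤ i ∧ i ≤ p + 3 ∧ i ≠ j := by
      by_cases h : p + 2 = j
      · exact ⟨p + 3, by omega, le_rfl, by omega⟩
      · exact ⟨p + 2, le_rfl, by omega, h⟩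
    have hi : i ∈ Finset.Icc 1 S.q := Finset.mem_Icc.2 ⟨by omega, by omega⟩
    obtain ⟨x, hxA, hx⟩ := hcov i hi hij
    have e1 := abs_le.1 (H.abs_le_left hT hi (i := i - 1) (by omega) hx)
    have e2 := abs_le.1 (H.abs_le_right hT hi (i := i + 1) (by omega) (by omega) hx)
    have f1 : (S.cp (i - 1) : ℝ) < S.cp i := by
      exact_mod_cast hv.cp_lt (by omega) (by omega)
    have f2 : (S.cp i : ℝ) < S.cp (i + 1) := by
      exact_mod_cast hv.cp_lt (by omega) (by omega)
    have g1 : S.cp (i - 1) < x := by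
      have : (S.cp (i - 1) : ℝ) < x := by linarith
      exact_mod_cast this
    have g2 : x < S.cp (i + 1) := by
      have : (x : ℝ) < S.cp (i + 1) := by linarith
      exact_mod_cast this
    have k1 := hv.cp_le (i := p + 1) (j := i - 1) (by omega) (by omega)
    have k2 := hv.cp_le (i := i + 1) (j := p + 4) (by omega) (by omega)
    rcases hgap.2.2.2 x hxA with h | h <;> omega
  obtain ⟨m, rfl⟩ := Nat.exists_eq_add_of_le hpr
  refine (MeanModel.IsValid.abs_level_sub_le hB p m hr).trans ?_
  have : (m : ℝ) ≤ 3 := by exact_mod_cast (by omega : m ≤ 3)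
  gcongr

/-- If at most one change point is not covered, the residual sum of squares is at most of order
`n`. -/
lemma RSS_le (H : RegularSample n S e ξ α η) (hn : 0 < n) (hT : T * η ≤ 1 / 16) {B : ℝ}
    (hB : ∀ j ∈ Finset.Icc 1 S.q, |S.d j| ≤ B) (hB0 : 0 ≤ B) {j : ℕ}
    {A : Finset ℕ} (hA : A ⊆ Finset.Ioo 0 n)
    (hcov : ∀ i ∈ Finset.Icc 1 S.q, i ≠ j → Covers S A (T * ξ) i) :
    RSS n (fun t => S.mean t + e t) A ≤ 18 * B ^ 2 * n + 2 * ∑ t ∈ Finset.Ioc 0 n, e t ^ 2 := by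
  have h1 : RSS n (fun t => S.mean t + e t) A ≤
      segSum n A (fun s u => ∑ t ∈ Finset.Ioc s u, (18 * B ^ 2 + 2 * e t ^ 2)) := by
    rw [RSS_eq_segSum]
    refine segSum_mono hn hA fun a b hgap => ?_
    obtain ⟨μ, hμ⟩ := H.abs_mean_sub_level_le hT hB hB0 hA hcov hgap
    refine (segRSS_le _ hgap.2.2.1 μ).trans (Finset.sum_le_sum fun t ht => ?_)
    have e1 := hμ t ht
    have e2 : (S.mean t - μ) ^ 2 ≤ (3 * B) ^ 2 := sq_le_sq' (neg_le_of_abs_le e1) (le_of_abs_le e1)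
    have e3 := add_sq_le (a := S.mean t - μ) (b := e t)
    have e4 : S.mean t + e t - μ = S.mean t - μ + e t := by ring
    rw [e4]
    linarith
  refine h1.trans (le_of_eq ?_)
  rw [segSum_sum hn _ hA, Finset.sum_add_distrib, sum_Ioc_const 0 n (Nat.zero_le _),
    ← Finset.mul_sum]
  push_cast
  ring

end RegularSample

/-- Whatever the break points, the residual sum of squares is not much smaller than that of the
noise. -/
lemma MeanModel.IsValid.le_RSS {S : MeanModel} {n : ℕ} (hv : S.IsValid n) (hn : 0 < n) {e : ℕ → ℝ}
    {W : ℝ} (hW : 0 ≤ W)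
    (hnoise : ∀ s t, s < t → t ≤ n → (∑ i ∈ Finset.Ioc s t, e i) ^ 2 ≤ W * ((t : ℝ) - s))
    {A : Finset ℕ} (hA : A ⊆ Finset.Ioo 0 n) :
    ∑ t ∈ Finset.Ioc 0 n, e t ^ 2 - (1 + A.card + S.q) * W ≤
      RSS n (fun t => S.mean t + e t) A := by
  classical
  set A' := A ∪ (Finset.Icc 1 S.q).image S.cp with hA'def
  have hA' : A' ⊆ Finset.Ioo 0 n := by
    refine Finset.union_subset hA fun k hk => ?_
    obtain ⟨i, hi, rfl⟩ := Finset.mem_image.1 hk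
    rw [Finset.mem_Icc] at hi
    have h1 := hv.cp_lt (i := 0) (j := i) (by omega) (by omega)
    have h2 := hv.cp_lt (i := i) (j := S.q + 1) (by omega) le_rfl
    rw [hv.2.1] at h2
    exact Finset.mem_Ioo.2 ⟨by omega, h2⟩
  refine le_trans ?_ (RSS_anti _ Finset.subset_union_left hA')
  have h1 : segSum n A' (fun s u => ∑ t ∈ Finset.Ioc s u, e t ^ 2 - W) ≤
      RSS n (fun t => S.mean t + e t) A' := by
    rw [RSS_eq_segSum]
    refine segSum_mono hn hA' fun a b hgap => ?_
    have hab := hgap.2.2.1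
    have hbn := hgap.le hA'
    have habR : (a : ℝ) < b := by exact_mod_cast hab
    obtain ⟨p, hp, h1, h2⟩ := hv.exists_index (s := a) (by omega)
    have hb : b ≤ S.cp (p + 1) := by
      by_contra! hcon
      have hpq : p + 1 ≤ S.q := by
        by_contra! hcon2
        obtain rfl : p = S.q := by omega
        rw [hv.2.1] at hcon
        omega
      have hmem : S.cp (p + 1) ∈ A' := Finset.mem_union_right _
        (Finset.mem_image_of_mem _ (Finset.mem_Icc.2 ⟨by omega, hpq⟩))
      rcases hgap.2.2.2 _ hmem with h | h <;> omega
    have hx : ∀ t ∈ Finset.Ioc a b, S.mean t + e t - S.level p = e t := by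
      intro t ht
      rw [Finset.mem_Ioc] at ht
      rw [hv.mean_eq hp (by omega) (by omega)]
      ring
    have hx2 : ∀ t ∈ Finset.Ioc a b, (S.mean t + e t - S.level p) ^ 2 = e t ^ 2 :=
      fun t ht => by rw [hx t ht]
    rw [segRSS_eq _ hab (S.level p), Finset.sum_congr rfl hx, Finset.sum_congr rfl hx2]
    have : (∑ t ∈ Finset.Ioc a b, e t) ^ 2 / ((b : ℝ) - a) ≤ W := by
      rw [div_le_iff₀ (by linarith)]
      exact hnoise a b hab hbn
    linarith
  refine le_trans ?_ h1
  have h2 : segSum n A' (fun s u => ∑ t ∈ Finset.Ioc s u, e t ^ 2 - W) =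
      ∑ t ∈ Finset.Ioc 0 n, e t ^ 2 - (insert 0 A').card * W := by
    rw [← segSum_sum hn _ hA']
    unfold segSum
    rw [Finset.sum_sub_distrib, Finset.sum_const, nsmul_eq_mul]
  rw [h2]
  have h3 : (insert 0 A').card ≤ 1 + A.card + S.q := by
    have e1 := Finset.card_insert_le 0 A'
    have e2 := Finset.card_union_le A ((Finset.Icc 1 S.q).image S.cp)
    have e3 := Finset.card_image_le (s := Finset.Icc 1 S.q) (f := S.cp)
    rw [Nat.card_Icc] at e3
    rw [← hA'def] at e2
    omega
  have h4 : ((insert 0 A').card : ℝ) ≤ 1 + A.card + S.q := by exact_mod_cast h3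
  have := mul_le_mul_of_nonneg_right h4 hW
  linarith

/-! ### The Schwarz criterion -/

/-- Constants for the analysis of the pruning algorithm. Residual sums of squares lie between
`c₀ n` and `C₀ n`, and `K` is the factor by which the acceptance radius may be exceeded. Distances
to change points are compared with multiples of the penalty: they are tiny (`σ`), small (`τ`),
moderate (`T₁`, `T₂`) or large (`T`). The bound `η` on the ratio of noise to penalty and of penalty
to jumps is chosen last. The conditions `gain_small` and `gain_large` say that a superfluous break
point is not worth its penalty and that a missing one is; `mean_*` and `lam` bound the relative
deviation of sample means from the levels; `swap_σ` and `lam_lt` make it profitable to move a badly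
placed break point. -/
structure Tuning (c₀ C₀ K T T₁ T₂ τ σ M lam η : ℝ) : Prop where
  c₀_pos : 0 < c₀
  C₀_pos : 0 < C₀
  one_lt_K : 1 < K
  η_pos : 0 < η
  σ_pos : 0 < σ
  lam_pos : 0 < lam
  two_σ_le : 2 * σ ≤ τ
  τ_le_T₁ : τ ≤ T₁
  T₁_le_T₂ : 16 * T₁ ≤ T₂
  T₂_le_T : T₂ ≤ T
  τ_le_M : τ ≤ M
  T₂_sq_le : T₂ ^ 2 ≤ M * T
  gain_small : 6 * M + 6 * η < 2 * c₀
  gain_large : 32 * C₀ < T₁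
  gain_large' : 64 * C₀ < T₂
  T_mul_η : T * η ≤ 1 / 16
  mean_T₁ : 2 * T * η + √(η / (T₁ / 2)) ≤ 1 / 8
  mean_T₂ : 2 * T * η + √(η / (T₂ / 2)) ≤ 1 / 8
  swap_σ : 34 * (4 * T ^ 2 + 4) * η ≤ σ
  mean_σ : 2 * T * η + η / (σ / 2) + √(η / (σ / 2)) ≤ 1 / 4
  lam_lt : 5 * lam < (K - 1) / (K + 1)
  σ_le_lam : 4 * σ ≤ lam * τ
  η_le_lam : 2 * η ≤ lam * (1 - 1 / K)
  mean_τ : 2 * T * η + η / (τ / 2) + √(η / (τ / 2)) ≤ lam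
  K_mul_η : K * η ≤ σ

/-- Given the bounds for the residual sums of squares and `K > 1`, all constants can be chosen. -/
lemma exists_tuning {c₀ C₀ K : ℝ} (hc : 0 < c₀) (hC : 0 < C₀) (hK : 1 < K) :
    ∃ T T₁ T₂ τ σ M lam : ℝ, ∀ᶠ η in 𝓝[>] (0 : ℝ), Tuning c₀ C₀ K T T₁ T₂ τ σ M lam η := by
  obtain ⟨M, hM⟩ : ∃ M, M = c₀ / 6 := ⟨_, rfl⟩
  obtain ⟨T₁, hT₁⟩ : ∃ T₁, T₁ = 64 * C₀ := ⟨_, rfl⟩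
  obtain ⟨T₂, hT₂⟩ : ∃ T₂, T₂ = 16 * T₁ := ⟨_, rfl⟩
  obtain ⟨T, hT⟩ : ∃ T, T = max T₂ (T₂ ^ 2 / M) := ⟨_, rfl⟩
  obtain ⟨lam, hlam⟩ : ∃ lam, lam = (K - 1) / (K + 1) / 6 := ⟨_, rfl⟩
  obtain ⟨τ, hτ⟩ : ∃ τ, τ = min M T₁ := ⟨_, rfl⟩
  obtain ⟨σ, hσ⟩ : ∃ σ, σ = min (τ / 2) (lam * τ / 4) := ⟨_, rfl⟩
  have hM0 : 0 < M := by rw [hM]; positivity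
  have hT₁0 : 0 < T₁ := by rw [hT₁]; positivity
  have hT₂0 : 0 < T₂ := by rw [hT₂]; positivity
  have hK1 : 0 < K - 1 := by linarith
  have hlam0 : 0 < lam := by rw [hlam]; positivity
  have hτ0 : 0 < τ := by rw [hτ]; exact lt_min hM0 hT₁0
  have hσ0 : 0 < σ := by rw [hσ]; exact lt_min (by positivity) (by positivity)
  have hKinv : 0 < 1 - 1 / K := by
    rw [sub_pos, div_lt_one (by linarith)]
    exact hK
  have small : ∀ {f : ℝ → ℝ} {b : ℝ}, Continuous f → f 0 = 0 → 0 < b →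
      ∀ᶠ η in 𝓝[>] (0 : ℝ), f η < b := by
    intro f b hf h0 hb
    have h1 : Tendsto f (𝓝[>] 0) (𝓝 0) := by
      have := hf.tendsto 0
      rw [h0] at this
      exact this.mono_left nhdsWithin_le_nhds
    exact h1.eventually_lt_const hb
  refine ⟨T, T₁, T₂, τ, σ, M, lam, ?_⟩
  filter_upwards [self_mem_nhdsWithin,
    small (f := fun η => 6 * η) (b := c₀) (by fun_prop) (by simp) hc,
    small (f := fun η => T * η) (b := 1 / 16) (by fun_prop) (by simp) (by norm_num),
    small (f := fun η => 2 * T * η + √(η / (T₁ / 2))) (b := 1 / 8) (by fun_prop) (by simp)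
      (by norm_num),
    small (f := fun η => 2 * T * η + √(η / (T₂ / 2))) (b := 1 / 8) (by fun_prop) (by simp)
      (by norm_num),
    small (f := fun η => 34 * (4 * T ^ 2 + 4) * η) (by fun_prop) (by simp) hσ0,
    small (f := fun η => 2 * T * η + η / (σ / 2) + √(η / (σ / 2))) (b := 1 / 4) (by fun_prop)
      (by simp) (by norm_num),
    small (f := fun η => 2 * η) (b := lam * (1 - 1 / K)) (by fun_prop) (by simp) (by positivity),
    small (f := fun η => 2 * T * η + η / (τ / 2) + √(η / (τ / 2))) (by fun_prop) (by simp) hlam0,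
    small (f := fun η => K * η) (by fun_prop) (by simp) hσ0] with η h0 h1 h2 h3 h4 h5 h6 h7 h8 h9
  have hσ1 : σ ≤ τ / 2 := by rw [hσ]; exact min_le_left _ _
  have hσ2 : σ ≤ lam * τ / 4 := by rw [hσ]; exact min_le_right _ _
  exact {
    c₀_pos := hc
    C₀_pos := hC
    one_lt_K := hK
    η_pos := h0
    σ_pos := hσ0
    lam_pos := hlam0
    two_σ_le := by linarith
    τ_le_T₁ := by rw [hτ]; exact min_le_right _ _
    T₁_le_T₂ := hT₂.ge
    T₂_le_T := by rw [hT]; exact le_max_left _ _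
    τ_le_M := by rw [hτ]; exact min_le_left _ _
    T₂_sq_le := by
      have : T₂ ^ 2 / M ≤ T := by rw [hT]; exact le_max_right _ _
      rw [div_le_iff₀ hM0] at this
      linarith
    gain_small := by linarith
    gain_large := by linarith
    gain_large' := by linarith
    T_mul_η := h2.le
    mean_T₁ := h3.le
    mean_T₂ := h4.le
    swap_σ := h5.le
    mean_σ := h6.le
    lam_lt := by
      have : 0 < (K - 1) / (K + 1) := by positivity
      linarith
    σ_le_lam := by linarith
    η_le_lam := h7.le
    mean_τ := h8.le
    K_mul_η := h9.le }

/-- A regular sample together with a candidate set `Cand`, bounds for the residual sums of squares,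
and a distinguished candidate `g j` in the vicinity of every change point `j`. -/
structure GoodSample (n : ℕ) (S : MeanModel) (e : ℕ → ℝ) (ξ α η c₀ C₀ T : ℝ) (Cand : Finset ℕ)
    (g : ℕ → ℕ) : Prop extends RegularSample n S e ξ α η where
  n_pos : 0 < n
  local_noise : LocalNoise S e α η
  cand_subset : Cand ⊆ Finset.Ioo 0 n
  le_rss : ∀ A ⊆ Cand, c₀ * n ≤ RSS n (fun t => S.mean t + e t) A
  rss_le : ∀ A ⊆ Cand, ∀ j, (∀ i ∈ Finset.Icc 1 S.q, i ≠ j → Covers S A (T * ξ) i) →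
    RSS n (fun t => S.mean t + e t) A ≤ C₀ * n
  g_mem : ∀ j ∈ Finset.Icc 1 S.q, g j ∈ Cand
  g_close : ∀ j ∈ Finset.Icc 1 S.q, scaledError S (g j) j ≤ α

lemma half_log_sub_le {n R₁ R₂ w c : ℝ} (hn : 0 < n) (hc : 0 < c) (hR₁ : 0 < R₁)
    (hw0 : 0 ≤ w) (hw : R₁ - R₂ ≤ w) (hR₂ : c * n ≤ R₂) :
    n / 2 * Real.log (R₁ / n) - n / 2 * Real.log (R₂ / n) ≤ w / (2 * c) := by
  have hR₂0 : 0 < R₂ := lt_of_lt_of_le (by positivity) hR₂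
  rw [Real.log_div hR₁.ne' hn.ne', Real.log_div hR₂0.ne' hn.ne']
  have h1 : Real.log R₁ - Real.log R₂ ≤ w / R₂ := by
    rw [← Real.log_div hR₁.ne' hR₂0.ne']
    refine (Real.log_le_sub_one_of_pos (by positivity)).trans ?_
    rw [div_sub_one hR₂0.ne']
    gcongr
  have h2 : w / R₂ ≤ w / (c * n) := by gcongr
  have h3 : n / 2 * (w / (c * n)) = w / (2 * c) := by field_simp
  have := mul_le_mul_of_nonneg_left (h1.trans h2) (by positivity : 0 ≤ n / 2)
  linarith

lemma le_half_log_sub {n R₁ R₂ w c : ℝ} (hn : 0 < n) (hc : 0 < c) (hR₂ : 0 < R₂) (hw0 : 0 ≤ w)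
    (hw : w ≤ R₁ - R₂) (hR₁ : R₁ ≤ c * n) :
    w / (2 * c) ≤ n / 2 * Real.log (R₁ / n) - n / 2 * Real.log (R₂ / n) := by
  have hR₁0 : 0 < R₁ := by linarith
  rw [Real.log_div hR₁0.ne' hn.ne', Real.log_div hR₂.ne' hn.ne']
  have h1 : w / R₁ ≤ Real.log R₁ - Real.log R₂ := by
    rw [← Real.log_div hR₁0.ne' hR₂.ne']
    refine le_trans ?_ (Real.one_sub_inv_le_log_of_pos (by positivity))
    rw [inv_div, one_sub_div hR₁0.ne']
    gcongr
  have h2 : w / (c * n) ≤ w / R₁ := by gcongr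
  have h3 : n / 2 * (w / (c * n)) = w / (2 * c) := by field_simp
  have := mul_le_mul_of_nonneg_left (h2.trans h1) (by positivity : 0 ≤ n / 2)
  linarith

namespace GoodSample

variable {n : ℕ} {S : MeanModel} {e : ℕ → ℝ} {ξ α η c₀ C₀ T T₁ T₂ τ σ M lam K : ℝ}
  {Cand : Finset ℕ} {g : ℕ → ℕ} {D C Khat : Finset ℕ}

lemma SC_eq (x : ℕ → ℝ) (A : Finset ℕ) :
    SC n x ξ D C Khat A = (n : ℝ) / 2 * Real.log (RSS n x (A ∪ (Khat ∪ C \ D)) / n) +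
      (A.card : ℝ) * ξ + ((Khat.card : ℝ) + (C \ D).card) * ξ := by
  unfold SC
  rw [Finset.union_assoc]
  ring

lemma rss_pos (H : GoodSample n S e ξ α η c₀ C₀ T Cand g)
    (tun : Tuning c₀ C₀ K T T₁ T₂ τ σ M lam η) {A : Finset ℕ} (hA : A ⊆ Cand) :
    0 < RSS n (fun t => S.mean t + e t) A := by
  have h1 : (0 : ℝ) < n := by exact_mod_cast H.n_pos
  exact lt_of_lt_of_le (mul_pos tun.c₀_pos h1) (H.le_rss A hA)

/-- Adding a superfluous candidate increases the criterion. -/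
lemma SC_lt_insert (H : GoodSample n S e ξ α η c₀ C₀ T Cand g)
    (tun : Tuning c₀ C₀ K T T₁ T₂ τ σ M lam η) {A : Finset ℕ} {u : ℕ} (hu : u ∉ A)
    (hA : insert u A ∪ (Khat ∪ C \ D) ⊆ Cand)
    (hcov : ∀ i ∈ Finset.Icc 1 S.q, Covers S (A ∪ (Khat ∪ C \ D)) (τ * ξ) i ∨
      Covers S (A ∪ (Khat ∪ C \ D)) (T₂ * ξ) i ∧ T * ξ < scaledError S u i) :
    SC n (fun t => S.mean t + e t) ξ D C Khat A <
      SC n (fun t => S.mean t + e t) ξ D C Khat (insert u A) := by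
  have hn : (0 : ℝ) < n := by exact_mod_cast H.n_pos
  have hξ := H.ξ_pos
  have hη := H.η_pos
  have hT₁ := tun.gain_large
  have hC₀ := tun.C₀_pos
  have hσ := tun.σ_pos
  have hM0 : 0 < M := by linarith [tun.two_σ_le, tun.τ_le_M]
  rw [Finset.insert_union] at hA
  have hA' := (Finset.subset_insert u _).trans hA
  have h1 := H.toRegularSample.RSS_sub_RSS_insert_le (τ := τ) (T₁ := T₂) (T := T) (M := M)
    (by linarith [tun.two_σ_le])
    ((mul_le_mul_of_nonneg_right tun.T₂_le_T hη.le).trans tun.T_mul_η)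
    (by linarith [tun.τ_le_T₁, tun.T₁_le_T₂]) tun.T₂_le_T tun.τ_le_M tun.T₂_sq_le
    (hA.trans H.cand_subset) hcov
  have h2 := half_log_sub_le hn tun.c₀_pos (H.rss_pos tun hA') (by positivity) h1
    (H.le_rss _ hA)
  have h3 : (6 * M + 6 * η) * ξ / (2 * c₀) < ξ := by
    have := tun.c₀_pos
    rw [div_lt_iff₀ (by positivity)]
    have := mul_lt_mul_of_pos_right tun.gain_small hξ
    linarith
  rw [SC_eq, SC_eq, Finset.card_insert_of_notMem hu, Finset.insert_union]
  push_cast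
  linarith

/-- A set that contains a candidate near a change point improves substantially on a set without. -/
lemma SC_lt_of_uncovered (H : GoodSample n S e ξ α η c₀ C₀ T Cand g)
    (tun : Tuning c₀ C₀ K T T₁ T₂ τ σ M lam η) {θ : ℝ} (hθ0 : 0 < θ) (hθT : θ ≤ T)
    (hθ : 2 * T * η + √(η / (θ / 2)) ≤ 1 / 8) {m : ℕ} (hm : 32 * C₀ * m < θ) {A A₁ A₂ : Finset ℕ}
    {u j : ℕ} (hA₂ : A₂ ∪ (Khat ∪ C \ D) ⊆ Cand) (hj : j ∈ Finset.Icc 1 S.q)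
    (hcov : ∀ i ∈ Finset.Icc 1 S.q, i ≠ j → Covers S (A ∪ (Khat ∪ C \ D)) (T * ξ) i)
    (hncov : ¬ Covers S (A ∪ (Khat ∪ C \ D)) (θ * ξ) j) (hu : scaledError S u j ≤ θ / 16 * ξ)
    (hA₁ : A₁ ⊆ A) (huA : insert u A ⊆ A₂) (hcard : A₂.card ≤ A₁.card + m) :
    SC n (fun t => S.mean t + e t) ξ D C Khat A₂ <
      SC n (fun t => S.mean t + e t) ξ D C Khat A₁ := by
  have hn : (0 : ℝ) < n := by exact_mod_cast H.n_pos
  have hξ := H.ξ_pos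
  have hC₀ := tun.C₀_pos
  have hins : insert u (A ∪ (Khat ∪ C \ D)) ⊆ A₂ ∪ (Khat ∪ C \ D) := by
    rw [← Finset.insert_union]
    exact Finset.union_subset_union_left huA
  have hAC := (Finset.subset_insert u _).trans (hins.trans hA₂)
  have h1 := H.toRegularSample.le_RSS_sub_RSS_insert (by linarith) tun.T_mul_η hθ0 hθT hθ hj
    (hAC.trans H.cand_subset) hcov hncov hu
  have h2 := RSS_anti (fun t => S.mean t + e t) hins (hA₂.trans H.cand_subset)
  have hR := H.rss_le _ hAC j hcov
  have h4 := le_half_log_sub hn hC₀ (H.rss_pos tun hA₂) (by positivity)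
    (h1.trans (sub_le_sub_left h2 _)) hR
  have hA₁A : A₁ ∪ (Khat ∪ C \ D) ⊆ A ∪ (Khat ∪ C \ D) := Finset.union_subset_union_left hA₁
  have h5 := RSS_anti (fun t => S.mean t + e t) hA₁A (hAC.trans H.cand_subset)
  have h6 : (n : ℝ) / 2 * Real.log (RSS n (fun t => S.mean t + e t) (A ∪ (Khat ∪ C \ D)) / n) ≤
      (n : ℝ) / 2 *
        Real.log (RSS n (fun t => S.mean t + e t) (A₁ ∪ (Khat ∪ C \ D)) / n) := by
    have := H.rss_pos tun hAC
    gcongr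
  have h7 : m * ξ < θ * ξ / 16 / (2 * C₀) := by
    rw [lt_div_iff₀ (by positivity)]
    have := mul_lt_mul_of_pos_right hm hξ
    linarith
  have h8 : (A₂.card : ℝ) * ξ ≤ (A₁.card + m) * ξ := by
    have : (A₂.card : ℝ) ≤ A₁.card + m := by exact_mod_cast hcard
    gcongr
  rw [SC_eq, SC_eq]
  linarith

lemma SC_insert_lt_insert (H : GoodSample n S e ξ α η c₀ C₀ T Cand g)
    (tun : Tuning c₀ C₀ K T T₁ T₂ τ σ M lam η) {A : Finset ℕ} {c u : ℕ} (hu : u ∉ A) (hc : c ∉ A)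
    (hA : insert u A ∪ (Khat ∪ C \ D) ⊆ Cand)
    (hlt : RSS n (fun t => S.mean t + e t) (insert u (A ∪ (Khat ∪ C \ D))) <
      RSS n (fun t => S.mean t + e t) (insert c (A ∪ (Khat ∪ C \ D)))) :
    SC n (fun t => S.mean t + e t) ξ D C Khat (insert u A) <
      SC n (fun t => S.mean t + e t) ξ D C Khat (insert c A) := by
  have hn : (0 : ℝ) < n := by exact_mod_cast H.n_pos
  rw [SC_eq, SC_eq, Finset.card_insert_of_notMem hu, Finset.card_insert_of_notMem hc,
    Finset.insert_union, Finset.insert_union]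
  rw [Finset.insert_union] at hA
  have := H.rss_pos tun hA
  gcongr

end GoodSample

/-! ### The inner algorithm -/

/-- The situation in which the inner algorithm is run: `D` is the set of active candidates between
`cL` and `cR`, all other break points `Khat ∪ C \ D` lie outside `(cL, cR)`, and every change point
has its distinguished candidate in `D` or is represented by one of the other break points. -/
structure PruneEnv (S : MeanModel) (α K : ℝ) (Cand : Finset ℕ) (g : ℕ → ℕ) (C Khat D : Finset ℕ)
    (cL cR : ℕ) : Prop where
  D_subset : D ⊆ Cand
  rest_subset : Khat ∪ C \ D ⊆ Cand
  mem_D : ∀ c ∈ D, cL < c ∧ c < cR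
  rest_out : ∀ y ∈ Khat ∪ C \ D, y ≤ cL ∨ cR ≤ y
  covered : ∀ j ∈ Finset.Icc 1 S.q, g j ∈ D ∨ Covers S (Khat ∪ C \ D) (K * α) j

lemma InnerSubset.refl (A : Finset ℕ) : InnerSubset A A := ⟨subset_rfl, fun _ hc _ _ => hc⟩

lemma InnerSubset.card_le {A A' : Finset ℕ} (h : InnerSubset A A') : A'.card ≤ A.card + 2 := by
  have h1 : (A' \ A).card ≤ 2 := by
    rcases (A' \ A).eq_empty_or_nonempty with h0 | ⟨c, hc⟩
    · simp [h0]
    have hne : A'.Nonempty := ⟨c, (Finset.mem_sdiff.1 hc).1⟩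
    have hsub : A' \ A ⊆ {A'.min' hne, A'.max' hne} := by
      intro c hc
      rw [Finset.mem_sdiff] at hc
      rw [Finset.mem_insert, Finset.mem_singleton]
      by_contra! hcon
      exact hc.2 (h.2 c hc.1
        ⟨_, Finset.min'_mem _ hne, lt_of_le_of_ne (Finset.min'_le _ _ hc.1) hcon.1.symm⟩
        ⟨_, Finset.max'_mem _ hne, lt_of_le_of_ne (Finset.le_max' _ _ hc.1) hcon.2⟩)
    exact (Finset.card_le_card hsub).trans (Finset.card_le_two)
  have h2 := Finset.card_sdiff_add_card_eq_card h.1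
  omega

lemma minCard_le {D : Finset ℕ} {sc : Finset ℕ → ℝ} {A : Finset ℕ} (h : MonotoneAbove D sc A) :
    minCard D sc ≤ A.card := Nat.sInf_le ⟨A, h, rfl⟩

lemma exists_card_eq_minCard {D : Finset ℕ} {sc : Finset ℕ → ℝ} {A : Finset ℕ}
    (h : MonotoneAbove D sc A) : ∃ B, MonotoneAbove D sc B ∧ B.card = minCard D sc :=
  Nat.sInf_mem (s := {m : ℕ | ∃ A, MonotoneAbove D sc A ∧ A.card = m}) ⟨_, A, h, rfl⟩

lemma MonotoneAbove.searchFamily {D : Finset ℕ} {sc : Finset ℕ → ℝ} {A A' : Finset ℕ}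
    (h : MonotoneAbove D sc A') (hcard : A'.card ≤ minCard D sc + 2) (hA : InnerSubset A A') :
    SearchFamily D sc A := ⟨A', h, minCard_le h, hcard, hA⟩

/-- A point between `c` and a point `x` that is nearer to a change point than `c` is itself nearer
than `c`. -/
lemma scaledError_lt_of_between {S : MeanModel} {c y x j : ℕ} (hd : S.d j ≠ 0)
    (h : scaledError S x j < scaledError S c j) (hy : (c < y ∧ y ≤ x) ∨ (x ≤ y ∧ y < c)) :
    scaledError S y j < scaledError S c j := by
  unfold scaledError at *
  have hX : 0 < S.d j ^ 2 := by positivity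
  have h1 : |(x : ℝ) - S.cp j| < |(c : ℝ) - S.cp j| := lt_of_mul_lt_mul_left h hX.le
  refine mul_lt_mul_of_pos_left ?_ hX
  have hx := abs_le.1 (le_refl |(x : ℝ) - S.cp j|)
  rcases hy with ⟨h2, h3⟩ | ⟨h2, h3⟩
  · have h2' : (c : ℝ) < y := by exact_mod_cast h2
    have h3' : (y : ℝ) ≤ x := by exact_mod_cast h3
    have hck : (c : ℝ) < S.cp j := by
      by_contra! hcon
      rw [abs_of_nonneg (by linarith), abs_of_nonneg (by linarith)] at h1
      linarith
    rw [abs_of_neg (by linarith : (c : ℝ) - S.cp j < 0)] at h1 ⊢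
    rw [abs_lt]
    constructor <;> linarith
  · have h2' : (x : ℝ) ≤ y := by exact_mod_cast h2
    have h3' : (y : ℝ) < c := by exact_mod_cast h3
    have hck : (S.cp j : ℝ) < c := by
      by_contra! hcon
      rw [abs_of_nonpos (by linarith), abs_of_nonpos (by linarith)] at h1
      linarith
    rw [abs_of_pos (by linarith : 0 < (c : ℝ) - S.cp j)] at h1 ⊢
    rw [abs_lt]
    constructor <;> linarith

namespace PruneEnv

variable {n : ℕ} {S : MeanModel} {e : ℕ → ℝ} {ξ α η c₀ C₀ T T₁ T₂ τ σ M lam K : ℝ}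
  {Cand : Finset ℕ} {g : ℕ → ℕ} {D C Khat : Finset ℕ} {cL cR : ℕ}

/-- The orders of magnitude that the arguments below refer to. -/
lemma scales (H : GoodSample n S e ξ α η c₀ C₀ T Cand g)
    (tun : Tuning c₀ C₀ K T T₁ T₂ τ σ M lam η) :
    0 < α ∧ α < K * α ∧ K * α ≤ σ * ξ ∧ α ≤ T₁ / 16 * ξ ∧ σ * ξ ≤ τ * ξ ∧ τ * ξ ≤ T₁ * ξ ∧
      T₁ * ξ ≤ T₂ * ξ ∧ T₁ * ξ ≤ T₂ / 16 * ξ ∧ T₂ * ξ ≤ T * ξ := by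
  have hξ := H.ξ_pos
  have hα := H.α_pos
  have hK := tun.one_lt_K
  have hη := tun.η_pos
  have hσ := tun.σ_pos
  have h1 := tun.two_σ_le
  have h2 := tun.τ_le_T₁
  have h3 := tun.T₁_le_T₂
  have h4 := tun.T₂_le_T
  have h5 := tun.swap_σ
  have hαη := H.α_le
  have hησ : 16 * η ≤ σ := by nlinarith [mul_nonneg (sq_nonneg T) hη.le]
  refine ⟨hα, by nlinarith, ?_, ?_, by gcongr; linarith, by gcongr, by gcongr; linarith,
    by gcongr; linarith, by gcongr⟩
  · calc K * α ≤ K * (η * ξ) := by gcongr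
      _ = K * η * ξ := by ring
      _ ≤ σ * ξ := by gcongr; exact tun.K_mul_η
  · calc α ≤ η * ξ := hαη
      _ ≤ T₁ / 16 * ξ := by gcongr; linarith

lemma union_subset (P : PruneEnv S α K Cand g C Khat D cL cR) {A : Finset ℕ} (hA : A ⊆ D) :
    A ∪ (Khat ∪ C \ D) ⊆ Cand :=
  Finset.union_subset (hA.trans P.D_subset) P.rest_subset

/-- A set of candidates that, with the break points outside `(cL, cR)`, closely covers all change
points has the monotonicity property (C1). -/
lemma monotoneAbove_of_covers (P : PruneEnv S α K Cand g C Khat D cL cR)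
    (H : GoodSample n S e ξ α η c₀ C₀ T Cand g) (tun : Tuning c₀ C₀ K T T₁ T₂ τ σ M lam η)
    {A : Finset ℕ} (hA : A ⊆ D)
    (hcov : ∀ i ∈ Finset.Icc 1 S.q, Covers S (A ∪ (Khat ∪ C \ D)) (τ * ξ) i) :
    MonotoneAbove D (SC n (fun t => S.mean t + e t) ξ D C Khat) A := by
  refine ⟨hA, fun B hAB hBD c hc => ?_⟩
  rw [Finset.mem_sdiff] at hc
  refine (H.SC_lt_insert tun hc.2 (P.union_subset (Finset.insert_subset hc.1 hBD))
    fun i hi => Or.inl ?_).le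
  exact (hcov i hi).mono (Finset.union_subset_union_left hAB) le_rfl

/-- Conversely, a set with the monotonicity property covers all change points at moderate distance:
otherwise all other candidates could be added, and then the distinguished candidate of the uncovered
change point would improve the criterion. -/
lemma covers_of_monotoneAbove (P : PruneEnv S α K Cand g C Khat D cL cR)
    (H : GoodSample n S e ξ α η c₀ C₀ T Cand g) (tun : Tuning c₀ C₀ K T T₁ T₂ τ σ M lam η)
    {A : Finset ℕ} (hA : MonotoneAbove D (SC n (fun t => S.mean t + e t) ξ D C Khat) A) {j : ℕ}
    (hj : j ∈ Finset.Icc 1 S.q) : Covers S (A ∪ (Khat ∪ C \ D)) (T₁ * ξ) j := by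
  classical
  obtain ⟨hα, hαK, s1, s2, s3, s4, s5, s6, s7⟩ := scales H tun
  by_contra hncov
  have hgD : g j ∈ D := (P.covered j hj).resolve_right fun h =>
    hncov (h.mono Finset.subset_union_right (by linarith))
  set B := D.filter fun c => ¬ scaledError S c j ≤ T₁ * ξ with hB
  have hgB : g j ∉ B := fun h => (Finset.mem_filter.1 h).2 ((H.g_close j hj).trans (by linarith))
  have hAB : A ⊆ B := fun a ha => Finset.mem_filter.2
    ⟨hA.1 ha, fun h => hncov ⟨a, Finset.mem_union_left _ ha, h⟩⟩
  have h1 := hA.2 B hAB (Finset.filter_subset _ _) (g j) (Finset.mem_sdiff.2 ⟨hgD, hgB⟩)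
  refine absurd h1 (not_le.2 ?_)
  refine H.SC_lt_of_uncovered tun (A := B) (θ := T₁) (m := 1)
    (by linarith [tun.gain_large, tun.C₀_pos]) (by linarith [tun.T₁_le_T₂, tun.T₂_le_T,
      tun.gain_large, tun.C₀_pos]) tun.mean_T₁ (by simpa using tun.gain_large)
    (P.union_subset (Finset.insert_subset hgD (Finset.filter_subset _ _))) hj ?_ ?_
    ((H.g_close j hj).trans s2) subset_rfl subset_rfl (Finset.card_insert_le _ _)
  · intro i hi hij
    rcases P.covered i hi with h | h
    · refine ⟨g i, Finset.mem_union_left _ (Finset.mem_filter.2 ⟨h, fun hclose => hij ?_⟩),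
        (H.g_close i hi).trans (by linarith)⟩
      exact H.eq_of_close tun.T_mul_η hi hj ((H.g_close i hi).trans (by linarith))
        (hclose.trans (by linarith))
    · exact h.mono Finset.subset_union_right (by linarith)
  · rintro ⟨x, hx, hxj⟩
    rcases Finset.mem_union.1 hx with hx | hx
    · exact (Finset.mem_filter.1 hx).2 hxj
    · exact hncov ⟨x, Finset.mem_union_right _ hx, hxj⟩

/-- A change point whose distinguished candidate lies in `(cL, cR)` and which has a break point
nearby outside this interval is close to `cL` or to `cR`. -/
lemma close_boundary (P : PruneEnv S α K Cand g C Khat D cL cR) {j : ℕ} {θ : ℝ} (hg : g j ∈ D)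
    (hgj : scaledError S (g j) j ≤ θ) (h : Covers S (Khat ∪ C \ D) θ j) :
    scaledError S cL j ≤ θ ∨ scaledError S cR j ≤ θ := by
  obtain ⟨y, hy, hyj⟩ := h
  obtain ⟨h1, h2⟩ := P.mem_D _ hg
  rcases P.rest_out y hy with h | h
  · exact Or.inl (scaledError_between h h1.le hyj hgj)
  · exact Or.inr (scaledError_between h2.le h hgj hyj)

/-- One representative for every change point in `J` makes an admissible set, provided that the
remaining change points are covered from outside `(cL, cR)`. There are at most two such change
points with a candidate in `D`, the first and the last one. This is what the two extra elements and
the removal of extremal elements in the definition of the search family are for. -/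
lemma searchFamily_image (P : PruneEnv S α K Cand g C Khat D cL cR)
    (H : GoodSample n S e ξ α η c₀ C₀ T Cand g) (tun : Tuning c₀ C₀ K T T₁ T₂ τ σ M lam η)
    {J : Finset ℕ} (hJ : J ⊆ Finset.Icc 1 S.q)
    (hout : ∀ j ∈ Finset.Icc 1 S.q, j ∉ J → g j ∈ D → Covers S (Khat ∪ C \ D) (T₂ * ξ) j)
    {r : ℕ → ℕ} (hgD : ∀ j ∈ J, g j ∈ D) (hrD : ∀ j ∈ J, r j ∈ D)
    (hr : ∀ j ∈ J, scaledError S (r j) j ≤ τ * ξ) :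
    SearchFamily D (SC n (fun t => S.mean t + e t) ξ D C Khat) (J.image r) := by
  classical
  obtain ⟨hα, hαK, s1, s2, s3, s4, s5, s6, s7⟩ := scales H tun
  have hT := tun.T_mul_η
  set r' : ℕ → ℕ := fun j => if j ∈ J then r j else g j with hr'
  set J' := (Finset.Icc 1 S.q).filter fun j => g j ∈ D with hJ'
  have hJJ' : J ⊆ J' := fun j hj => Finset.mem_filter.2 ⟨hJ hj, hgD j hj⟩
  have hJ'I : J' ⊆ Finset.Icc 1 S.q := Finset.filter_subset _ _
  have hr'D : ∀ j ∈ J', r' j ∈ D := by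
    intro j hj
    by_cases h : j ∈ J
    · simp only [hr', if_pos h]
      exact hrD j h
    · simp only [hr', if_neg h]
      exact (Finset.mem_filter.1 hj).2
  have hr'close : ∀ j ∈ J', scaledError S (r' j) j ≤ τ * ξ := by
    intro j hj
    by_cases h : j ∈ J
    · simp only [hr', if_pos h]
      exact hr j h
    · simp only [hr', if_neg h]
      exact (H.g_close j (hJ'I hj)).trans (by linarith)
  have hinj : Set.InjOn r' J' := by
    intro i hi j hj hij
    refine H.eq_of_close hT (hJ'I hi) (hJ'I hj) ((hr'close i hi).trans (by linarith)) ?_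
    rw [hij]
    exact (hr'close j hj).trans (by linarith)
  have hmono : MonotoneAbove D (SC n (fun t => S.mean t + e t) ξ D C Khat) (J'.image r') := by
    refine P.monotoneAbove_of_covers H tun (Finset.image_subset_iff.2 hr'D) fun i hi => ?_
    by_cases h : g i ∈ D
    · have hiJ' : i ∈ J' := Finset.mem_filter.2 ⟨hi, h⟩
      exact ⟨r' i, Finset.mem_union_left _ (Finset.mem_image_of_mem _ hiJ'), hr'close i hiJ'⟩
    · exact ((P.covered i hi).resolve_left h).mono Finset.subset_union_right (by linarith)
  refine hmono.searchFamily ?_ ⟨?_, ?_⟩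
  · obtain ⟨B, hB, hBcard⟩ := exists_card_eq_minCard hmono
    rw [← hBcard, Finset.card_image_of_injOn hinj]
    set J₁ := J'.filter fun j => Covers S (Khat ∪ C \ D) (T₁ * ξ) j with hJ₁
    have h1 : J₁.card ≤ 2 := by
      have hsub : J₁ ⊆ (J'.filter fun j => scaledError S cL j ≤ T₁ * ξ) ∪
          J'.filter fun j => scaledError S cR j ≤ T₁ * ξ := by
        intro j hj
        rw [hJ₁, Finset.mem_filter] at hj
        rcases P.close_boundary (Finset.mem_filter.1 hj.1).2
          ((H.g_close j (hJ'I hj.1)).trans (by linarith)) hj.2 with h | h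
        · exact Finset.mem_union_left _ (Finset.mem_filter.2 ⟨hj.1, h⟩)
        · exact Finset.mem_union_right _ (Finset.mem_filter.2 ⟨hj.1, h⟩)
      have hone : ∀ z, (J'.filter fun j => scaledError S z j ≤ T₁ * ξ).card ≤ 1 := by
        intro z
        rw [Finset.card_le_one]
        intro i hi j hj
        rw [Finset.mem_filter] at hi hj
        exact H.eq_of_close hT (hJ'I hi.1) (hJ'I hj.1) (hi.2.trans (by linarith))
          (hj.2.trans (by linarith))
      have := Finset.card_le_card hsub
      have := Finset.card_union_le (J'.filter fun j => scaledError S cL j ≤ T₁ * ξ)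
        (J'.filter fun j => scaledError S cR j ≤ T₁ * ξ)
      have := hone cL
      have := hone cR
      omega
    have h2 : (J' \ J₁).card ≤ B.card := by
      have hex : ∀ j, ∃ b, j ∈ J' \ J₁ → b ∈ B ∧ scaledError S b j ≤ T₁ * ξ := by
        intro j
        by_cases hj : j ∈ J' \ J₁
        · rw [Finset.mem_sdiff] at hj
          obtain ⟨b, hb, hbj⟩ := P.covers_of_monotoneAbove H tun hB (hJ'I hj.1)
          rcases Finset.mem_union.1 hb with hb | hb
          · exact ⟨b, fun _ => ⟨hb, hbj⟩⟩
          · exact absurd (Finset.mem_filter.2 ⟨hj.1, b, hb, hbj⟩) hj.2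
        · exact ⟨0, fun h => absurd h hj⟩
      choose b hb using hex
      refine Finset.card_le_card_of_injOn b (fun j hj => (hb j hj).1) ?_
      intro i hi j hj hij
      have hi' := hJ'I (Finset.mem_sdiff.1 hi).1
      have hj' := hJ'I (Finset.mem_sdiff.1 hj).1
      refine H.eq_of_close hT hi' hj' ((hb i hi).2.trans (by linarith)) ?_
      rw [hij]
      exact (hb j hj).2.trans (by linarith)
    have h3 : (J' \ J₁).card + J₁.card = J'.card :=
      Finset.card_sdiff_add_card_eq_card (Finset.filter_subset _ _)
    omega
  · intro c hc
    obtain ⟨j, hj, rfl⟩ := Finset.mem_image.1 hc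
    refine Finset.mem_image.2 ⟨j, hJJ' hj, ?_⟩
    simp only [hr', if_pos hj]
  · -- a removed element is close to `cL` or `cR`, so that it is the first or the last one
    rintro c hc ⟨a, ha, hac⟩ ⟨b, hb, hcb⟩
    obtain ⟨j, hj, rfl⟩ := Finset.mem_image.1 hc
    obtain ⟨i, hi, rfl⟩ := Finset.mem_image.1 ha
    obtain ⟨l, hl, rfl⟩ := Finset.mem_image.1 hb
    by_cases hjJ : j ∈ J
    · refine Finset.mem_image.2 ⟨j, hjJ, ?_⟩
      simp only [hr', if_pos hjJ]
    exfalso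
    have hjc := hr'close j hj
    rcases P.close_boundary (Finset.mem_filter.1 hj).2
      ((H.g_close j (hJ'I hj)).trans (by linarith))
      (hout j (hJ'I hj) hjJ (Finset.mem_filter.1 hj).2) with h | h
    · have h1 := scaledError_between (P.mem_D _ (hr'D i hi)).1.le hac.le h
        (hjc.trans (by linarith))
      have : i = j := H.eq_of_close hT (hJ'I hi) (hJ'I hj) ((hr'close i hi).trans (by linarith))
        (h1.trans (by linarith))
      subst this
      exact lt_irrefl _ hac
    · have h1 := scaledError_between hcb.le (P.mem_D _ (hr'D l hl)).2.le
        (hjc.trans (by linarith)) h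
      have : l = j := H.eq_of_close hT (hJ'I hl) (hJ'I hj) ((hr'close l hl).trans (by linarith))
        (h1.trans (by linarith))
      subst this
      exact lt_irrefl _ hcb

/-- The output of the inner algorithm covers all change points at moderate distance. Otherwise the
set from which it was obtained by removing extremal elements would be better. -/
lemma covers_of_isPrunAlgOutput (P : PruneEnv S α K Cand g C Khat D cL cR)
    (H : GoodSample n S e ξ α η c₀ C₀ T Cand g) (tun : Tuning c₀ C₀ K T T₁ T₂ τ σ M lam η)
    {Ahat : Finset ℕ}
    (hout : IsPrunAlgOutput D (SC n (fun t => S.mean t + e t) ξ D C Khat) Ahat) {j : ℕ}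
    (hj : j ∈ Finset.Icc 1 S.q) : Covers S (Ahat ∪ (Khat ∪ C \ D)) (T₂ * ξ) j := by
  classical
  obtain ⟨hα, hαK, s1, s2, s3, s4, s5, s6, s7⟩ := scales H tun
  obtain ⟨⟨A', hmono, hc1, hc2, hinner⟩, hmin, -⟩ := hout
  by_contra hncov
  obtain ⟨x, hx, hxj⟩ := P.covers_of_monotoneAbove H tun hmono hj
  have hxA' : x ∈ A' := (Finset.mem_union.1 hx).resolve_right fun h =>
    hncov ⟨x, Finset.mem_union_right _ h, hxj.trans s5⟩
  set A := A'.filter fun c => ¬ scaledError S c j ≤ T₂ * ξ with hA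
  have h1 := hmin A' (hmono.searchFamily hc2 (InnerSubset.refl A'))
  refine absurd h1 (not_le.2 ?_)
  refine H.SC_lt_of_uncovered tun (A := A) (θ := T₂) (m := 2) (u := x) (j := j)
    (by linarith [tun.gain_large', tun.C₀_pos]) tun.T₂_le_T tun.mean_T₂
    (by have := tun.gain_large'; push_cast; linarith) (P.union_subset hmono.1) hj ?_ ?_
    (hxj.trans s6) ?_ (Finset.insert_subset hxA' (Finset.filter_subset _ _)) hinner.card_le
  · intro i hi hij
    obtain ⟨y, hy, hyi⟩ := P.covers_of_monotoneAbove H tun hmono hi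
    rcases Finset.mem_union.1 hy with hy | hy
    · refine ⟨y, Finset.mem_union_left _ (Finset.mem_filter.2 ⟨hy, fun hclose => hij ?_⟩),
        hyi.trans (by linarith)⟩
      exact H.eq_of_close tun.T_mul_η hi hj (hyi.trans (by linarith)) (hclose.trans s7)
    · exact ⟨y, Finset.mem_union_right _ hy, hyi.trans (by linarith)⟩
  · rintro ⟨y, hy, hyj⟩
    rcases Finset.mem_union.1 hy with hy | hy
    · exact (Finset.mem_filter.1 hy).2 hyj
    · exact hncov ⟨y, Finset.mem_union_right _ hy, hyj⟩
  · intro a ha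
    exact Finset.mem_filter.2 ⟨hinner.1 ha, fun h => hncov ⟨a, Finset.mem_union_left _ ha, h⟩⟩

end PruneEnv

namespace PruneEnv

variable {n : ℕ} {S : MeanModel} {e : ℕ → ℝ} {ξ α η c₀ C₀ T T₁ T₂ τ σ M lam K : ℝ}
  {Cand : Finset ℕ} {g : ℕ → ℕ} {D C Khat : Finset ℕ} {cL cR : ℕ}

/-- No break point `y` separates a candidate `c` near the change point `j` from the distinguished
candidate of `j`, unless it is nearer to `j` than `c`. -/
lemma separated (P : PruneEnv S α K Cand g C Khat D cL cR)
    (H : GoodSample n S e ξ α η c₀ C₀ T Cand g) (tun : Tuning c₀ C₀ K T T₁ T₂ τ σ M lam η)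
    {j c y : ℕ} (hj : j ∈ Finset.Icc 1 S.q) (hc : c ∈ D) (hgD : g j ∈ D)
    (hcT : scaledError S c j ≤ T * ξ) (hgc : scaledError S (g j) j < scaledError S c j)
    (hy : y ∈ Khat ∪ C \ D ∨ (∃ i ∈ Finset.Icc 1 S.q, i ≠ j ∧ scaledError S y i ≤ T * ξ) ∨
      y ≠ c ∧ scaledError S c j ≤ scaledError S y j) :
    (y < c ∧ y < g j) ∨ (c < y ∧ g j < y) := by
  have hgT := hgc.le.trans hcT
  rcases hy with hy | ⟨i, hi, hij, hyi⟩ | ⟨hyc, hle⟩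
  · have h1 := P.mem_D _ hc
    have h2 := P.mem_D _ hgD
    rcases P.rest_out y hy with h | h
    · left; omega
    · right; omega
  · rcases lt_or_gt_of_ne hij with h | h
    · exact Or.inl ⟨H.lt_of_close tun.T_mul_η hi hj h hyi hcT,
        H.lt_of_close tun.T_mul_η hi hj h hyi hgT⟩
    · exact Or.inr ⟨H.lt_of_close tun.T_mul_η hj hi h hcT hyi,
        H.lt_of_close tun.T_mul_η hj hi h hgT hyi⟩
  · by_contra hcon
    have hb : (c < y ∧ y ≤ g j) ∨ (g j ≤ y ∧ y < c) := by omega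
    exact absurd (scaledError_lt_of_between (H.valid.d_ne_zero hj) hgc hb) (not_lt.2 hle)

lemma SC_swap_coarse (P : PruneEnv S α K Cand g C Khat D cL cR)
    (H : GoodSample n S e ξ α η c₀ C₀ T Cand g) (tun : Tuning c₀ C₀ K T T₁ T₂ τ σ M lam η)
    {A : Finset ℕ} {j c : ℕ} (hA : A ⊆ D) (hj : j ∈ Finset.Icc 1 S.q) (hgD : g j ∈ D)
    (hcov : ∀ i ∈ Finset.Icc 1 S.q, i ≠ j → Covers S (A ∪ (Khat ∪ C \ D)) (T * ξ) i)
    (hncov : ¬ Covers S (A ∪ (Khat ∪ C \ D)) (σ * ξ) j)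
    (hc1 : σ * ξ < scaledError S c j) (hc2 : scaledError S c j ≤ T * ξ)
    (hsep : ∀ y ∈ A ∪ (Khat ∪ C \ D), (y < c ∧ y < g j) ∨ (c < y ∧ g j < y)) :
    SC n (fun t => S.mean t + e t) ξ D C Khat (insert (g j) A) <
      SC n (fun t => S.mean t + e t) ξ D C Khat (insert c A) := by
  obtain ⟨hα, hαK, s1, s2, s3, s4, s5, s6, s7⟩ := scales H tun
  have hT : σ ≤ T := by
    linarith [tun.two_σ_le, tun.τ_le_T₁, tun.T₁_le_T₂, tun.T₂_le_T, tun.σ_pos]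
  refine H.SC_insert_lt_insert tun (fun h => ?_) (fun h => ?_)
    (P.union_subset (Finset.insert_subset hgD hA)) ?_
  · have := hsep _ (Finset.mem_union_left _ h)
    omega
  · have := hsep _ (Finset.mem_union_left _ h)
    omega
  · exact H.RSS_swap_lt_coarse (by linarith [tun.σ_pos]) tun.T_mul_η tun.σ_pos hT tun.swap_σ
      tun.mean_σ hj ((P.union_subset hA).trans H.cand_subset) hcov hncov (H.g_close j hj) hc1 hc2
      hsep

lemma SC_swap_fine (P : PruneEnv S α K Cand g C Khat D cL cR)
    (H : GoodSample n S e ξ α η c₀ C₀ T Cand g) (tun : Tuning c₀ C₀ K T T₁ T₂ τ σ M lam η)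
    {A : Finset ℕ} {j c : ℕ} (hA : A ⊆ D) (hj : j ∈ Finset.Icc 1 S.q) (hgD : g j ∈ D)
    (hcov : ∀ i ∈ Finset.Icc 1 S.q, i ≠ j → Covers S (A ∪ (Khat ∪ C \ D)) (T * ξ) i)
    (hncov : ¬ Covers S (A ∪ (Khat ∪ C \ D)) (τ * ξ) j)
    (hc1 : K * α < scaledError S c j) (hc2 : scaledError S c j ≤ σ * ξ)
    (hsep : ∀ y ∈ A ∪ (Khat ∪ C \ D), (y < c ∧ y < g j) ∨ (c < y ∧ g j < y)) :
    SC n (fun t => S.mean t + e t) ξ D C Khat (insert (g j) A) <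
      SC n (fun t => S.mean t + e t) ξ D C Khat (insert c A) := by
  obtain ⟨hα, hαK, s1, s2, s3, s4, s5, s6, s7⟩ := scales H tun
  have hT : τ ≤ T := by
    linarith [tun.two_σ_le, tun.τ_le_T₁, tun.T₁_le_T₂, tun.T₂_le_T, tun.σ_pos]
  have hητ : 2 * η ≤ τ := by
    nlinarith [mul_nonneg (sq_nonneg T) tun.η_pos.le, tun.swap_σ, tun.two_σ_le, tun.η_pos]
  refine H.SC_insert_lt_insert tun (fun h => ?_) (fun h => ?_)
    (P.union_subset (Finset.insert_subset hgD hA)) ?_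
  · have := hsep _ (Finset.mem_union_left _ h)
    omega
  · have := hsep _ (Finset.mem_union_left _ h)
    omega
  · exact H.RSS_swap_lt_fine H.local_noise (by linarith [tun.σ_pos, tun.two_σ_le]) tun.T_mul_η
      tun.one_lt_K tun.lam_pos tun.lam_lt hT hητ tun.two_σ_le tun.σ_le_lam tun.η_le_lam tun.mean_τ
      hj ((P.union_subset hA).trans H.cand_subset) hcov hncov (H.g_close j hj) hc1 hc2 hsep

/-- The output of the inner algorithm consists of exactly one element close to each of certain
change points, and all other change points are covered from outside `(cL, cR)`. For the proof, the
elements of the output nearest to the change points are moved to better positions, and then all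
other elements are removed. Every step decreases the criterion, and the result belongs to the search
family, so that nothing can have changed. -/
lemma output_eq_image (P : PruneEnv S α K Cand g C Khat D cL cR)
    (H : GoodSample n S e ξ α η c₀ C₀ T Cand g) (tun : Tuning c₀ C₀ K T T₁ T₂ τ σ M lam η)
    {Ahat : Finset ℕ}
    (hout : IsPrunAlgOutput D (SC n (fun t => S.mean t + e t) ξ D C Khat) Ahat) :
    ∃ J ⊆ Finset.Icc 1 S.q, ∃ c : ℕ → ℕ, Ahat = J.image c ∧
      (∀ j ∈ J, g j ∈ D ∧ c j ∈ D ∧ ¬ Covers S (Khat ∪ C \ D) (τ * ξ) j ∧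
        scaledError S (c j) j ≤ σ * ξ) ∧
      ∀ j ∈ Finset.Icc 1 S.q, j ∉ J → Covers S (Khat ∪ C \ D) (T₂ * ξ) j := by
  classical
  obtain ⟨hα, hαK, s1, s2, s3, s4, s5, s6, s7⟩ := scales H tun
  have hT := tun.T_mul_η
  set sc := SC n (fun t => S.mean t + e t) ξ D C Khat with hsc
  set E := Khat ∪ C \ D with hE
  have hAD : Ahat ⊆ D := by
    obtain ⟨A', h1, -, -, h2⟩ := hout.1
    exact h2.1.trans h1.1
  set J := (Finset.Icc 1 S.q).filter fun j => ¬ Covers S E (τ * ξ) j ∧ Covers S Ahat (T * ξ) j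
    with hJ
  have hJI : J ⊆ Finset.Icc 1 S.q := Finset.filter_subset _ _
  have hex : ∀ j, ∃ c, j ∈ J → c ∈ Ahat ∧ ∀ a ∈ Ahat, scaledError S c j ≤ scaledError S a j := by
    intro j
    by_cases hj : j ∈ J
    · obtain ⟨x, hx, -⟩ := (Finset.mem_filter.1 hj).2.2
      obtain ⟨c, hc, hmin⟩ := Ahat.exists_min_image (fun a => scaledError S a j) ⟨x, hx⟩
      exact ⟨c, fun _ => ⟨hc, hmin⟩⟩
    · exact ⟨0, fun h => absurd h hj⟩
  choose c hc using hex
  have hcT : ∀ j ∈ J, scaledError S (c j) j ≤ T * ξ := by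
    intro j hj
    obtain ⟨x, hx, hxj⟩ := (Finset.mem_filter.1 hj).2.2
    exact ((hc j hj).2 x hx).trans hxj
  have hcD : ∀ j ∈ J, c j ∈ D := fun j hj => hAD (hc j hj).1
  have hnE : ∀ j ∈ J, ¬ Covers S E (τ * ξ) j := fun j hj => (Finset.mem_filter.1 hj).2.1
  have hgD : ∀ j ∈ J, g j ∈ D := fun j hj => (P.covered j (hJI hj)).resolve_right fun h =>
    hnE j hj (h.mono subset_rfl (by linarith))
  have hnJ : ∀ j ∈ Finset.Icc 1 S.q, j ∉ J →
      Covers S E (τ * ξ) j ∨ ¬ Covers S Ahat (T * ξ) j ∧ Covers S E (T₂ * ξ) j := by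
    intro j hj hjJ
    by_cases h : Covers S E (τ * ξ) j
    · exact Or.inl h
    · have h2 : ¬ Covers S Ahat (T * ξ) j := fun h2 => hjJ (Finset.mem_filter.2 ⟨hj, h, h2⟩)
      refine Or.inr ⟨h2, ?_⟩
      obtain ⟨x, hx, hxj⟩ := P.covers_of_isPrunAlgOutput H tun hout hj
      rcases Finset.mem_union.1 hx with hx | hx
      · exact absurd ⟨x, hx, hxj.trans s7⟩ h2
      · exact ⟨x, hx, hxj⟩
  have hnJ' : ∀ j ∈ Finset.Icc 1 S.q, j ∉ J → Covers S E (T₂ * ξ) j := fun j hj hjJ =>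
    (hnJ j hj hjJ).elim (fun h => h.mono subset_rfl (by linarith)) And.right
  set r : ℕ → ℕ := fun j => if scaledError S (c j) j ≤ σ * ξ then c j else g j with hr
  have hrD : ∀ j ∈ J, r j ∈ D := by
    intro j hj
    by_cases h : scaledError S (c j) j ≤ σ * ξ
    · simp only [hr, if_pos h]
      exact hcD j hj
    · simp only [hr, if_neg h]
      exact hgD j hj
  have hrσ : ∀ j ∈ J, scaledError S (r j) j ≤ σ * ξ := by
    intro j hj
    by_cases h : scaledError S (c j) j ≤ σ * ξ
    · simp only [hr, if_pos h]
      exact h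
    · simp only [hr, if_neg h]
      exact (H.g_close j (hJI hj)).trans (by linarith)
  set U := Ahat \ J.image c with hU
  have hUA : U ⊆ Ahat := Finset.sdiff_subset
  have himage : J.image c ⊆ Ahat := Finset.image_subset_iff.2 fun j hj => (hc j hj).1
  have hAhat : U ∪ J.image c = Ahat := Finset.sdiff_union_of_subset himage
  -- moving the nearest elements one after the other
  have hmove : ∀ J₀ ⊆ J,
      sc (U ∪ J.image fun i => if i ∈ J₀ then r i else c i) ≤ sc Ahat ∧
        ((∃ j ∈ J₀, r j ≠ c j) →
          sc (U ∪ J.image fun i => if i ∈ J₀ then r i else c i) < sc Ahat) := by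
    intro J₀
    induction J₀ using Finset.induction_on with
    | empty => intro _; simp [hAhat]
    | insert j J₀ hjJ₀ ih =>
      intro hsub
      have hjJ := hsub (Finset.mem_insert_self _ _)
      obtain ⟨ih1, ih2⟩ := ih ((Finset.subset_insert _ _).trans hsub)
      set s : ℕ → ℕ := fun i => if i ∈ J₀ then r i else c i with hs
      by_cases hrc : r j = c j
      · have hfun : (fun i => if i ∈ insert j J₀ then r i else c i) = s := by
          funext i
          by_cases hij : i = j
          · subst hij
            simp [hs, hrc]
          · simp [hs, Finset.mem_insert, hij]
        rw [hfun]
        refine ⟨ih1, fun ⟨i, hi, hir⟩ => ih2 ⟨i, ?_, hir⟩⟩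
        rcases Finset.mem_insert.1 hi with rfl | hi
        · exact absurd hrc hir
        · exact hi
      · have hbig : σ * ξ < scaledError S (c j) j := by
          by_contra! hcon
          exact hrc (by simp only [hr, if_pos hcon])
        have hrg : r j = g j := by simp only [hr, if_neg (not_le.2 hbig)]
        have hsD : ∀ i ∈ J, s i ∈ D := by
          intro i hi
          by_cases h : i ∈ J₀
          · simp only [hs, if_pos h]
            exact hrD i hi
          · simp only [hs, if_neg h]
            exact hcD i hi
        have hsT : ∀ i ∈ J, scaledError S (s i) i ≤ T * ξ := by
          intro i hi
          by_cases h : i ∈ J₀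
          · simp only [hs, if_pos h]
            exact (hrσ i hi).trans (by linarith)
          · simp only [hs, if_neg h]
            exact hcT i hi
        have hi1 : J.image (fun i => if i ∈ insert j J₀ then r i else c i) =
            insert (g j) ((J.erase j).image s) := by
          conv_lhs => rw [← Finset.insert_erase hjJ]
          rw [Finset.image_insert, if_pos (Finset.mem_insert_self _ _), hrg]
          congr 1
          refine Finset.image_congr fun i hi => ?_
          have hij : i ≠ j := Finset.ne_of_mem_erase hi
          simp [hs, Finset.mem_insert, hij]
        have hi2 : J.image s = insert (c j) ((J.erase j).image s) := by
          conv_lhs => rw [← Finset.insert_erase hjJ]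
          rw [Finset.image_insert]
          simp only [hs, if_neg hjJ₀]
        have hclass : ∀ y ∈ U ∪ (J.erase j).image s ∪ E, y ∈ E ∨
            (∃ i ∈ Finset.Icc 1 S.q, i ≠ j ∧ scaledError S y i ≤ T * ξ) ∨
            y ≠ c j ∧ scaledError S (c j) j ≤ scaledError S y j := by
          intro y hy
          rcases Finset.mem_union.1 hy with hy | hy
          · rcases Finset.mem_union.1 hy with hy | hy
            · right; right
              rw [hU, Finset.mem_sdiff] at hy
              refine ⟨fun h => hy.2 ?_, (hc j hjJ).2 y hy.1⟩
              rw [h]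
              exact Finset.mem_image_of_mem _ hjJ
            · obtain ⟨i, hi, rfl⟩ := Finset.mem_image.1 hy
              rw [Finset.mem_erase] at hi
              exact Or.inr (Or.inl ⟨i, hJI hi.2, hi.1, hsT i hi.2⟩)
          · exact Or.inl hy
        have hlt : sc (insert (g j) (U ∪ (J.erase j).image s)) <
            sc (insert (c j) (U ∪ (J.erase j).image s)) := by
          refine P.SC_swap_coarse H tun ?_ (hJI hjJ) (hgD j hjJ) ?_ ?_ hbig (hcT j hjJ) ?_
          · refine Finset.union_subset (hUA.trans hAD) (Finset.image_subset_iff.2 fun i hi => ?_)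
            exact hsD i (Finset.mem_of_mem_erase hi)
          · intro i hi hij
            by_cases hiJ : i ∈ J
            · refine ⟨s i, Finset.mem_union_left _ (Finset.mem_union_right _
                (Finset.mem_image_of_mem _ (Finset.mem_erase.2 ⟨hij, hiJ⟩))), hsT i hiJ⟩
            · exact (hnJ' i hi hiJ).mono Finset.subset_union_right s7
          · rintro ⟨y, hy, hyj⟩
            rcases hclass y hy with h | ⟨i, hi, hij, hyi⟩ | ⟨-, h⟩
            · exact hnE j hjJ ⟨y, h, hyj.trans s3⟩
            · exact hij (H.eq_of_close hT hi (hJI hjJ) hyi (hyj.trans (by linarith)))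
            · linarith
          · intro y hy
            exact P.separated H tun (hJI hjJ) (hcD j hjJ) (hgD j hjJ) (hcT j hjJ)
              ((H.g_close j (hJI hjJ)).trans_lt (by linarith)) (hclass y hy)
        rw [hi1, Finset.union_insert]
        rw [hi2, Finset.union_insert] at ih1
        exact ⟨(hlt.trans_le ih1).le, fun _ => hlt.trans_le ih1⟩
  -- removing all other elements
  have hremove : ∀ V ⊆ Ahat, sc (J.image r) ≤ sc (V ∪ J.image r) ∧
      (¬ V ⊆ J.image r → sc (J.image r) < sc (V ∪ J.image r)) := by
    intro V
    induction V using Finset.induction_on with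
    | empty => intro _; simp
    | insert u V huV ih =>
      intro hsub
      have huA := hsub (Finset.mem_insert_self _ _)
      have hVA := (Finset.subset_insert _ _).trans hsub
      obtain ⟨ih1, ih2⟩ := ih hVA
      by_cases hu : u ∈ V ∪ J.image r
      · have huJ : u ∈ J.image r := (Finset.mem_union.1 hu).resolve_left huV
        rw [Finset.insert_union, Finset.insert_eq_of_mem hu]
        exact ⟨ih1, fun h => ih2 fun h2 => h (Finset.insert_subset huJ h2)⟩
      · have hlt : sc (V ∪ J.image r) < sc (insert u (V ∪ J.image r)) := by
          refine H.SC_lt_insert tun hu (P.union_subset (Finset.insert_subset (hAD huA)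
            (Finset.union_subset (hVA.trans hAD) (Finset.image_subset_iff.2 hrD)))) fun i hi => ?_
          by_cases hiJ : i ∈ J
          · exact Or.inl ⟨r i, Finset.mem_union_left _ (Finset.mem_union_right _
              (Finset.mem_image_of_mem _ hiJ)), (hrσ i hiJ).trans s3⟩
          · refine (hnJ i hi hiJ).imp (fun h => h.mono Finset.subset_union_right le_rfl)
              fun h => ⟨h.2.mono Finset.subset_union_right le_rfl, ?_⟩
            by_contra! hcon
            exact h.1 ⟨u, huA, hcon⟩
        rw [Finset.insert_union]
        exact ⟨(ih1.trans_lt hlt).le, fun _ => ih1.trans_lt hlt⟩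
  have hfam := P.searchFamily_image H tun hJI (fun j hj hjJ _ => hnJ' j hj hjJ) hgD hrD
    (fun j hj => (hrσ j hj).trans s3)
  have hmin := hout.2.1 _ hfam
  obtain ⟨m1, m2⟩ := hmove J subset_rfl
  have hJr : (J.image fun i => if i ∈ J then r i else c i) = J.image r :=
    Finset.image_congr fun i hi => if_pos hi
  rw [hJr] at m1 m2
  obtain ⟨k1, k2⟩ := hremove U hUA
  have hrc : ∀ j ∈ J, r j = c j := by
    by_contra! hcon
    exact absurd (k1.trans_lt (m2 hcon)) (not_lt.2 hmin)
  have himg : J.image r = J.image c := Finset.image_congr fun i hi => hrc i hi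
  have hUsub : U ⊆ J.image r := by
    by_contra hcon
    exact absurd ((k2 hcon).trans_le m1) (not_lt.2 hmin)
  rw [himg] at hUsub
  refine ⟨J, hJI, c, ?_, fun j hj => ⟨hgD j hj, hcD j hj, hnE j hj, ?_⟩, hnJ'⟩
  · rw [← hAhat]
    exact Finset.union_eq_right.2 hUsub
  · rw [← hrc j hj]
    exact hrσ j hj

/-- The output of the inner algorithm: one element within the acceptance radius, up to the factor
`K`, for each of certain change points, while all other change points are covered from outside
`(cL, cR)`. -/
theorem isPrunAlgOutput_spec (P : PruneEnv S α K Cand g C Khat D cL cR)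
    (H : GoodSample n S e ξ α η c₀ C₀ T Cand g) (tun : Tuning c₀ C₀ K T T₁ T₂ τ σ M lam η)
    {Ahat : Finset ℕ}
    (hout : IsPrunAlgOutput D (SC n (fun t => S.mean t + e t) ξ D C Khat) Ahat) :
    ∃ J ⊆ Finset.Icc 1 S.q, ∃ c : ℕ → ℕ, Ahat = J.image c ∧
      (∀ j ∈ J, c j ∈ D ∧ ¬ Covers S (Khat ∪ C \ D) (τ * ξ) j ∧
        scaledError S (c j) j ≤ K * α) ∧
      ∀ j ∈ Finset.Icc 1 S.q, j ∉ J → Covers S (Khat ∪ C \ D) (T₂ * ξ) j := by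
  classical
  obtain ⟨hα, hαK, s1, s2, s3, s4, s5, s6, s7⟩ := scales H tun
  have hT := tun.T_mul_η
  obtain ⟨J, hJI, c, hAhat, hJ, hnJ⟩ := P.output_eq_image H tun hout
  refine ⟨J, hJI, c, hAhat, fun j hj => ⟨(hJ j hj).2.1, (hJ j hj).2.2.1, ?_⟩, hnJ⟩
  by_contra! hbig
  obtain ⟨hgD, hcD, hnE, hcσ⟩ := hJ j hj
  -- otherwise replace the representative of `j` by the distinguished candidate
  have hcT : ∀ i ∈ J, scaledError S (c i) i ≤ T * ξ := fun i hi =>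
    (hJ i hi).2.2.2.trans (by linarith)
  set A := (J.erase j).image c with hA
  have hclass : ∀ y ∈ A ∪ (Khat ∪ C \ D), y ∈ Khat ∪ C \ D ∨
      (∃ i ∈ Finset.Icc 1 S.q, i ≠ j ∧ scaledError S y i ≤ T * ξ) := by
    intro y hy
    rcases Finset.mem_union.1 hy with hy | hy
    · obtain ⟨i, hi, rfl⟩ := Finset.mem_image.1 hy
      rw [Finset.mem_erase] at hi
      exact Or.inr ⟨i, hJI hi.2, hi.1, hcT i hi.2⟩
    · exact Or.inl hy
  have hlt : SC n (fun t => S.mean t + e t) ξ D C Khat (insert (g j) A) <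
      SC n (fun t => S.mean t + e t) ξ D C Khat (insert (c j) A) := by
    refine P.SC_swap_fine H tun ?_ (hJI hj) hgD ?_ ?_ hbig hcσ ?_
    · exact Finset.image_subset_iff.2 fun i hi => (hJ i (Finset.mem_of_mem_erase hi)).2.1
    · intro i hi hij
      by_cases hiJ : i ∈ J
      · exact ⟨c i, Finset.mem_union_left _
          (Finset.mem_image_of_mem _ (Finset.mem_erase.2 ⟨hij, hiJ⟩)), hcT i hiJ⟩
      · exact (hnJ i hi hiJ).mono Finset.subset_union_right s7
    · rintro ⟨y, hy, hyj⟩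
      rcases hclass y hy with h | ⟨i, hi, hij, hyi⟩
      · exact hnE ⟨y, h, hyj⟩
      · exact hij (H.eq_of_close hT hi (hJI hj) hyi (hyj.trans (by linarith)))
    · intro y hy
      exact P.separated H tun (hJI hj) hcD hgD (hcT j hj)
        ((H.g_close j (hJI hj)).trans_lt (by linarith)) ((hclass y hy).imp_right Or.inl)
  have h1 : J.image c = insert (c j) A := by
    conv_lhs => rw [← Finset.insert_erase hj]
    rw [Finset.image_insert]
  have h2 : J.image (Function.update c j (g j)) = insert (g j) A := by
    conv_lhs => rw [← Finset.insert_erase hj]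
    rw [Finset.image_insert, Function.update_self]
    congr 1
    exact Finset.image_congr fun i hi => Function.update_of_ne (Finset.ne_of_mem_erase hi) _ _
  have hfam : SearchFamily D (SC n (fun t => S.mean t + e t) ξ D C Khat) (insert (g j) A) := by
    rw [← h2]
    refine P.searchFamily_image H tun hJI (fun i hi hiJ _ => hnJ i hi hiJ)
      (fun i hi => (hJ i hi).1) (fun i hi => ?_) (fun i hi => ?_)
    · by_cases hij : i = j
      · subst hij
        rwa [Function.update_self]
      · rw [Function.update_of_ne hij]
        exact (hJ i hi).2.1
    · by_cases hij : i = j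
      · subst hij
        rw [Function.update_self]
        exact (H.g_close i (hJI hi)).trans (by linarith)
      · rw [Function.update_of_ne hij]
        exact (hJ i hi).2.2.2.trans s3
  have hmin := hout.2.1 _ hfam
  rw [hAhat, h1] at hmin
  exact absurd hlt (not_lt.2 hmin)

end PruneEnv

/-! ### The outer algorithm -/

/-- The invariant of the outer algorithm, for a state (accepted candidates, active candidates):
every accepted candidate is close to a change point, no change point has two of them, and a change
point without one still has its distinguished candidate among the active ones. -/
structure LocInvariant (S : MeanModel) (α K : ℝ) (Cand : Finset ℕ) (g : ℕ → ℕ)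
    (st : Finset ℕ × Finset ℕ) : Prop where
  accepted_subset : st.1 ⊆ Cand
  active_subset : st.2 ⊆ Cand
  disjoint : Disjoint st.1 st.2
  close : ∀ a ∈ st.1, ∃ j ∈ Finset.Icc 1 S.q, scaledError S a j ≤ K * α
  unique : ∀ j ∈ Finset.Icc 1 S.q, ∀ a ∈ st.1, ∀ b ∈ st.1,
    scaledError S a j ≤ K * α → scaledError S b j ≤ K * α → a = b
  reached : ∀ j ∈ Finset.Icc 1 S.q, Covers S st.1 (K * α) j ∨ g j ∈ st.2

/-- Two points at distance at least `m` cannot both be close to the same change point. -/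
lemma sq_mul_le_scaledError_add {S : MeanModel} {x y m j : ℕ} (h : x + m ≤ y) :
    S.d j ^ 2 * m ≤ scaledError S x j + scaledError S y j := by
  unfold scaledError
  rw [← mul_add]
  have h' : (x : ℝ) + m ≤ y := by exact_mod_cast h
  gcongr
  have h1 := neg_abs_le ((x : ℝ) - S.cp j)
  have h2 := le_abs_self ((y : ℝ) - S.cp j)
  linarith

namespace LocInvariant

variable {n : ℕ} {S : MeanModel} {e : ℕ → ℝ} {ξ α η c₀ C₀ T T₁ T₂ τ σ M lam K : ℝ}
  {Cand : Finset ℕ} {g : ℕ → ℕ} {gL gR : ℕ → ℕ} {h : ℕ → ℝ} {st st' : Finset ℕ × Finset ℕ}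

lemma pruneEnv (I : LocInvariant S α K Cand g st)
    (H : GoodSample n S e ξ α η c₀ C₀ T Cand g) (tun : Tuning c₀ C₀ K T T₁ T₂ τ σ M lam η)
    {x cL cR : ℕ} (hx : x ∈ st.2)
    (hcL : IsGreatest {c | LeftBoundary gL gR st.2 st.1 x c} cL)
    (hcR : IsLeast {c | RightBoundary n gL gR st.2 st.1 x c} cR) :
    PruneEnv S α K Cand g st.2 st.1 (st.2.filter fun c => cL < c ∧ c < cR) cL cR := by
  obtain ⟨hα, hαK, -⟩ := PruneEnv.scales H tun
  refine ⟨(Finset.filter_subset _ _).trans I.active_subset,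
    Finset.union_subset I.accepted_subset (Finset.sdiff_subset.trans I.active_subset),
    fun c hc => (Finset.mem_filter.1 hc).2, fun y hy => ?_, fun j hj => ?_⟩
  · rcases Finset.mem_union.1 hy with hy | hy
    · have hne : y ≠ x := fun hyx => Finset.disjoint_left.1 I.disjoint hy (hyx ▸ hx)
      rcases lt_or_gt_of_ne hne with hlt | hlt
      · exact Or.inl (hcL.2 ⟨hlt, Or.inl hy⟩)
      · exact Or.inr (hcR.2 ⟨hlt, Or.inl hy⟩)
    · rw [Finset.mem_sdiff, Finset.mem_filter] at hy
      by_contra! hcon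
      exact hy.2 ⟨hy.1, hcon⟩
  · rcases I.reached j hj with hc | hc
    · exact Or.inr (hc.mono Finset.subset_union_left le_rfl)
    · by_cases hD : g j ∈ st.2.filter fun c => cL < c ∧ c < cR
      · exact Or.inl hD
      · exact Or.inr ⟨g j, Finset.mem_union_right _ (Finset.mem_sdiff.2 ⟨hc, hD⟩),
          (H.g_close j hj).trans hαK.le⟩

/-- The heart of the matter: an iteration preserves the invariant. If the change point `j` is left
undetected although its distinguished candidate is in the local environment, then it lies close to
an end point of that environment. This end point is neither accepted nor `0` or `n`, so it is an
active candidate, whose distance from the central candidate exceeds the detection interval. Hence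
the distinguished candidate of `j` is not the central candidate. Nor does an element of the output
lie between it and that end point, so that no decision about it is made. -/
lemma step (I : LocInvariant S α K Cand g st)
    (H : GoodSample n S e ξ α η c₀ C₀ T Cand g) (tun : Tuning c₀ C₀ K T T₁ T₂ τ σ M lam η)
    (hgL : ∀ j ∈ Finset.Icc 1 S.q, T₂ * ξ + α < S.d j ^ 2 * gL (g j))
    (hgR : ∀ j ∈ Finset.Icc 1 S.q, T₂ * ξ + α < S.d j ^ 2 * gR (g j))
    (hstep : LocAlgStep n (fun t => S.mean t + e t) ξ gL gR h st st') :
    LocInvariant S α K Cand g st' := by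
  classical
  obtain ⟨x, hx, -, cL, cR, hcL, hcR, D, hD, Ahat, hout, hst1, hst2⟩ := hstep
  have P : PruneEnv S α K Cand g st.2 st.1 D cL cR := hD ▸ I.pruneEnv H tun hx hcL hcR
  have hxD : x ∈ D := by
    rw [hD, Finset.mem_filter]
    exact ⟨hx, hcL.1.1, hcR.1.1⟩
  have hDC : D ⊆ st.2 := hD ▸ Finset.filter_subset _ _
  obtain ⟨J, hJ, c, hA, hcJ, hcov⟩ := P.isPrunAlgOutput_spec H tun hout
  obtain ⟨hα, hαK, s1, s2, s3, s4, s5, s6, s7⟩ := PruneEnv.scales H tun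
  have memA : ∀ a ∈ Ahat, ∃ i ∈ J, a = c i := fun a ha => by
    rw [hA, Finset.mem_image] at ha
    obtain ⟨i, hi, rfl⟩ := ha
    exact ⟨i, hi, rfl⟩
  have hAD : Ahat ⊆ D := fun a ha => by
    obtain ⟨i, hi, rfl⟩ := memA a ha
    exact (hcJ i hi).1
  have eqc : ∀ {i j y : ℕ}, i ∈ Finset.Icc 1 S.q → j ∈ Finset.Icc 1 S.q →
      scaledError S y i ≤ T₂ * ξ → scaledError S y j ≤ T₂ * ξ → i = j := fun hi hj h1 h2 =>
    H.eq_of_close tun.T_mul_η hi hj (h1.trans s7) (h2.trans s7)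
  refine ⟨?_, ?_, ?_, ?_, ?_, ?_⟩
  · rw [hst1]
    exact Finset.union_subset I.accepted_subset (hAD.trans P.D_subset)
  · rw [hst2]
    exact Finset.sdiff_subset.trans I.active_subset
  · rw [hst1, hst2, Finset.disjoint_left]
    intro a ha ha'
    rw [Finset.mem_sdiff] at ha'
    rcases Finset.mem_union.1 ha with ha | ha
    · exact Finset.disjoint_left.1 I.disjoint ha ha'.1
    · refine ha'.2 (Finset.mem_insert_of_mem (Finset.mem_filter.2 ⟨hAD ha, Or.inl ?_⟩))
      exact ⟨⟨a, ha, le_rfl⟩, a, ha, le_rfl⟩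
  · rw [hst1]
    intro a ha
    rcases Finset.mem_union.1 ha with ha | ha
    · exact I.close a ha
    · obtain ⟨i, hi, rfl⟩ := memA a ha
      exact ⟨i, hJ hi, (hcJ i hi).2.2⟩
  · rw [hst1]
    have new : ∀ j ∈ Finset.Icc 1 S.q, ∀ a ∈ Ahat, scaledError S a j ≤ K * α →
        j ∈ J ∧ a = c j := fun j hj a ha haj => by
      obtain ⟨i, hi, rfl⟩ := memA a ha
      have := eqc (hJ hi) hj ((hcJ i hi).2.2.trans (by linarith)) (haj.trans (by linarith))
      exact ⟨this ▸ hi, this ▸ rfl⟩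
    have old : ∀ j ∈ J, ∀ a ∈ st.1, ¬ scaledError S a j ≤ K * α := fun j hj a ha haj =>
      (hcJ j hj).2.1 ⟨a, Finset.mem_union_left _ ha, haj.trans (s1.trans s3)⟩
    intro j hj a ha b hb haj hbj
    rcases Finset.mem_union.1 ha with ha | ha <;> rcases Finset.mem_union.1 hb with hb | hb
    · exact I.unique j hj a ha b hb haj hbj
    · exact absurd haj (old j (new j hj b hb hbj).1 a ha)
    · exact absurd hbj (old j (new j hj a ha haj).1 b hb)
    · rw [(new j hj a ha haj).2, (new j hj b hb hbj).2]
  · intro j hj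
    rw [hst1, hst2]
    by_cases hK : Covers S st.1 (K * α) j
    · exact Or.inl (hK.mono Finset.subset_union_left le_rfl)
    have hgC := (I.reached j hj).resolve_left hK
    by_cases hjJ : j ∈ J
    · exact Or.inl ⟨c j, Finset.mem_union_right _ (hA ▸ Finset.mem_image_of_mem c hjJ),
        (hcJ j hjJ).2.2⟩
    right
    rw [Finset.mem_sdiff]
    refine ⟨hgC, fun hdec => ?_⟩
    have hgD : g j ∈ D := by
      rcases Finset.mem_insert.1 hdec with hdec | hdec
      · exact hdec ▸ hxD
      · exact (Finset.mem_filter.1 hdec).1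
    have hgj : scaledError S (g j) j ≤ T₂ * ξ := (H.g_close j hj).trans (by linarith)
    -- An accepted candidate near `j` would have to represent `j`.
    have hnear : ∀ y ∈ st.1, ¬ scaledError S y j ≤ T₂ * ξ := fun y hy hyj => by
      obtain ⟨i, hi, hyi⟩ := I.close y hy
      have := eqc hi hj (hyi.trans (by linarith)) hyj
      exact hK ⟨y, hy, this ▸ hyi⟩
    have hAnear : ∀ a ∈ Ahat, ¬ scaledError S a j ≤ T₂ * ξ := fun a ha haj => by
      obtain ⟨i, hi, rfl⟩ := memA a ha
      have := eqc (hJ hi) hj ((hcJ i hi).2.2.trans (by linarith)) haj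
      exact hjJ (this ▸ hi)
    rcases P.close_boundary hgD hgj (hcov j hj hjJ) with hcl | hcl
    · have hcLK : cL ∉ st.1 := fun hc => hnear cL hc hcl
      have hcL0 : cL ≠ 0 := (H.pos_of_close tun.T_mul_η hj (hcl.trans s7)).ne'
      have hfar := ((hcL.1.2.resolve_left hcLK).resolve_left hcL0).2
      have hAlt : ∀ a ∈ Ahat, ¬ a ≤ g j := fun a ha hag =>
        hAnear a ha (scaledError_between (P.mem_D a (hAD ha)).1.le hag hcl hgj)
      rcases Finset.mem_insert.1 hdec with hdec | hdec
      · have h1 := sq_mul_le_scaledError_add (S := S) (x := cL) (m := gL x) (y := x) (j := j)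
          (by omega)
        rw [← hdec] at h1
        linarith [hgL j hj, H.g_close j hj]
      · rcases (Finset.mem_filter.1 hdec).2 with ⟨⟨a, ha, hag⟩, -⟩ | ⟨hc, -⟩ | ⟨-, ⟨a, ha⟩, hc⟩
        · exact hAlt a ha hag
        · exact hc.elim hcLK hcL0
        · exact hAlt a ha (hc a ha).le
    · have hcRK : cR ∉ st.1 := fun hc => hnear cR hc hcl
      have hcRn : cR ≠ n := (H.lt_n_of_close tun.T_mul_η hj (hcl.trans s7)).ne
      have hfar := ((hcR.1.2.resolve_left hcRK).resolve_left hcRn).2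
      have hAlt : ∀ a ∈ Ahat, ¬ g j ≤ a := fun a ha hag =>
        hAnear a ha (scaledError_between hag (P.mem_D a (hAD ha)).2.le hgj hcl)
      rcases Finset.mem_insert.1 hdec with hdec | hdec
      · have h1 := sq_mul_le_scaledError_add (S := S) (x := x) (m := gR x) (y := cR) (j := j)
          (by omega)
        rw [← hdec] at h1
        linarith [hgR j hj, H.g_close j hj]
      · rcases (Finset.mem_filter.1 hdec).2 with ⟨-, b, hb, hbg⟩ | ⟨-, ⟨a, ha⟩, hc⟩ | ⟨hc, -⟩
        · exact hAlt b hb hbg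
        · exact hAlt a ha (hc a ha).le
        · exact hc.elim hcRK hcRn

lemma initial (H : GoodSample n S e ξ α η c₀ C₀ T Cand g) :
    LocInvariant S α K Cand g (∅, Cand) where
  accepted_subset := Finset.empty_subset _
  active_subset := subset_rfl
  disjoint := Finset.disjoint_empty_left _
  close := by simp
  unique := by simp
  reached j hj := Or.inr (H.g_mem j hj)

/-- When no candidate is active any more, the accepted candidates represent the change points
bijectively and in their order. -/
lemma card_eq_and_nthEstimator {Khat : Finset ℕ} (I : LocInvariant S α K Cand g (Khat, ∅))
    (H : GoodSample n S e ξ α η c₀ C₀ T Cand g) (tun : Tuning c₀ C₀ K T T₁ T₂ τ σ M lam η) :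
    Khat.card = S.q ∧
      ∀ j ∈ Finset.Icc 1 S.q, scaledError S (nthEstimator Khat j) j ≤ K * α := by
  obtain ⟨hα, hαK, s1, s2, s3, s4, s5, s6, s7⟩ := PruneEnv.scales H tun
  have hKT : K * α ≤ T * ξ := by linarith
  have hex : ∀ i : Fin S.q, ∃ a ∈ Khat, scaledError S a (i + 1) ≤ K * α := fun i =>
    (I.reached (i + 1) (Finset.mem_Icc.2 ⟨by omega, by omega⟩)).resolve_right (by simp)
  choose f hf hfe using hex
  have hmono : StrictMono f := fun i i' hii' =>
    H.lt_of_close tun.T_mul_η (Finset.mem_Icc.2 ⟨by omega, by omega⟩)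
      (Finset.mem_Icc.2 ⟨by omega, by omega⟩) (Nat.succ_lt_succ hii')
      ((hfe i).trans hKT) ((hfe i').trans hKT)
  have himage : Finset.univ.image f = Khat := by
    ext a
    rw [Finset.mem_image]
    constructor
    · rintro ⟨i, -, rfl⟩
      exact hf i
    · intro ha
      obtain ⟨j, hj, haj⟩ := I.close a ha
      have hj' := Finset.mem_Icc.1 hj
      refine ⟨⟨j - 1, by omega⟩, Finset.mem_univ _, ?_⟩
      refine I.unique j hj _ (hf _) a ha ?_ haj
      have := hfe ⟨j - 1, by omega⟩
      rwa [show ((⟨j - 1, by omega⟩ : Fin S.q) : ℕ) + 1 = j by simp; omega] at this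
  have hcard : Khat.card = S.q := by
    rw [← himage, Finset.card_image_of_injective _ hmono.injective, Finset.card_univ,
      Fintype.card_fin]
  refine ⟨hcard, fun j hj => ?_⟩
  have hj' := Finset.mem_Icc.1 hj
  have hemb := Finset.orderEmbOfFin_unique hcard hf hmono
  have h1 := congrFun hemb ⟨j - 1, by omega⟩
  rw [Finset.orderEmbOfFin_apply] at h1
  have h2 : nthEstimator Khat j = f ⟨j - 1, by omega⟩ := by
    unfold nthEstimator
    rw [h1]
    exact List.getD_eq_getElem _ _ _
  have h3 := hfe ⟨j - 1, by omega⟩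
  rw [show ((⟨j - 1, by omega⟩ : Fin S.q) : ℕ) + 1 = j by simp; omega] at h3
  rwa [h2]

end LocInvariant

/-- The inner algorithm always has an output: `D` itself trivially has the monotonicity property. -/
lemma exists_isPrunAlgOutput (D : Finset ℕ) (sc : Finset ℕ → ℝ) : ∃ A, IsPrunAlgOutput D sc A := by
  classical
  have hD : MonotoneAbove D sc D := ⟨subset_rfl, fun B h1 _ c hc => by
    rw [Finset.mem_sdiff] at hc
    exact absurd (h1 hc.1) hc.2⟩
  obtain ⟨B, hB, hBc⟩ := exists_card_eq_minCard hD
  have hsub : ∀ A, SearchFamily D sc A → A ∈ D.powerset := fun A ⟨A', h1, _, _, h2⟩ =>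
    Finset.mem_powerset.2 (h2.1.trans h1.1)
  set F := D.powerset.filter (SearchFamily D sc) with hF
  have hmem : ∀ A, A ∈ F ↔ SearchFamily D sc A := fun A => by
    rw [hF, Finset.mem_filter]
    exact ⟨fun h => h.2, fun h => ⟨hsub A h, h⟩⟩
  have hne : F.Nonempty := ⟨B, (hmem B).2 (hB.searchFamily (by omega) (InnerSubset.refl B))⟩
  obtain ⟨A₀, hA₀, hmin⟩ := Finset.exists_min_image F sc hne
  obtain ⟨A, hA, hAmin⟩ := Finset.exists_min_image (F.filter fun A => sc A = sc A₀)
    Finset.card ⟨A₀, Finset.mem_filter.2 ⟨hA₀, rfl⟩⟩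
  rw [Finset.mem_filter] at hA
  refine ⟨A, (hmem A).1 hA.1, fun A' hA' => hA.2 ▸ hmin A' ((hmem A').2 hA'), fun A' hA' heq => ?_⟩
  exact hAmin A' (Finset.mem_filter.2 ⟨(hmem A').2 hA', heq.trans hA.2⟩)

/-- The outer algorithm always has an output, since every iteration decides about at least one
candidate. -/
lemma exists_reflTransGen_locAlgStep (n : ℕ) (x : ℕ → ℝ) (ξ : ℝ) (gL gR : ℕ → ℕ) (h : ℕ → ℝ)
    (C Khat : Finset ℕ) (hC : C ⊆ Finset.Ioo 0 n) :
    ∃ K', Relation.ReflTransGen (LocAlgStep n x ξ gL gR h) (Khat, C) (K', ∅) := by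
  classical
  induction hm : C.card using Nat.strong_induction_on generalizing C Khat with
  | _ m ih =>
    rcases C.eq_empty_or_nonempty with rfl | hne
    · exact ⟨Khat, Relation.ReflTransGen.refl⟩
    obtain ⟨y, hy, hymax⟩ := Finset.exists_max_image C h hne
    have hyn := Finset.mem_Ioo.1 (hC hy)
    obtain ⟨cL, hcL⟩ : ∃ cL, IsGreatest {c | LeftBoundary gL gR C Khat y c} cL :=
      BddAbove.exists_isGreatest_of_nonempty ⟨y, fun c hc => hc.1.le⟩
        ⟨0, hyn.1, Or.inr (Or.inl rfl)⟩
    obtain ⟨cR, hcR⟩ : ∃ cR, IsLeast {c | RightBoundary n gL gR C Khat y c} cR :=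
      BddBelow.exists_isLeast_of_nonempty ⟨y, fun c hc => hc.1.le⟩
        ⟨n, hyn.2, Or.inr (Or.inl rfl)⟩
    set D := C.filter fun c => cL < c ∧ c < cR with hD
    obtain ⟨A, hA⟩ := exists_isPrunAlgOutput D (SC n x ξ D C Khat)
    obtain ⟨K', hK'⟩ := ih (C \ decided n Khat D A y cL cR).card
      (hm ▸ Finset.card_lt_card (Finset.ssubset_iff_subset_ne.2 ⟨Finset.sdiff_subset, fun heq =>
        (Finset.mem_sdiff.1 (heq ▸ hy)).2 (Finset.mem_insert_self _ _)⟩))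
      (C \ decided n Khat D A y cL cR) (Khat ∪ A) (Finset.sdiff_subset.trans hC) rfl
    exact ⟨K', Relation.ReflTransGen.head
      ⟨y, hy, hymax, cL, cR, hcL, hcR, D, hD, A, hA, rfl, rfl⟩ hK'⟩

/-- On a good sample with sufficiently long detection intervals, every output of the outer algorithm
is consistent. -/
lemma GoodSample.isLocAlgOutput_spec {n : ℕ} {S : MeanModel} {e : ℕ → ℝ}
    {ξ α η c₀ C₀ T T₁ T₂ τ σ M lam K : ℝ} {Cand : Finset ℕ} {g : ℕ → ℕ} {gL gR : ℕ → ℕ}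
    {h : ℕ → ℝ} (H : GoodSample n S e ξ α η c₀ C₀ T Cand g)
    (tun : Tuning c₀ C₀ K T T₁ T₂ τ σ M lam η)
    (hgL : ∀ j ∈ Finset.Icc 1 S.q, T₂ * ξ + α < S.d j ^ 2 * gL (g j))
    (hgR : ∀ j ∈ Finset.Icc 1 S.q, T₂ * ξ + α < S.d j ^ 2 * gR (g j)) {Khat : Finset ℕ}
    (hout : IsLocAlgOutput n (fun t => S.mean t + e t) ξ gL gR h Cand Khat) :
    Khat.card = S.q ∧
      ∀ j ∈ Finset.Icc 1 S.q, scaledError S (nthEstimator Khat j) j ≤ K * α := by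
  have key : ∀ st, Relation.ReflTransGen
      (LocAlgStep n (fun t => S.mean t + e t) ξ gL gR h) (∅, Cand) st →
      LocInvariant S α K Cand g st := fun st hst => by
    induction hst with
    | refl => exact LocInvariant.initial H
    | tail _ hstep ih => exact ih.step H tun hgL hgR hstep
  exact (key _ hout).card_eq_and_nthEstimator H tun

/-! ### Samples on which the assumed events occur -/

lemma sq_sum_le_of_event11 {Ω : Type*} {ε : ℕ → Ω → ℝ} {w : ℝ} {n : ℕ} {ω : Ω}
    (h : ω ∈ event11 ε w n) {s t : ℕ} (hst : s < t) (ht : t ≤ n) :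
    (∑ i ∈ Finset.Ioc s t, ε i ω) ^ 2 ≤ w ^ 2 * ((t : ℝ) - s) := by
  have hst' : (0 : ℝ) < (t : ℝ) - s := by
    rw [sub_pos]
    exact_mod_cast hst
  have h1 := h s t hst ht
  have hs : 0 < √((t : ℝ) - s) := Real.sqrt_pos.2 hst'
  rw [one_div, inv_mul_le_iff₀ hs] at h1
  have h2 := pow_le_pow_left₀ (abs_nonneg _) h1 2
  rw [sq_abs, mul_pow, Real.sq_sqrt hst'.le] at h2
  linarith

lemma sqrt_div_sq {α d : ℝ} (hα : 0 ≤ α) : √(α / d ^ 2) = √α / |d| := by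
  rw [Real.sqrt_div hα, Real.sqrt_sq_eq_abs]

lemma abs_mul_le_of_far {α d l s w η : ℝ} (hα : 0 < α) (hd : d ≠ 0) (hl : 0 < l)
    (h : √(α / d ^ 2) / l * s ≤ w) (hw : w ≤ η * √α) : |d| * s ≤ η * (d ^ 2 * l) := by
  rw [sqrt_div_sq hα.le] at h
  have hd' := abs_pos.2 hd
  have hs := Real.sqrt_pos.2 hα
  have h1 : √α * s ≤ η * √α * (|d| * l) := by
    rw [div_div, div_mul_eq_mul_div, div_le_iff₀ (by positivity)] at h
    exact h.trans (by gcongr)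
  have h2 : s ≤ η * (|d| * l) := by
    refine le_of_mul_le_mul_left ?_ hs
    linarith
  rw [← sq_abs d]
  calc |d| * s ≤ |d| * (η * (|d| * l)) := by gcongr
    _ = η * (|d| ^ 2 * l) := by ring

lemma abs_mul_le_of_near {α d s w η : ℝ} (hα : 0 < α) (hd : d ≠ 0)
    (h : 1 / √(α / d ^ 2) * s ≤ w) (hw : w ≤ η * √α) : |d| * s ≤ η * α := by
  rw [sqrt_div_sq hα.le] at h
  have hd' := abs_pos.2 hd
  have hs := Real.sqrt_pos.2 hα
  rw [one_div_div, div_mul_eq_mul_div, div_le_iff₀ hs] at h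
  calc |d| * s ≤ w * √α := h
    _ ≤ η * √α * √α := by gcongr
    _ = η * α := by rw [mul_assoc, Real.mul_self_sqrt hα.le]

/-- Far from a change point the event `M^(12)` controls the noise, near to it `M^(13)` does. -/
lemma localNoise_of_events {Ω : Type*} {ε : ℕ → Ω → ℝ} {S : MeanModel} {n : ℕ} {ω : Ω}
    {w₁ w₂ α η : ℝ} (hv : S.IsValid n) (hα : 0 < α) (hη : 0 ≤ η) (hw₁ : w₁ ≤ η * √α)
    (hw₂ : w₂ ≤ η * √α) (h₁ : ω ∈ event12 ε S w₁ α) (h₂ : ω ∈ event13 ε S w₂ α) :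
    LocalNoise S (fun t => ε t ω) α η := by
  intro j hj c hc1 hc2
  have hd := hv.d_ne_zero hj
  have hpos : 0 ≤ η * max (scaledError S c j) α := mul_nonneg hη (hα.le.trans (le_max_right _ _))
  have key : ∀ (l : ℕ) (s : ℝ), 1 ≤ l → scaledError S c j = S.d j ^ 2 * l →
      (α / S.d j ^ 2 ≤ l → √(α / S.d j ^ 2) / l * s ≤ w₁) →
      ((l : ℝ) ≤ α / S.d j ^ 2 → 1 / √(α / S.d j ^ 2) * s ≤ w₂) →
      |S.d j| * s ≤ η * max (scaledError S c j) α := by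
    intro l s hl hsc hfar hnear
    have hl' : (0 : ℝ) < l := by exact_mod_cast hl
    rcases le_total (α / S.d j ^ 2) (l : ℝ) with h | h
    · refine (abs_mul_le_of_far hα hd hl' (hfar h) hw₁).trans ?_
      rw [← hsc]
      gcongr
      exact le_max_left _ _
    · refine (abs_mul_le_of_near hα hd (hnear h) hw₂).trans ?_
      gcongr
      exact le_max_right _ _
  rcases lt_trichotomy c (S.cp j) with hlt | rfl | hlt
  · refine ⟨?_, by simpa [Finset.Ioc_eq_empty_of_le hlt.le] using hpos⟩
    obtain ⟨l, hl⟩ := Nat.exists_eq_add_of_le hlt.le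
    have hcl : S.cp j - l = c := by omega
    refine key l _ (by omega) ?_ (fun h => ?_) (fun h => ?_)
    · unfold scaledError
      rw [hl]
      push_cast
      rw [sub_add_cancel_left, abs_neg, abs_of_nonneg (Nat.cast_nonneg l)]
    · rw [← hcl]
      exact (h₁ j hj l h).1 (by omega)
    · rw [← hcl]
      exact (h₂ j hj l (by omega) h).1
  · constructor <;> simpa using hpos
  · refine ⟨by simpa [Finset.Ioc_eq_empty_of_le hlt.le] using hpos, ?_⟩
    obtain ⟨l, rfl⟩ := Nat.exists_eq_add_of_le hlt.le
    refine key l _ (by omega) ?_ (fun h => ?_) (fun h => ?_)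
    · unfold scaledError
      push_cast
      rw [add_sub_cancel_left, abs_of_nonneg (Nat.cast_nonneg l)]
    · exact (h₁ j hj l h).2 (by omega)
    · exact (h₂ j hj l (by omega) h).2

lemma isLocAlgOutput_empty {n : ℕ} {x : ℕ → ℝ} {ξ : ℝ} {gL gR : ℕ → ℕ} {h : ℕ → ℝ}
    {Khat : Finset ℕ} (hout : IsLocAlgOutput n x ξ gL gR h ∅ Khat) : Khat = ∅ := by
  rcases Relation.ReflTransGen.cases_head hout with heq | ⟨st, ⟨c, hc, -⟩, -⟩
  · exact (Prod.mk.inj heq).1.symm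
  · exact absurd hc (Finset.notMem_empty c)

/-- The deterministic core of the theorem. The constants `c₁ / 4` and `18 B² + 2 c₂` for the
residual sums of squares come from the bounds for the energy `∑ ε_t²` of the noise. -/
lemma mem_consistencyEvent {Ω : Type*} {ε : ℕ → Ω → ℝ} {S : MeanModel} {n : ℕ} {ω : Ω}
    {w w₁ w₂ ξ α η c₁ c₂ B K T T₁ T₂ τ σ M lam κ r : ℝ} {C : Ω → Finset ℕ}
    {gL gR : Ω → ℕ → ℕ} {h : Ω → ℕ → ℝ}
    (tun : Tuning (c₁ / 4) (18 * B ^ 2 + 2 * c₂) K T T₁ T₂ τ σ M lam η)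
    (hn : 0 < n) (hv : S.IsValid n) (hξ : 0 < ξ) (hα : 0 < α) (hw : w ^ 2 ≤ η * ξ)
    (hαξ : α ≤ η * ξ) (hξD : ∀ j ∈ Finset.Icc 1 S.q, ξ ≤ η * (S.d j ^ 2 * S.delta j))
    (hw₁ : w₁ ≤ η * √α) (hw₂ : w₂ ≤ η * √α) (hB0 : 0 ≤ B)
    (hB : ∀ j ∈ Finset.Icc 1 S.q, |S.d j| ≤ B) (hC : C ω ⊆ Finset.Ioo 0 n)
    (h11 : ω ∈ event11 ε w n) (h12 : ω ∈ event12 ε S w₁ α) (h13 : ω ∈ event13 ε S w₂ α)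
    (hlow : c₁ / 2 * n ≤ ∑ t ∈ Finset.Ioc 0 n, ε t ω ^ 2)
    (hupp : ∑ t ∈ Finset.Ioc 0 n, ε t ω ^ 2 ≤ c₂ * n)
    (hQ : w ^ 2 * (C ω).card / n ≤ c₁ / 12) (hκ : κ * (T₂ + η) < 1)
    (hdet : ∀ j ∈ Finset.Icc 1 S.q, ∃ c ∈ C ω, scaledError S c j ≤ α ∧
      ξ ≤ κ * (S.d j ^ 2 * (min (gL ω c) (gR ω c) : ℕ))) (hr : K * α ≤ r) :
    ω ∈ consistencyEvent n ε S ξ C gL gR h r := by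
  classical
  refine ⟨exists_reflTransGen_locAlgStep n _ ξ _ _ _ _ _ hC, fun Khat hout => ?_⟩
  have hn' : (0 : ℝ) < n := by exact_mod_cast hn
  have hη := tun.η_pos
  have hT₂ : 0 < T₂ := by linarith [tun.σ_pos, tun.two_σ_le, tun.τ_le_T₁, tun.T₁_le_T₂]
  choose! g hgC hgα hgG using hdet
  have R : RegularSample n S (fun t => ε t ω) ξ α η :=
    { valid := hv
      ξ_pos := hξ
      α_pos := hα
      η_pos := hη
      noise := fun s t hst ht => (sq_sum_le_of_event11 h11 hst ht).trans (by
        have : (0 : ℝ) ≤ (t : ℝ) - s := by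
          rw [sub_nonneg]
          exact_mod_cast hst.le
        gcongr)
      α_le := hαξ
      ξ_le := hξD }
  have hαT : α ≤ T * ξ := by
    refine hαξ.trans ?_
    gcongr
    have := tun.K_mul_η
    have := tun.one_lt_K
    nlinarith [tun.two_σ_le, tun.τ_le_T₁, tun.T₁_le_T₂, tun.T₂_le_T, tun.σ_pos]
  have hqQ : S.q ≤ (C ω).card := by
    have := Finset.card_le_card_of_injOn (s := Finset.Icc 1 S.q) (t := C ω) g hgC
      fun i hi j hj hij => R.eq_of_close tun.T_mul_η hi hj ((hgα i hi).trans hαT)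
        (hij ▸ (hgα j hj).trans hαT)
    simpa using this
  -- For an empty candidate set `hQ` is void, but then there is no change point to be found.
  rcases (C ω).eq_empty_or_nonempty with hemp | hne
  · have hq : S.q = 0 := by simpa [hemp] using hqQ
    unfold IsLocAlgOutput at hout
    rw [hemp] at hout
    rw [isLocAlgOutput_empty hout, hq]
    simp
  have G : GoodSample n S (fun t => ε t ω) ξ α η (c₁ / 4) (18 * B ^ 2 + 2 * c₂) T (C ω) g :=
    { R with
      n_pos := hn
      local_noise := localNoise_of_events hv hα hη.le hw₁ hw₂ h12 h13
      cand_subset := hC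
      le_rss := fun A hA => by
        refine le_trans ?_ (hv.le_RSS hn (sq_nonneg w)
          (fun s t => sq_sum_le_of_event11 h11) (hA.trans hC))
        -- At most `3 |C|` noise terms of size `w²`: one for each break point or change point.
        have h1 : (1 + A.card + S.q : ℝ) ≤ 3 * (C ω).card := by
          have := Finset.card_le_card hA
          have := hne.card_pos
          exact_mod_cast (by omega : 1 + A.card + S.q ≤ 3 * (C ω).card)
        have h2 := mul_le_mul_of_nonneg_right h1 (sq_nonneg w)
        rw [div_le_iff₀ hn'] at hQ
        linarith
      rss_le := fun A hA j hcov => by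
        refine (R.RSS_le hn tun.T_mul_η hB hB0 (hA.trans hC) hcov).trans ?_
        linarith
      g_mem := hgC
      g_close := hgα }
  have hG : ∀ j ∈ Finset.Icc 1 S.q, ∀ m : ℕ, min (gL ω (g j)) (gR ω (g j)) ≤ m →
      T₂ * ξ + α < S.d j ^ 2 * m := fun j hj m hm => by
    have h1 := hgG j hj
    have h2 : S.d j ^ 2 * (min (gL ω (g j)) (gR ω (g j)) : ℕ) ≤ S.d j ^ 2 * m := by
      gcongr
    refine lt_of_lt_of_le ?_ h2
    set Y := S.d j ^ 2 * ((min (gL ω (g j)) (gR ω (g j)) : ℕ) : ℝ) with hY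
    have hY0 : 0 ≤ Y := by positivity
    have hY1 : 0 < Y := lt_of_le_of_ne hY0 fun h0 => by
      rw [← h0] at h1
      linarith
    calc T₂ * ξ + α ≤ (T₂ + η) * ξ := by linarith
      _ ≤ (T₂ + η) * (κ * Y) := by gcongr
      _ = κ * (T₂ + η) * Y := by ring
      _ < Y := by nlinarith
  obtain ⟨hcard, hclose⟩ := G.isLocAlgOutput_spec tun
    (fun j hj => hG j hj _ (min_le_left _ _)) (fun j hj => hG j hj _ (min_le_right _ _)) hout
  exact ⟨hcard, fun j hj => (hclose j hj).trans hr⟩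

/-! ### Probabilities -/

section Probability

variable {Ω : Type*} [MeasurableSpace Ω] {μ : Measure Ω}

lemma WithProbTendingToOne.inter {E F : ℕ → Set Ω} (hE : WithProbTendingToOne μ E)
    (hF : WithProbTendingToOne μ F) : WithProbTendingToOne μ fun n => E n ∩ F n := by
  unfold WithProbTendingToOne at *
  have h := hE.add hF
  rw [add_zero] at h
  refine tendsto_of_tendsto_of_tendsto_of_le_of_le tendsto_const_nhds h (fun _ => zero_le)
    fun n => ?_
  rw [Set.compl_inter]
  exact measure_union_le _ _

lemma WithProbTendingToOne.mono {E F : ℕ → Set Ω} (hE : WithProbTendingToOne μ E)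
    (h : ∀ᶠ n in atTop, E n ⊆ F n) : WithProbTendingToOne μ F :=
  tendsto_of_tendsto_of_tendsto_of_le_of_le' tendsto_const_nhds hE
    (Eventually.of_forall fun _ => zero_le)
    (h.mono fun _ hn => measure_mono (Set.compl_subset_compl.2 hn))

lemma withProbTendingToOne_abs_lt {f : ℕ → Ω → ℝ}
    (h : TendstoInMeasure μ f atTop fun _ => 0) {r : ℝ} (hr : 0 < r) :
    WithProbTendingToOne μ fun n => {ω | |f n ω| < r} := by
  have h1 := tendstoInMeasure_iff_norm.1 h r hr
  unfold WithProbTendingToOne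
  refine h1.congr fun n => ?_
  congr 1
  ext ω
  simp

/-- The law of large numbers for the squares, a special case of ergodicity. -/
lemma ErrorAssumption.energy [IsProbabilityMeasure μ] {ε : ℕ → Ω → ℝ} {S : ℕ → MeanModel}
    {w w₁ w₂ : ℕ → ℝ} (h : ErrorAssumption μ ε S w w₁ w₂) {c₁ c₂ : ℝ} (hc₁ : 0 < c₁)
    (hvar : ∀ t, 1 ≤ t → c₁ ≤ variance (ε t) μ ∧ variance (ε t) μ ≤ c₂) :
    WithProbTendingToOne μ fun n => {ω | c₁ / 2 * n ≤ ∑ t ∈ Finset.Ioc 0 n, ε t ω ^ 2 ∧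
      ∑ t ∈ Finset.Ioc 0 n, ε t ω ^ 2 ≤ (c₂ + 1) * n} := by
  have h1 := h.ergodic 1 (fun x => x 0 ^ 2) (by fun_prop)
    ⟨1, fun x => by
      rw [Fin.sum_univ_one, abs_of_nonneg (sq_nonneg _)]
      linarith⟩
  have h2 := (withProbTendingToOne_abs_lt h1 (by positivity : 0 < min (c₁ / 2) 1))
  refine h2.mono ((eventually_ge_atTop 1).mono fun n hn ω hω => ?_)
  have hn' : (0 : ℝ) < n := by exact_mod_cast hn
  have hω' : |(∑ t ∈ Finset.Ioc 0 n, (ε t ω ^ 2 - ∫ ω', ε t ω' ^ 2 ∂μ)) / (n : ℝ)| <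
      min (c₁ / 2) 1 := by
    simpa [show Finset.Icc 1 n = Finset.Ioc 0 n from rfl] using hω
  have hint : ∀ t ∈ Finset.Ioc 0 n, ∫ ω', ε t ω' ^ 2 ∂μ = variance (ε t) μ := fun t ht =>
    have ht' : 1 ≤ t := (Finset.mem_Ioc.1 ht).1
    (variance_of_integral_eq_zero (h.square_integrable t ht').1.aemeasurable (h.centred t ht')).symm
  rw [abs_div, abs_of_pos hn', div_lt_iff₀ hn', Finset.sum_sub_distrib, Finset.sum_congr rfl hint,
    abs_lt] at hω'
  have hlo : c₁ * n ≤ ∑ t ∈ Finset.Ioc 0 n, variance (ε t) μ := by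
    have := Finset.card_nsmul_le_sum (Finset.Ioc 0 n) (fun t => variance (ε t) μ) c₁
      fun t ht => (hvar t (Finset.mem_Ioc.1 ht).1).1
    simpa [mul_comm] using this
  have hup : ∑ t ∈ Finset.Ioc 0 n, variance (ε t) μ ≤ c₂ * n := by
    have := Finset.sum_le_card_nsmul (Finset.Ioc 0 n) (fun t => variance (ε t) μ) c₂
      fun t ht => (hvar t (Finset.mem_Ioc.1 ht).1).2
    simpa [mul_comm] using this
  have m1 : min (c₁ / 2) 1 * (n : ℝ) ≤ c₁ / 2 * n := by
    gcongr
    exact min_le_left _ _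
  have m2 : min (c₁ / 2) 1 * (n : ℝ) ≤ 1 * n := by
    gcongr
    exact min_le_right _ _
  constructor <;> linarith [hω'.1, hω'.2]

end Probability

lemma MeanModel.IsValid.delta_pos {S : MeanModel} {n j : ℕ} (h : S.IsValid n)
    (hj : j ∈ Finset.Icc 1 S.q) : 0 < S.delta j := by
  rw [Finset.mem_Icc] at hj
  have h1 := h.cp_lt (i := j - 1) (j := j) (by omega) (by omega)
  have h2 := h.cp_lt (i := j) (j := j + 1) (by omega) (by omega)
  unfold MeanModel.delta
  omega

lemma PenaltyAssumption.eventually_le {S : ℕ → MeanModel} {w ξ : ℕ → ℝ}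
    (h : PenaltyAssumption S w ξ) (hS : SignalAssumption S) {η : ℝ} (hη : 0 < η) :
    ∀ᶠ n in atTop, ∀ j ∈ Finset.Icc 1 (S n).q,
      ξ n ≤ η * ((S n).d j ^ 2 * (S n).delta j) := by
  filter_upwards [h.penalty_small.eventually_le_const (ENNReal.ofReal_pos.2 hη),
    eventually_ge_atTop 1] with n hn hn1 j hj
  have hd := (hS.valid n hn1).d_ne_zero hj
  have hδ : (0 : ℝ) < (S n).delta j := by exact_mod_cast (hS.valid n hn1).delta_pos hj
  have hpos : 0 < (S n).d j ^ 2 * (S n).delta j := by positivity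
  have h1 : (S n).D ≤ ENNReal.ofReal ((S n).d j ^ 2 * (S n).delta j) := iInf₂_le j hj
  have h2 := (ENNReal.div_le_div_left h1 (ENNReal.ofReal (ξ n))).trans hn
  rw [← ENNReal.ofReal_div_of_pos hpos, ENNReal.ofReal_le_ofReal_iff hη.le,
    div_le_iff₀ hpos] at h2
  exact h2

/-- With probability tending to one, the algorithm has an output and all outputs are consistent. -/
lemma withProbTendingToOne_consistencyEvent {Ω : Type*} [MeasurableSpace Ω] {μ : Measure Ω}
    [IsProbabilityMeasure μ] {ε : ℕ → Ω → ℝ} {S : ℕ → MeanModel} {w w₁ w₂ ξ ρ ν ν' : ℕ → ℝ}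
    {C : ℕ → Ω → Finset ℕ} {gL gR : ℕ → Ω → ℕ → ℕ} {h : ℕ → Ω → ℕ → ℝ} {K : ℝ}
    (hsignal : SignalAssumption S) (herror : ErrorAssumption μ ε S w w₁ w₂)
    (hpenalty : PenaltyAssumption S w ξ) (hcand : CandidateAssumption μ S w w₁ w₂ ρ C)
    (hν : SlowRate ρ ξ ν) (hdet : DetectionIntervalAssumption μ S ξ ρ ν C gL gR)
    (hK : 1 < K) (hν' : ∀ᶠ n in atTop, K * ν n ≤ ν' n) :
    WithProbTendingToOne μ (fun n =>
      consistencyEvent n ε (S n) (ξ n) (C n) (gL n) (gR n) (h n) (ρ n * ν' n)) := by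
  obtain ⟨B, hB⟩ := hsignal.jumps_bounded
  obtain ⟨c₁, c₂, hc₁, hvar⟩ := herror.variance_bounds
  have hc₂ : c₁ ≤ c₂ := (hvar 1 le_rfl).1.trans (hvar 1 le_rfl).2
  obtain ⟨κ, hκ, hdet⟩ := hdet
  obtain ⟨T, T₁, T₂, τ, σ, M, lam, htun⟩ := exists_tuning (c₀ := c₁ / 4)
    (C₀ := 18 * |B| ^ 2 + 2 * (c₂ + 1)) (by positivity)
    (by have := sq_nonneg |B|; linarith) hK
  obtain ⟨η, tun, hη1⟩ := (htun.and (eventually_nhdsWithin_of_eventually_nhds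
    (eventually_lt_nhds (zero_lt_one' ℝ)))).exists
  have hη := tun.η_pos
  have ev_w := hpenalty.penalty_large.eventually_le_const hη
  have ev_α := hν.negligible.eventually_le_const hη
  have ev_D := hpenalty.eventually_le hsignal hη
  obtain ⟨A, hA0, hA⟩ := hcand.precision_ge.exists_pos
  have ev_ν := hν.tendsto.eventually_ge_atTop (max 1 (A / η ^ 2))
  have ev_κ : ∀ᶠ n in atTop, κ n * (T₂ + η) < 1 := by
    have := hκ.mul_const (T₂ + η)
    rw [zero_mul] at this
    exact this.eventually_lt_const one_pos
  -- `M^(12)` and `M^(13)` are used at the scale of the acceptance radius.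
  have hadm : AdmissibleScale S fun n => ρ n * ν n := by
    filter_upwards [hν.one_le, ev_α, ev_D, hpenalty.pos, eventually_ge_atTop 1] with
      n h1 h2 h3 h4 h5
    refine ⟨h1, le_iInf₂ fun j hj => ENNReal.ofReal_le_ofReal ?_⟩
    rw [div_le_iff₀ h4] at h2
    have h6 := h3 j hj
    have h7 : 0 ≤ (S n).d j ^ 2 * ((S n).delta j : ℝ) := by positivity
    nlinarith
  have hE := (((herror.prob11.inter (herror.prob1213 _ _ hadm hadm)).inter
    (herror.energy hc₁ hvar)).inter
    (withProbTendingToOne_abs_lt hcand.number (by positivity : 0 < c₁ / 12))).inter hdet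
  refine hE.mono ?_
  filter_upwards [hν.one_le, ev_w, ev_α, ev_D, hpenalty.pos, eventually_ge_atTop 1, hB, hA.bound,
    ev_ν, ev_κ, hν'] with n hα hw hαξ hξD hξ hn hBn hAn hνn hκn hν'n
  rintro ω ⟨⟨⟨⟨h11, h12, h13⟩, hlow, hupp⟩, hQ⟩, hdetω⟩
  have hν0 : 0 < ν n := by linarith [le_max_left 1 (A / η ^ 2)]
  have hρ : 0 < ρ n := by
    by_contra! hcon
    nlinarith
  -- Here the slowly diverging factor `ν` beats the constant in `max (w₁, w₂)² = O(ρ)`.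
  have hmax : max (w₁ n) (w₂ n) ≤ η * √(ρ n * ν n) := by
    rw [Real.norm_of_nonneg (sq_nonneg _), Real.norm_of_nonneg hρ.le] at hAn
    have h1 : A ≤ ν n * η ^ 2 := by
      rw [← div_le_iff₀ (by positivity)]
      exact (le_max_right _ _).trans hνn
    have h2 : max (w₁ n) (w₂ n) ^ 2 ≤ η ^ 2 * (ρ n * ν n) :=
      hAn.trans ((mul_le_mul_of_nonneg_right h1 hρ.le).trans (le_of_eq (by ring)))
    have h3 := Real.abs_le_sqrt h2
    rw [Real.sqrt_mul (sq_nonneg η), Real.sqrt_sq hη.le] at h3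
    exact (le_abs_self _).trans h3
  rw [div_le_iff₀ hξ] at hw hαξ
  refine mem_consistencyEvent tun hn (hsignal.valid n hn) hξ (by linarith) hw hαξ hξD
    ((le_max_left _ _).trans hmax) ((le_max_right _ _).trans hmax) (abs_nonneg B)
    (fun j hj => (hBn j hj).trans (le_abs_self B)) (hcand.subset n ω) h11 h12 h13 hlow hupp
    ((le_abs_self _).trans hQ.le) hκn hdetω ?_
  calc K * (ρ n * ν n) = ρ n * (K * ν n) := by ring
    _ ≤ ρ n * ν' n := by gcongr

end LocPrune

theorem mainTheorem1 {Ω : Type*} [MeasurableSpace Ω] (μ : Measure Ω) [IsProbabilityMeasure μ]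
    (ε : ℕ → Ω → ℝ) (S : ℕ → MeanModel) (w w₁ w₂ ξ ρ : ℕ → ℝ)
    (C : ℕ → Ω → Finset ℕ) (gL gR : ℕ → Ω → ℕ → ℕ) (h : ℕ → Ω → ℕ → ℝ)
    (hsignal : SignalAssumption S)
    (herror : ErrorAssumption μ ε S w w₁ w₂)
    (hsize : SizeAssumption S w)
    (hpenalty : PenaltyAssumption S w ξ)
    (hcand : CandidateAssumption μ S w w₁ w₂ ρ C)
    (ν : ℕ → ℝ) (hν : SlowRate ρ ξ ν)
    (hdet : DetectionIntervalAssumption μ S ξ ρ ν C gL gR)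
    (K : ℝ) (hK : 1 < K) (ν' : ℕ → ℝ) (hν' : ∀ᶠ n in atTop, K * ν n ≤ ν' n) :
    WithProbTendingToOne μ (fun n =>
      consistencyEvent n ε (S n) (ξ n) (C n) (gL n) (gR n) (h n) (ρ n * ν' n)) ∧
    Tendsto (fun n => μ.real
      (consistencyEvent n ε (S n) (ξ n) (C n) (gL n) (gR n) (h n) (ρ n * ν' n)))
      atTop (𝓝 1) ∧
    ∀ a b : ℕ → ℝ, AdmissibleScale S a → AdmissibleScale S b →
      ∃ r : ℕ → ℝ, Tendsto r atTop (𝓝 0) ∧ ∀ n,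
        μ.real (eventM n ε (S n) (w n) (w₁ n) (w₂ n) (ρ n) (a n) (b n) (C n)) + r n ≤
          μ.real (consistencyEvent n ε (S n) (ξ n) (C n) (gL n) (gR n) (h n)
            (ρ n * ν' n)) := by
  have h₁ : WithProbTendingToOne μ (fun n =>
      consistencyEvent n ε (S n) (ξ n) (C n) (gL n) (gR n) (h n) (ρ n * ν' n)) :=
    withProbTendingToOne_consistencyEvent hsignal herror hpenalty hcand hν hdet hK hν'
  have h₂ := (ENNReal.tendsto_toReal ENNReal.zero_ne_top).comp h₁
  have h₃ : ∀ n, 1 ≤ μ.real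
      (consistencyEvent n ε (S n) (ξ n) (C n) (gL n) (gR n) (h n) (ρ n * ν' n)) +
      μ.real (consistencyEvent n ε (S n) (ξ n) (C n) (gL n) (gR n) (h n) (ρ n * ν' n))ᶜ :=
    fun n => by
      have := measureReal_union_le (μ := μ)
        (consistencyEvent n ε (S n) (ξ n) (C n) (gL n) (gR n) (h n) (ρ n * ν' n))
        (consistencyEvent n ε (S n) (ξ n) (C n) (gL n) (gR n) (h n) (ρ n * ν' n))ᶜ
      rwa [Set.union_compl_self, probReal_univ] at this
  have h₄ : Tendsto (fun n => -μ.real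
      (consistencyEvent n ε (S n) (ξ n) (C n) (gL n) (gR n) (h n) (ρ n * ν' n))ᶜ) atTop (𝓝 0) := by
    simpa [Measure.real, Function.comp_def] using h₂.neg
  refine ⟨h₁, ?_, fun a b _ _ => ⟨_, h₄, fun n => ?_⟩⟩
  · have h₅ := h₄.const_add 1
    rw [add_zero] at h₅
    exact tendsto_of_tendsto_of_tendsto_of_le_of_le h₅ tendsto_const_nhds
      (fun n => by linarith [h₃ n]) (fun n => measureReal_le_one)
  · have := measureReal_le_one (μ := μ)
      (s := eventM n ε (S n) (w n) (w₁ n) (w₂ n) (ρ n) (a n) (b n) (C n))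
    linarith [h₃ n]
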